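/- **Setting.** Let $n\ge 2$, let $G\subset\mathbb{R}^{n-1}=\partial\mathbb{R}^n_+$ be a bounded Lipschitz domain, and let $\mu>0$ and $c_s>0$. For $r\in\mathbb{R}$ put $\tilde H^{r}(G)=\{u\in H^r(\mathbb{R}^{n-1}):\operatorname{supp}u\subset\overline G\}$ and $H^r(G)=H^r(\mathbb{R}^{n-1})/\tilde H^r(\mathbb{R}^{n-1}\setminus\overline G)$. For $\omega\in\mathbb{C}\setminus\{0\}$ let $$\|u\|_{r,\omega}=\Big(\int_{\mathbb{R}^{n-1}}(|\omega|^2+|\xi'|^2)^r|\hat u(\xi')|^2\,d\xi'\Big)^{1/2}.$$ Let $\|\cdot\|_{r,\omega,*}$ be its restriction to $\tilde H^r(G)$, and let $\|\cdot\|_{r,\omega,G}$ be the induced quotient norm on $H^r(G)$ (the infimum over all extensions). Let $\hat u(\omega)=\int e^{i\omega t}u(t)\,dt$ denote the Fourier–Laplace transform in time. For $\sigma>0$ and $s\in\mathbb{R}$, $H^s_\sigma(\mathbb{R}^+,\tilde H^r(G))$ is the space of distributions $u$ on $\mathbb{R}$ with values in $\tilde H^r(G)$ and support in $[0,\infty)$,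 such that $e^{-\sigma t}u$ is tempered and $$\|u\|_{s,r,\sigma,*}=\Big(\int_{\operatorname{Im}\omega=\sigma}|\omega|^{2s}\,\|\hat u(\omega)\|_{r,\omega,*}^2\,d\omega\Big)^{1/2}<\infty .$$ The space $H^s_\sigma(\mathbb{R}^+,H^r(G))$, with norm $\|\cdot\|_{s,r,\sigma}$, is defined in the same way from $H^r(G)$ and $\|\cdot\|_{r,\omega,G}$. The Dirichlet-to-Neumann operator $S_\sigma$ of the half-space $\mathbb{R}^n_+$ is given by $$\widehat{S_\sigma\varphi}(\omega,\xi')=-i\mu\,\Gamma(\omega,\xi')\,\hat\varphi(\omega,\xi'),\qquad \Gamma(\omega,\xi')=\sqrt{c_s^{-2}\omega^2-|\xi'|^2},\quad \operatorname{Im}\Gamma>0,\qquad \omega=\xi_0+i\sigma,$$ and $p_Q$ is the restriction to $Q=\mathbb{R}\times G$. Finally, let $$\langle\psi,\varphi\rangle_\sigma=\frac1{2\pi}\int_{\operatorname{Im}\omega=\sigma}\langle\hat\psi(\omega),\hat\varphi(\omega)\rangle_G\,d\omega ,$$ where $\langle\cdot,\cdot\rangle_G$ is the sesquilinear duality between $H^{-1/2}(G)$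 and $\tilde H^{1/2}(G)$ that extends $\int_G a\,\overline{v}\,dx'$. Thus $\langle\psi,\varphi\rangle_\sigma$ extends $\int_0^\infty e^{-2\sigma t}\int_G\psi\,\overline{\varphi}\,dx'\,dt$. **Theorem.** 1. For all $\sigma>0$ and $s\in\mathbb{R}$, $p_QS_\sigma$ is well defined and continuous from $H^s_\sigma(\mathbb{R}^+,\tilde H^{1/2}(G))$ to $H^s_\sigma(\mathbb{R}^+,H^{-1/2}(G))$: there is a constant $C$ with $\|p_QS_\sigma\varphi\|_{s,-\frac12,\sigma}\le C\|\varphi\|_{s,\frac12,\sigma,*}$. 2. There is a constant $C$ that does not depend on $\sigma$, and for every $\sigma>0$ a constant $\kappa_\sigma>0$, such that for all $\varphi\in H^0_\sigma(\mathbb{R}^+,\tilde H^{1/2}(G))$ the pairing $\langle p_QS_\sigma\varphi,\varphi\rangle_\sigma$ exists and $$\kappa_\sigma\,\|\varphi\|_{-\frac12,\frac12,\sigma,*}^2\le \operatorname{Re}\langle p_QS_\sigma\varphi,\varphi\rangle_\sigma\quad\text{and}\quad |\langle p_QS_\sigma\varphi,\varphi\rangle_\sigma|\le C\,\|\varphi\|_{0,\frac12,\sigma,*}^2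 .$$ -/

import Mathlib

open MeasureTheory Complex TopologicalSpace
open scoped SchwartzMap Distributions ENNReal NNReal FourierTransform

noncomputable section
namespace DtN

/-- The boundary `ℝ^d` of the half-space `ℝ^{d+1}_+`. -/
abbrev Space (d : ℕ) : Type := EuclideanSpace ℝ (Fin d)

/-- The weight `(1 + |ξ|²)^r`. -/
def bessel {d : ℕ} (r : ℝ) (ξ : Space d) : ℝ := (1 + ‖ξ‖ ^ 2) ^ r

/-- The measure `(1 + |ξ|²)^r dξ` on the frequency side. -/
def sobolevMeasure (d : ℕ) (r : ℝ) : Measure (Space d) :=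
  volume.withDensity fun ξ => ENNReal.ofReal (bessel r ξ)

/-- The Sobolev space `H^r(ℝ^d)`, each element being given by its Fourier transform
`û(ξ) = ∫ e^{-i⟨x,ξ⟩} u(x) dx`, which is a function that is square integrable with respect to
`(1 + |ξ|²)^r dξ`; so `u ξ` stands for `û(ξ)`. The tempered distribution itself is
`toDistribution u` below. -/
abbrev Sobolev (d : ℕ) (r : ℝ) : Type := Lp ℂ 2 (sobolevMeasure d r)

/-- `ξ ↦ ∫ e^{i⟨x,ξ⟩} g(x) dx`. -/
def expTransform {d : ℕ} (g : Space d → ℂ) (ξ : Space d) : ℂ :=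
  ∫ x, cexp (I * (inner ℝ x ξ : ℝ)) * g x

/-- The tempered distribution on `ℝ^d` with Fourier transform `u`:
`g ↦ (2π)^{-d} ∫ û(ξ) (∫ e^{i⟨x,ξ⟩} g(x) dx) dξ`. -/
def toDistribution {d : ℕ} {r : ℝ} (u : Sobolev d r) (g : 𝓢(Space d, ℂ)) : ℂ :=
  (((2 * Real.pi : ℝ) : ℂ) ^ d)⁻¹ * ∫ ξ, u ξ * expTransform g ξ

lemma bessel_pos {d : ℕ} (r : ℝ) (ξ : Space d) : 0 < bessel r ξ :=
  Real.rpow_pos_of_pos (by positivity) r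

lemma continuous_bessel {d : ℕ} (r : ℝ) : Continuous (bessel r : Space d → ℝ) := by
  unfold bessel
  exact Continuous.rpow_const (by fun_prop) fun ξ => Or.inl (by positivity)

instance (d : ℕ) (r : ℝ) : (sobolevMeasure d r).HasTemperateGrowth where
  exists_integrable := by
    obtain ⟨n, hn⟩ := (inferInstance : (volume : Measure (Space d)).HasTemperateGrowth)
    obtain ⟨m, hm⟩ := exists_nat_ge (2 * |r|)
    refine ⟨n + m, ?_⟩
    unfold sobolevMeasure
    rw [integrable_withDensity_iff (by have := (continuous_bessel (d := d) r).measurable; fun_prop)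
      (Filter.Eventually.of_forall fun _ => ENNReal.ofReal_lt_top)]
    refine hn.mono' ?_ (Filter.Eventually.of_forall fun ξ => ?_)
    · refine Measurable.aestronglyMeasurable ?_
      have := (continuous_bessel (d := d) r).measurable
      fun_prop
    · have h1 : (1 : ℝ) ≤ 1 + ‖ξ‖ := by linarith [norm_nonneg ξ]
      have h0 : (0 : ℝ) < 1 + ‖ξ‖ := by linarith
      have hb : bessel r ξ ≤ (1 + ‖ξ‖) ^ (m : ℝ) := by
        unfold bessel
        calc (1 + ‖ξ‖ ^ 2) ^ r ≤ (1 + ‖ξ‖ ^ 2) ^ |r| :=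
              Real.rpow_le_rpow_of_exponent_le (by nlinarith [norm_nonneg ξ]) (le_abs_self r)
          _ ≤ ((1 + ‖ξ‖) ^ (2:ℝ)) ^ |r| := by
              refine Real.rpow_le_rpow (by positivity) ?_ (abs_nonneg r)
              rw [Real.rpow_two]; nlinarith [norm_nonneg ξ]
          _ = (1 + ‖ξ‖) ^ (2 * |r|) := (Real.rpow_mul h0.le _ _).symm
          _ ≤ _ := Real.rpow_le_rpow_of_exponent_le h1 hm
      rw [ENNReal.toReal_ofReal (bessel_pos r ξ).le, Real.norm_of_nonneg
        (mul_nonneg (Real.rpow_nonneg h0.le _) (bessel_pos r ξ).le)]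
      calc _ ≤ (1 + ‖ξ‖) ^ (-((n + m : ℕ) : ℝ)) * (1 + ‖ξ‖) ^ (m : ℝ) := by gcongr
        _ = _ := by rw [← Real.rpow_add h0]; push_cast; ring_nf

/-- The transformed test function is again a Schwartz function. -/
lemma exists_schwartz_expTransform {d : ℕ} (g : 𝓢(Space d, ℂ)) (r : ℝ) :
    ∃ h : 𝓢(Space d, ℂ), ∀ ξ, expTransform g ξ = bessel r ξ * h ξ := by
  have hp : (2 * Real.pi)⁻¹ ≠ 0 := by positivity
  let L : Space d ≃L[ℝ] Space d := ContinuousLinearEquiv.smulLeft (Units.mk0 _ hp)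
  let G : 𝓢(Space d, ℂ) := SchwartzMap.compCLMOfContinuousLinearEquiv ℂ L (𝓕⁻ g)
  have hb : (fun ξ : Space d => ((bessel (-r) ξ : ℝ) : ℂ)).HasTemperateGrowth := by
    unfold bessel; fun_prop
  refine ⟨SchwartzMap.smulLeftCLM ℂ (fun ξ : Space d => ((bessel (-r) ξ : ℝ) : ℂ)) G, fun ξ => ?_⟩
  rw [SchwartzMap.smulLeftCLM_apply_apply hb]
  have h1 : (bessel r ξ : ℂ) * (bessel (-r) ξ : ℂ) = 1 := by
    rw [← ofReal_mul]
    unfold bessel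
    rw [← Real.rpow_add (by positivity)]; simp
  rw [smul_eq_mul, ← mul_assoc, h1, one_mul]
  simp only [G, SchwartzMap.compCLMOfContinuousLinearEquiv_apply, Function.comp,
    SchwartzMap.fourierInv_coe, Real.fourierInv_eq', expTransform, L]
  congr 1 with x
  rw [smul_eq_mul]
  congr 2
  simp [ContinuousLinearEquiv.smulLeft, Units.smul_def, inner_smul_right]
  have : (Real.pi : ℂ) ≠ 0 := by exact_mod_cast Real.pi_ne_zero
  field_simp

/-- Testing against a fixed Schwartz function is continuous and linear on the Sobolev space. -/
lemma exists_clm_toDistribution {d : ℕ} {r : ℝ} (g : 𝓢(Space d, ℂ)) :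
    ∃ Λ : Sobolev d r →L[ℂ] ℂ, ∀ u, Λ u = toDistribution u g := by
  obtain ⟨h, hh⟩ := exists_schwartz_expTransform g r
  have hm : MemLp (fun ξ => (starRingEnd ℂ) (h ξ)) 2 (sobolevMeasure d r) :=
    (h.memLp 2 (sobolevMeasure d r)).star
  refine ⟨(((2 * Real.pi : ℝ) : ℂ) ^ d)⁻¹ • innerSL ℂ (hm.toLp _), fun u => ?_⟩
  simp only [smul_apply, innerSL_apply_apply, smul_eq_mul, toDistribution]
  refine congrArg _ ?_
  rw [L2.inner_def]
  have e : ∀ᵐ ξ ∂(sobolevMeasure d r), inner ℂ (hm.toLp _ ξ) (u ξ) = u ξ * h ξ := by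
    filter_upwards [hm.coeFn_toLp] with ξ hξ
    rw [hξ]; simp [RCLike.inner_apply]
  rw [integral_congr_ae e]
  unfold sobolevMeasure
  rw [integral_withDensity_eq_integral_toReal_smul
    (by have := (continuous_bessel (d := d) r).measurable; fun_prop)
    (Filter.Eventually.of_forall fun _ => ENNReal.ofReal_lt_top)]
  congr 1 with ξ
  rw [ENNReal.toReal_ofReal (bessel_pos r ξ).le, hh, real_smul]
  ring

/-- The elements of `H^r(ℝ^d)` whose support lies in the closed set `K`. -/
def supportedIn (d : ℕ) (r : ℝ) (K : Set (Space d)) : Submodule ℂ (Sobolev d r) where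
  carrier := {u | Distribution.IsVanishingOn (toDistribution u) Kᶜ}
  zero_mem' g _ := by
    obtain ⟨Λ, hΛ⟩ := exists_clm_toDistribution (r := r) g
    rw [← hΛ, map_zero]
  add_mem' {u v} hu hv g hg := by
    obtain ⟨Λ, hΛ⟩ := exists_clm_toDistribution (r := r) g
    rw [← hΛ, map_add, hΛ, hΛ, hu g hg, hv g hg, add_zero]
  smul_mem' c u hu g hg := by
    obtain ⟨Λ, hΛ⟩ := exists_clm_toDistribution (r := r) g
    rw [← hΛ, map_smul, hΛ, hu g hg, smul_zero]

instance (d : ℕ) (r : ℝ) (K : Set (Space d)) :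
    IsClosed (supportedIn d r K : Set (Sobolev d r)) := by
  have : (supportedIn d r K : Set (Sobolev d r)) =
      ⋂ (g : 𝓢(Space d, ℂ)) (_ : tsupport g ⊆ Kᶜ), {u | toDistribution u g = 0} := by
    ext u; simp [supportedIn, Distribution.IsVanishingOn]
  rw [this]
  refine isClosed_iInter fun g => isClosed_iInter fun _ => ?_
  obtain ⟨Λ, hΛ⟩ := exists_clm_toDistribution (r := r) g
  simp only [← hΛ]
  exact isClosed_eq Λ.continuous continuous_const

/-- `H̃^r(G)`: the elements of `H^r(ℝ^d)` with support in the closure of `G`. -/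
abbrev TildeH (d : ℕ) (r : ℝ) (G : Set (Space d)) : Type := supportedIn d r (closure G)

/-- `H^r(G)`: the quotient of `H^r(ℝ^d)` by `H̃^r(ℝ^d ∖ closure G)`. -/
abbrev QuotH (d : ℕ) (r : ℝ) (G : Set (Space d)) : Type :=
  Sobolev d r ⧸ supportedIn d r (closure (closure G)ᶜ)

/-- The restriction map `p_G : H^r(ℝ^d) → H^r(G)`. -/
def restrict {d : ℕ} {r : ℝ} (G : Set (Space d)) (u : Sobolev d r) : QuotH d r G :=
  Submodule.Quotient.mk u

/-- The frequency dependent norm `‖u‖_{r,ω} = (∫ (|ω|² + |ξ|²)^r |û(ξ)|² dξ)^{1/2}`. -/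
def freqNorm {d : ℕ} {r : ℝ} (ω : ℂ) (u : Sobolev d r) : ℝ≥0∞ :=
  (∫⁻ ξ, ENNReal.ofReal ((‖ω‖ ^ 2 + ‖ξ‖ ^ 2) ^ r) * ‖u ξ‖ₑ ^ 2) ^ (1 / 2 : ℝ)

/-- The norm `‖u‖_{r,ω,G,*}` on `H̃^r(G)`. -/
def tildeNorm {d : ℕ} {r : ℝ} {G : Set (Space d)} (ω : ℂ) (u : TildeH d r G) : ℝ≥0∞ :=
  freqNorm ω (u : Sobolev d r)

/-- The norm `‖a‖_{r,ω,G}` on `H^r(G)`: the infimum over all extensions of `a` to `ℝ^d`. -/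
def quotNorm {d : ℕ} {r : ℝ} {G : Set (Space d)} (ω : ℂ) (a : QuotH d r G) : ℝ≥0∞ :=
  ⨅ (u : Sobolev d r) (_ : restrict G u = a), freqNorm ω u

section VectorValued

variable {E : Type*} [NormedAddCommGroup E] [NormedSpace ℂ E]

/-- The tempered distribution `T` equals `e^{-σt} u`, that is `u(g) = T(e^{σt} g)` for all test
functions `g` on `ℝ`. -/
def IsExpWeighted (σ : ℝ) (u : 𝓓'((⊤ : Opens ℝ), E)) (T : 𝓢'(ℝ, E)) : Prop :=
  ∀ (g : 𝓓((⊤ : Opens ℝ), ℝ)) (h : 𝓢(ℝ, ℂ)),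
    (∀ t, h t = ((Real.exp (σ * t) * g t : ℝ) : ℂ)) → u g = T h

/-- `f(ξ₀) = û(ξ₀ + iσ)` for almost every `ξ₀`, where `û(ω) = ∫ e^{iωt} u(t) dt` is the
Fourier-Laplace transform: `e^{-σt} u` is tempered and the function `f` is its Fourier transform,
`⟨e^{-σt} u, h⟩ = ∫ k(ξ₀) f(ξ₀) dξ₀` whenever `h(t) = ∫ e^{iξ₀t} k(ξ₀) dξ₀`. -/
structure HasFourierLaplace (σ : ℝ) (u : 𝓓'((⊤ : Opens ℝ), E)) (f : ℝ → E) : Prop where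
  aestronglyMeasurable : AEStronglyMeasurable f volume
  integrable : ∀ k : 𝓢(ℝ, ℂ), Integrable fun ξ₀ => k ξ₀ • f ξ₀
  exists_tempered : ∃ T : 𝓢'(ℝ, E), IsExpWeighted σ u T ∧
    ∀ k h : 𝓢(ℝ, ℂ), (∀ t : ℝ, h t = ∫ ξ₀ : ℝ, cexp (I * ξ₀ * t) * k ξ₀) →
      T h = ∫ ξ₀, k ξ₀ • f ξ₀

/-- The norm `(∫_{Im ω = σ} |ω|^{2s} N(ω, û(ω))² dω)^{1/2}`; it is `∞` if `û` is not a function on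
the line `Im ω = σ`. As `û` is unique up to null sets, the infimum has at most one value. -/
def spaceTimeNorm (σ s : ℝ) (N : ℂ → E → ℝ≥0∞) (u : 𝓓'((⊤ : Opens ℝ), E)) : ℝ≥0∞ :=
  ⨅ (f : ℝ → E) (_ : HasFourierLaplace σ u f),
    (∫⁻ ξ₀ : ℝ, ENNReal.ofReal (‖(ξ₀ + σ * I : ℂ)‖ ^ (2 * s)) * N (ξ₀ + σ * I) (f ξ₀) ^ 2) ^
      (1 / 2 : ℝ)

/-- The distributions `u` on `ℝ` with values in `E` and support in `[0, ∞)` such that `e^{-σt} u`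
is tempered and the above norm is finite. -/
def spaceTimeSobolev (σ s : ℝ) (N : ℂ → E → ℝ≥0∞) : Set 𝓓'((⊤ : Opens ℝ), E) :=
  {u | Distribution.IsVanishingOn u (Set.Iio (0 : ℝ)) ∧ (∃ T, IsExpWeighted σ u T) ∧
    spaceTimeNorm σ s N u < ⊤}

end VectorValued

variable {d : ℕ}

/-- `Γ(ω, ξ) = √(c⁻² ω² - |ξ|²)`, with the branch of positive imaginary part for `Im ω > 0`, for
which `Γ(ω, ξ) ≈ c⁻¹ ω` when `|ω| ≫ |ξ|`. -/
def symbolRoot (c : ℝ) (ω : ℂ) (ξ : Space d) : ℂ :=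
  I * (((‖ξ‖ ^ 2 : ℝ) : ℂ) - ω ^ 2 / (c : ℂ) ^ 2) ^ (1 / 2 : ℂ)

/-- `ψ = p_Q S_σ φ`, where `S_σ` multiplies the Fourier-Laplace transform in time and Fourier
transform in space by `-iμ Γ(ω, ξ)`, `ω = ξ₀ + iσ`, and `p_Q` restricts to `Q = ℝ × G`. -/
def IsDirichletToNeumann (σ μ c : ℝ) (G : Set (Space d))
    (φ : 𝓓'((⊤ : Opens ℝ), TildeH d (1 / 2) G)) (ψ : 𝓓'((⊤ : Opens ℝ), QuotH d (-1 / 2) G)) :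
    Prop :=
  ∃ (f : ℝ → TildeH d (1 / 2) G) (k : ℝ → QuotH d (-1 / 2) G) (F : ℝ → Sobolev d (-1 / 2)),
    HasFourierLaplace σ φ f ∧ HasFourierLaplace σ ψ k ∧
    (∀ᵐ ξ₀ : ℝ, ∀ᵐ ξ : Space d, F ξ₀ ξ =
      -I * μ * symbolRoot c (ξ₀ + σ * I) ξ * (f ξ₀ : Sobolev d (1 / 2)) ξ) ∧
    ∀ᵐ ξ₀ : ℝ, k ξ₀ = restrict G (F ξ₀)

/-- The sesquilinear duality `(2π)^{-d} ∫ û(ξ) conj(v̂(ξ)) dξ` of `H^{-r}(ℝ^d)` and `H^r(ℝ^d)`,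
which extends `∫ u conj(v) dx`. -/
def sobolevPairing {r r' : ℝ} (u : Sobolev d r') (v : Sobolev d r) : ℂ :=
  (((2 * Real.pi : ℝ) : ℂ) ^ d)⁻¹ * ∫ ξ, u ξ * starRingEnd ℂ (v ξ)

/-- `z = ⟨a, v⟩_G` for `a ∈ H^{-1/2}(G)` and `v ∈ H̃^{1/2}(G)`: every extension `u` of `a` to `ℝ^d`
satisfies `⟨u, v⟩ = z`. -/
def IsDualPairing {G : Set (Space d)} (a : QuotH d (-1 / 2) G) (v : TildeH d (1 / 2) G) (z : ℂ) :
    Prop :=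
  ∀ u : Sobolev d (-1 / 2), restrict G u = a → sobolevPairing u (v : Sobolev d (1 / 2)) = z

/-- `z = ⟨ψ, φ⟩_σ = (2π)^{-1} ∫_{Im ω = σ} ⟨ψ̂(ω), φ̂(ω)⟩_G dω`, which by Plancherel's theorem
extends `∫_0^∞ e^{-2σt} ∫_G ψ conj(φ) dx dt`; the integral is required to exist. -/
def IsSpaceTimePairing {G : Set (Space d)} (σ : ℝ) (ψ : 𝓓'((⊤ : Opens ℝ), QuotH d (-1 / 2) G))
    (φ : 𝓓'((⊤ : Opens ℝ), TildeH d (1 / 2) G)) (z : ℂ) : Prop :=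
  ∃ (k : ℝ → QuotH d (-1 / 2) G) (f : ℝ → TildeH d (1 / 2) G) (p : ℝ → ℂ),
    HasFourierLaplace σ ψ k ∧ HasFourierLaplace σ φ f ∧
    (∀ᵐ ξ₀ : ℝ, IsDualPairing (k ξ₀) (f ξ₀) (p ξ₀)) ∧ Integrable p ∧
    z = ((2 * Real.pi : ℝ) : ℂ)⁻¹ * ∫ ξ₀, p ξ₀

/-- A Lipschitz domain: an open set that near each boundary point is, in the direction of some unit
vector `e`, the part above the graph of a Lipschitz function on the hyperplane orthogonal to
`e`. -/
def IsLipschitzDomain (G : Set (Space d)) : Prop :=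
  IsOpen G ∧ ∀ p ∈ frontier G, ∃ (e : Space d) (L : ℝ≥0) (γ : Space d → ℝ) (U : Set (Space d)),
    ‖e‖ = 1 ∧ LipschitzWith L γ ∧ IsOpen U ∧ p ∈ U ∧
    ∀ x ∈ U, x ∈ G ↔ γ (x - (inner ℝ e x : ℝ) • e) < inner ℝ e x

end DtN
end

open DtN

/-! On the line `Im ω = σ` the operator is multiplication by `μ (|ξ|² - ω²/c²)^{1/2}` with the
principal root, so both estimates reduce to pointwise bounds for this root. Its square has modulus
at most `|ξ|² + |ω|²/c²`, hence the root is at most `(1 + c⁻¹) (|ω|² + |ξ|²)^{1/2}` with no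
dependence on `σ` (`norm_realRoot_le`). This gives the mapping property and the upper bound of the
form.

For coercivity write the root as `x + iy` and `ω/c = m + il`. Then `x² - y² = |ξ|² - m² + l²` and
`xy = -ml`, which force `x ≥ l` and `l² (x² + y²) ≤ x² (l² + m²)`. Hence the real part is at least a
multiple of `σ |ω|⁻¹ (|ω|² + |ξ|²)^{1/2}` (`le_re_realRoot`). The lost factor `|ω|⁻¹` is the time
order `-1/2` on the left of the lower bound. Integration over `ξ` and `ξ₀` finishes both estimates.

Three qualitative points need more work. First, the image must be supported in `[0, ∞)`. For fixed
`ξ` the symbol is holomorphic in the upper half-plane with linear growth, while a test function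
supported in `t ≤ -ε` has a transform that decays like `e^{-ε Im ω}` times any negative power of
`|ω|`. Shifting the contour upwards shows that their product is again the transform of a function
supported in `t ≤ -ε` (`exists_schwartz_mul_holomorphic`). Since the symbol also depends on `ξ`, it
is replaced by simple functions of `ξ`, which turn the operator into a finite sum of scalar symbols
times fixed bounded operators; dominated convergence passes to the limit (`integral_dtnOp_eq_zero`).

Second, the pairing on `G` must not depend on the extension: elements of `H^{-1/2}` supported in the
closed exterior annihilate `H̃^{1/2}(G)` (`sobolevPairing_eq_zero`). A partition of unity localizes.
Near the boundary a small translation along the graph direction separates the supports, and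
mollification then reduces the pairing to a distribution tested off its support. This is where the
Lipschitz property enters.

Third, distributions in time and their transforms must determine each other. Square integrability
with a power weight yields polynomial growth in the mean, so the multiplied transform defines a
tempered distribution; density of compactly supported functions gives uniqueness. -/

noncomputable section
namespace DtN

/-! ### The Fourier transform without `2π` in the exponent -/

section ExpTransform

variable {V : Type*} [NormedAddCommGroup V] [InnerProductSpace ℝ V] [FiniteDimensional ℝ V]
  [MeasurableSpace V] [BorelSpace V]

variable (V) in
/-- The dilation by `(2π)⁻¹`. -/
def dilation : V ≃L[ℝ] V :=
  ContinuousLinearEquiv.smulLeft (Units.mk0 (2 * Real.pi)⁻¹ (by positivity))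

lemma dilation_apply {V : Type*} [NormedAddCommGroup V] [InnerProductSpace ℝ V] (x : V) :
    dilation V x = (2 * Real.pi)⁻¹ • x := rfl

lemma dilation_symm_apply {V : Type*} [NormedAddCommGroup V] [InnerProductSpace ℝ V] (x : V) :
    (dilation V).symm x = (2 * Real.pi) • x := by
  rw [ContinuousLinearEquiv.symm_apply_eq, dilation_apply, smul_smul,
    inv_mul_cancel₀ (by positivity), one_smul]

variable (V) in
/-- The map `k ↦ (x ↦ ∫ e^{i⟨ξ,x⟩} k(ξ) dξ)` on Schwartz functions. -/
def expMap : 𝓢(V, ℂ) →L[ℂ] 𝓢(V, ℂ) :=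
  (SchwartzMap.compCLMOfContinuousLinearEquiv ℂ (dilation V)).comp
    (FourierTransform.fourierInvCLM ℂ 𝓢(V, ℂ))

variable (V) in
/-- The inverse of `expMap`. -/
def expMapInv : 𝓢(V, ℂ) →L[ℂ] 𝓢(V, ℂ) :=
  (FourierTransform.fourierCLM ℂ 𝓢(V, ℂ)).comp
    (SchwartzMap.compCLMOfContinuousLinearEquiv ℂ (dilation V).symm)

lemma expMap_apply (k : 𝓢(V, ℂ)) (x : V) :
    expMap V k x = ∫ ξ, cexp (I * (inner ℝ ξ x : ℝ)) * k ξ := by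
  have hp : (Real.pi : ℂ) ≠ 0 := by exact_mod_cast Real.pi_ne_zero
  simp only [expMap, ContinuousLinearMap.comp_apply, FourierTransform.fourierInvCLM_apply,
    SchwartzMap.compCLMOfContinuousLinearEquiv_apply, Function.comp, SchwartzMap.fourierInv_coe,
    Real.fourierInv_eq', dilation_apply]
  congr 1 with ξ
  rw [smul_eq_mul]
  congr 2
  simp only [inner_smul_right]
  push_cast
  field_simp

@[simp]
lemma expMap_expMapInv (h : 𝓢(V, ℂ)) : expMap V (expMapInv V h) = h := by
  ext x
  simp [expMap, expMapInv]

@[simp]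
lemma expMapInv_expMap (h : 𝓢(V, ℂ)) : expMapInv V (expMap V h) = h := by
  have : SchwartzMap.compCLMOfContinuousLinearEquiv ℂ (dilation V).symm
      (SchwartzMap.compCLMOfContinuousLinearEquiv ℂ (dilation V) (𝓕⁻ h)) = 𝓕⁻ h := by
    ext x; simp
  simp [expMap, expMapInv, this]

/-- The explicit kernel serves to continue the transform of a compactly supported function off the
real line. -/
lemma expMapInv_real_apply (h : 𝓢(ℝ, ℂ)) (ξ : ℝ) :
    expMapInv ℝ h ξ = ((2 * Real.pi : ℝ) : ℂ)⁻¹ * ∫ t : ℝ, cexp (-(I * ξ * t)) * h t := by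
  have h1 := Measure.integral_comp_mul_left
    (fun t : ℝ => cexp (-(I * ξ * t)) * h t) (2 * Real.pi)
  rw [abs_of_pos (by positivity)] at h1
  simp only [expMapInv, ContinuousLinearMap.comp_apply, FourierTransform.fourierCLM_apply,
    SchwartzMap.fourier_coe, Real.fourier_real_eq_integral_exp_smul, smul_eq_mul,
    SchwartzMap.compCLMOfContinuousLinearEquiv_apply, Function.comp, dilation_symm_apply]
  rw [real_smul, ofReal_inv] at h1
  rw [← h1]
  congr 1 with t
  congr 2
  push_cast; ring

end ExpTransform

/-! ### Density of compactly supported Schwartz functions -/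

section Density

/-- Schwartz functions on the line are limits of compactly supported ones, whose supports are not
larger. -/
lemma exists_seq_compactSupport (h : 𝓢(ℝ, ℂ)) :
    ∃ u : ℕ → 𝓢(ℝ, ℂ), (∀ n, HasCompactSupport (u n)) ∧ (∀ n, tsupport (u n) ⊆ tsupport h) ∧
      Filter.Tendsto u Filter.atTop (nhds h) := by
  let χ : ContDiffBump (0 : ℝ) := ⟨1, 2, one_pos, one_lt_two⟩
  have hχ : ContDiff ℝ ((⊤ : ℕ∞) : WithTop ℕ∞) (fun t : ℝ => (χ t : ℂ)) :=
    ofRealCLM.contDiff.comp χ.contDiff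
  have hχc : HasCompactSupport (fun t : ℝ => (χ t : ℂ)) :=
    χ.hasCompactSupport.comp_left (g := ofReal) ofReal_zero
  let a : ℕ → ℝ → ℂ := fun n t => χ ((n + 1 : ℝ)⁻¹ * t)
  have han (n : ℕ) : (0 : ℝ) < n + 1 := by positivity
  have haS (n : ℕ) : ContDiff ℝ ((⊤ : ℕ∞) : WithTop ℕ∞) (a n) :=
    hχ.comp (contDiff_const.mul contDiff_id)
  have hac (n : ℕ) : HasCompactSupport (a n) := by
    have := hχc.comp_homeomorph (Homeomorph.mulLeft₀ (n + 1 : ℝ)⁻¹ (by have := han n; positivity))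
    exact this
  have hbd (i : ℕ) : ∃ C : ℝ, 0 ≤ C ∧ ∀ n t, ‖iteratedDeriv i (fun t => a n t - 1) t‖ ≤ C := by
    obtain ⟨C, hC⟩ := (hχ.continuous_iteratedDeriv i (by exact_mod_cast le_top)).norm
      |>.bounded_above_of_compact_support (by
        have := (hχc.iteratedFDeriv (𝕜 := ℝ) i).norm
        simpa [norm_iteratedFDeriv_eq_norm_iteratedDeriv] using this)
    have hb : ContDiff ℝ ((⊤ : ℕ∞) : WithTop ℕ∞) (fun t : ℝ => (χ t : ℂ) - 1) :=
      hχ.sub contDiff_const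
    have hle : ∀ t, ‖iteratedDeriv i (fun t : ℝ => (χ t : ℂ) - 1) t‖ ≤ C + 1 := fun t => by
      rw [iteratedDeriv_fun_sub ((hχ.of_le (by exact_mod_cast le_top)).contDiffAt)
        contDiff_const.contDiffAt, iteratedDeriv_const]
      refine (norm_sub_le _ _).trans (add_le_add (by simpa using hC t) ?_)
      split_ifs <;> simp
    have hC0 : 0 ≤ C + 1 := (norm_nonneg _).trans (hle 0)
    refine ⟨C + 1, hC0, fun n t => ?_⟩
    have := iteratedDeriv_comp_const_smul
      (hb.of_le (by exact_mod_cast le_top : (i : WithTop ℕ∞) ≤ _)) (n + 1 : ℝ)⁻¹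
    rw [show (fun t => a n t - 1) = fun t : ℝ => (χ ((n + 1 : ℝ)⁻¹ * t) : ℂ) - 1 from rfl, this,
      norm_smul]
    -- Dilation multiplies the `i`-th derivative by `(n + 1)^{-i} ≤ 1`, so one constant serves all
    -- `n`.
    refine (mul_le_of_le_one_left (norm_nonneg _) ?_).trans (hle _)
    rw [norm_pow, norm_inv, Real.norm_of_nonneg (han n).le]
    exact pow_le_one₀ (by have := han n; positivity) (inv_le_one_of_one_le₀ (by simp))
  have hmul (n : ℕ) : ContDiff ℝ ((⊤ : ℕ∞) : WithTop ℕ∞) (fun t => a n t * h t) :=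
    (haS n).mul (h.smooth _)
  refine ⟨fun n => (hac n).mul_right.toSchwartzMap (hmul n), fun n => ?_, fun n => ?_, ?_⟩
  · exact (hac n).mul_right
  · exact tsupport_mul_subset_right
  · rw [(schwartz_withSeminorms ℝ ℝ ℂ).tendsto_nhds]
    rintro ⟨k, m⟩ ε hε
    choose C hC0 hC using hbd
    set M : ℝ := ∑ i ∈ Finset.range (m + 1),
      (m.choose i : ℝ) * C i * SchwartzMap.seminorm ℝ (k + 1) (m - i) h with hM
    have hM0 : 0 ≤ M := Finset.sum_nonneg fun i _ =>
      mul_nonneg (mul_nonneg (by positivity) (hC0 i)) (apply_nonneg _ _)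
    have hlim : Filter.Tendsto (fun n : ℕ => (n + 1 : ℝ)⁻¹ * M) Filter.atTop (nhds 0) := by
      simpa using (tendsto_one_div_add_atTop_nhds_zero_nat (𝕜 := ℝ)).mul_const M
    filter_upwards [(tendsto_order.1 hlim).2 ε hε] with n hn
    refine lt_of_le_of_lt ?_ hn
    refine SchwartzMap.seminorm_le_bound' ℝ k m _ (by have := han n; positivity) fun t => ?_
    have hcoe : ⇑((hac n).mul_right.toSchwartzMap (hmul n) - h) =
        fun t => (a n t - 1) * h t := by
      ext t; simp [sub_mul]
    rw [hcoe]
    -- For `|t| < n + 1` the cutoff is locally `1` and the difference vanishes. Otherwise `1 ≤ |t| /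
    -- (n + 1)`, and one more power of `|t|`, absorbed by the seminorm of order `k + 1`, buys the
    -- factor `(n + 1)⁻¹`.
    rcases lt_or_ge |t| (n + 1) with ht | ht
    · have hz : (fun t => (a n t - 1) * h t) =ᶠ[nhds t] fun _ => 0 := by
        filter_upwards [continuous_abs.isOpen_preimage _ isOpen_Iio |>.mem_nhds ht] with s hs
        have : χ ((n + 1 : ℝ)⁻¹ * s) = 1 := by
          refine χ.one_of_mem_closedBall ?_
          rw [mem_closedBall_zero_iff, Real.norm_eq_abs, abs_mul,
            abs_of_pos (inv_pos.2 (han n)), inv_mul_le_iff₀ (han n)]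
          simpa [χ] using le_of_lt hs
        simp [a, this]
      rw [hz.iteratedDeriv_eq, iteratedDeriv_const]
      simp only [ite_self, norm_zero, mul_zero]
      have := han n; positivity
    · have hL := norm_iteratedFDeriv_mul_le (𝕜 := ℝ) ((haS n).sub contDiff_const) (h.smooth _) t
        (n := m) (by exact_mod_cast le_top : (m : WithTop ℕ∞) ≤ ((⊤ : ℕ∞) : WithTop ℕ∞))
        (g := h) (f := fun t => a n t - 1)
      simp only [norm_iteratedFDeriv_eq_norm_iteratedDeriv] at hL
      have ht0 : 0 < |t| := (han n).trans_le ht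
      calc |t| ^ k * ‖iteratedDeriv m (fun t => (a n t - 1) * h t) t‖
          ≤ |t| ^ k * ∑ i ∈ Finset.range (m + 1), (m.choose i : ℝ) *
              ‖iteratedDeriv i (fun t => a n t - 1) t‖ * ‖iteratedDeriv (m - i) h t‖ := by gcongr
        _ ≤ (n + 1 : ℝ)⁻¹ * |t| ^ (k + 1) * ∑ i ∈ Finset.range (m + 1), (m.choose i : ℝ) *
              ‖iteratedDeriv i (fun t => a n t - 1) t‖ * ‖iteratedDeriv (m - i) h t‖ := by
            refine mul_le_mul_of_nonneg_right ?_ (Finset.sum_nonneg fun _ _ => by positivity)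
            rw [pow_succ', ← mul_assoc]
            refine le_mul_of_one_le_left (by positivity) ?_
            rw [inv_mul_eq_div, one_le_div (han n)]; exact ht
        _ ≤ (n + 1 : ℝ)⁻¹ * M := by
            rw [mul_assoc, Finset.mul_sum]
            refine mul_le_mul_of_nonneg_left (Finset.sum_le_sum fun i _ => ?_)
              (inv_pos.2 (han n)).le
            calc _ = (m.choose i : ℝ) * ‖iteratedDeriv i (fun t => a n t - 1) t‖ *
                  (|t| ^ (k + 1) * ‖iteratedDeriv (m - i) h t‖) := by ring
              _ ≤ _ := by
                gcongr
                · exact mul_nonneg (by positivity) (hC0 i)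
                · exact hC i n t
                · exact SchwartzMap.le_seminorm' ℝ (k + 1) (m - i) h t

end Density

/-! ### Weighted distributions in time and their transforms -/

section FourierLaplace

variable {E : Type*} [NormedAddCommGroup E] [NormedSpace ℂ E]

/-- A compactly supported Schwartz function, times an exponential, as a pair of real test
functions. -/
lemma exists_testFunctions (σ : ℝ) (h : 𝓢(ℝ, ℂ)) (hc : HasCompactSupport h) :
    ∃ g₁ g₂ : 𝓓((⊤ : Opens ℝ), ℝ), tsupport g₁ ⊆ tsupport h ∧ tsupport g₂ ⊆ tsupport h ∧
      ∀ (u : 𝓓'((⊤ : Opens ℝ), E)) (T : 𝓢'(ℝ, E)), IsExpWeighted σ u T →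
        T h = u g₁ + I • u g₂ := by
  -- The weight condition only speaks of real test functions, so the real and imaginary parts of `h`
  -- are treated apart and recombined by the complex linearity of `T`. The factor `e^{-σt}` in `g`
  -- cancels the weight.
  have key (L : ℂ →L[ℝ] ℝ) : ∃ (g : 𝓓((⊤ : Opens ℝ), ℝ)) (k : 𝓢(ℝ, ℂ)),
      tsupport g ⊆ tsupport h ∧ (∀ t, k t = ((L (h t) : ℝ) : ℂ)) ∧
      ∀ t, k t = ((Real.exp (σ * t) * g t : ℝ) : ℂ) := by
    have hL : ContDiff ℝ ((⊤ : ℕ∞) : WithTop ℕ∞) (fun t => L (h t)) :=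
      L.contDiff.comp (h.smooth _)
    have hLc : HasCompactSupport (fun t => L (h t)) := hc.comp_left (g := L) (map_zero L)
    have hg : ContDiff ℝ ((⊤ : ℕ∞) : WithTop ℕ∞) (fun t => Real.exp (-(σ * t)) * L (h t)) :=
      ContDiff.mul (by fun_prop) hL
    refine ⟨⟨fun t => Real.exp (-(σ * t)) * L (h t), hg, hLc.mul_left, fun _ _ => trivial⟩,
      (hLc.comp_left (g := ofReal) ofReal_zero).toSchwartzMap (ofRealCLM.contDiff.comp hL),
      ?_, fun t => rfl, fun t => ?_⟩
    · refine (tsupport_mul_subset_right (f := fun t => Real.exp (-(σ * t)))).trans ?_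
      exact closure_mono fun t ht => by
        contrapose! ht
        simp only [Function.mem_support, not_not] at ht ⊢
        rw [ht, map_zero]
    · change ((L (h t) : ℝ) : ℂ) = ((Real.exp (σ * t) * (Real.exp (-(σ * t)) * L (h t)) : ℝ) : ℂ)
      rw [← mul_assoc, ← Real.exp_add]
      simp
  obtain ⟨g₁, k₁, hs₁, hk₁, hg₁⟩ := key reCLM
  obtain ⟨g₂, k₂, hs₂, hk₂, hg₂⟩ := key imCLM
  refine ⟨g₁, g₂, hs₁, hs₂, fun u T hT => ?_⟩
  rw [hT g₁ k₁ hg₁, hT g₂ k₂ hg₂, ← map_smul, ← map_add]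
  congr 1
  ext t
  simp only [add_apply, smul_apply, hk₁, hk₂, reCLM_apply, imCLM_apply,
    smul_eq_mul]
  rw [mul_comm I, re_add_im]

/-- The distribution `u` fixes `T` on compactly supported functions, which are dense. -/
lemma IsExpWeighted.unique {σ : ℝ} {u : 𝓓'((⊤ : Opens ℝ), E)} {T T' : 𝓢'(ℝ, E)}
    (hT : IsExpWeighted σ u T) (hT' : IsExpWeighted σ u T') : T = T' := by
  ext h
  obtain ⟨v, hvc, -, hv⟩ := exists_seq_compactSupport h
  have hc : Continuous fun h => T h := map_continuous T
  have hc' : Continuous fun h => T' h := map_continuous T'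
  refine tendsto_nhds_unique ((hc.tendsto h).comp hv) ?_
  refine ((hc'.tendsto h).comp hv).congr fun n => ?_
  obtain ⟨g₁, g₂, -, -, H⟩ := exists_testFunctions (E := E) σ (v n) (hvc n)
  simp only [Function.comp]
  rw [H u T hT, H u T' hT']

/-- The approximating functions have supports inside that of `h`, so vanishing extends from
compactly supported functions to Schwartz functions. -/
lemma IsExpWeighted.eq_zero_of_tsupport {σ : ℝ} {u : 𝓓'((⊤ : Opens ℝ), E)} {T : 𝓢'(ℝ, E)}
    (hT : IsExpWeighted σ u T) {s : Set ℝ} (hu : Distribution.IsVanishingOn u s)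
    {h : 𝓢(ℝ, ℂ)} (hh : tsupport h ⊆ s) : T h = 0 := by
  obtain ⟨v, hvc, hvs, hv⟩ := exists_seq_compactSupport h
  have hc : Continuous fun h => T h := map_continuous T
  refine tendsto_nhds_unique ((hc.tendsto h).comp hv) ?_
  refine tendsto_const_nhds.congr fun n => ?_
  obtain ⟨g₁, g₂, h₁, h₂, H⟩ := exists_testFunctions (E := E) σ (v n) (hvc n)
  simp only [Function.comp]
  rw [H u T hT, hu g₁ (h₁.trans ((hvs n).trans hh)), hu g₂ (h₂.trans ((hvs n).trans hh))]
  simp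

lemma HasFourierLaplace.exists_expMap {σ : ℝ} {u : 𝓓'((⊤ : Opens ℝ), E)} {f : ℝ → E}
    (hf : HasFourierLaplace σ u f) :
    ∃ T : 𝓢'(ℝ, E), IsExpWeighted σ u T ∧ ∀ k, T (expMap ℝ k) = ∫ ξ₀, k ξ₀ • f ξ₀ := by
  obtain ⟨T, hT, H⟩ := hf.exists_tempered
  refine ⟨T, hT, fun k => H k _ fun t => ?_⟩
  rw [expMap_apply]
  congr 1 with ξ
  simp [mul_comm, mul_left_comm]

/-- The spectral side of the support condition. -/
lemma HasFourierLaplace.integral_eq_zero {σ : ℝ} {u : 𝓓'((⊤ : Opens ℝ), E)} {f : ℝ → E}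
    (hf : HasFourierLaplace σ u f) {s : Set ℝ} (hu : Distribution.IsVanishingOn u s)
    {k : 𝓢(ℝ, ℂ)} (hk : tsupport (expMap ℝ k) ⊆ s) : ∫ ξ₀, k ξ₀ • f ξ₀ = 0 := by
  obtain ⟨T, hT, H⟩ := hf.exists_expMap
  rw [← H, hT.eq_zero_of_tsupport hu hk]

lemma locallyIntegrable_of_schwartz {V : Type*} [NormedAddCommGroup V] [NormedSpace ℝ V]
    [FiniteDimensional ℝ V] [MeasurableSpace V] [BorelSpace V] {ν : Measure V} {f : V → E}
    (hf : ∀ k : 𝓢(V, ℂ), Integrable (fun ξ => k ξ • f ξ) ν) : LocallyIntegrable f ν := by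
  intro x
  let χ : ContDiffBump x := ⟨1, 2, one_pos, one_lt_two⟩
  let k : 𝓢(V, ℂ) := (χ.hasCompactSupport.comp_left (g := ofReal) ofReal_zero).toSchwartzMap
    (ofRealCLM.contDiff.comp χ.contDiff)
  refine ⟨Metric.closedBall x 1, Metric.closedBall_mem_nhds x one_pos, ?_⟩
  refine ((hf k).integrableOn (s := Metric.closedBall x 1)).congr_fun (fun y hy => ?_)
    measurableSet_closedBall
  have : k y = 1 := by
    change ((χ y : ℝ) : ℂ) = 1
    rw [χ.one_of_mem_closedBall hy, ofReal_one]
  simp [this]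

/-- Real smooth functions of compact support are among the Schwartz functions, and these already
separate locally integrable functions. -/
lemma ae_eq_of_integral_schwartz_smul_eq [CompleteSpace E] {V : Type*} [NormedAddCommGroup V]
    [NormedSpace ℝ V] [FiniteDimensional ℝ V] [MeasurableSpace V] [BorelSpace V] {ν : Measure V}
    {f f' : V → E} (hf : ∀ k : 𝓢(V, ℂ), Integrable (fun ξ => k ξ • f ξ) ν)
    (hf' : ∀ k : 𝓢(V, ℂ), Integrable (fun ξ => k ξ • f' ξ) ν)
    (h : ∀ k : 𝓢(V, ℂ), ∫ ξ, k ξ • f ξ ∂ν = ∫ ξ, k ξ • f' ξ ∂ν) : f =ᵐ[ν] f' := by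
  refine ae_eq_of_integral_contDiff_smul_eq (locallyIntegrable_of_schwartz hf)
    (locallyIntegrable_of_schwartz hf') fun g hg hgc => ?_
  exact h ((hgc.comp_left (g := ofReal) ofReal_zero).toSchwartzMap (ofRealCLM.contDiff.comp hg))

lemma HasFourierLaplace.ae_eq [CompleteSpace E] {σ : ℝ} {u : 𝓓'((⊤ : Opens ℝ), E)} {f f' : ℝ → E}
    (hf : HasFourierLaplace σ u f) (hf' : HasFourierLaplace σ u f') : f =ᵐ[volume] f' := by
  obtain ⟨T, hT, H⟩ := hf.exists_expMap
  obtain ⟨T', hT', H'⟩ := hf'.exists_expMap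
  obtain rfl := hT.unique hT'
  exact ae_eq_of_integral_schwartz_smul_eq hf.integrable hf'.integrable fun k => by
    rw [← H, ← H']

/-- The test function `e^{σt} g(t)` as a Schwartz function. -/
def expWeight (σ : ℝ) (g : 𝓓((⊤ : Opens ℝ), ℝ)) : 𝓢(ℝ, ℂ) :=
  HasCompactSupport.toSchwartzMap (f := fun t => ((Real.exp (σ * t) * g t : ℝ) : ℂ))
    ((g.hasCompactSupport.mul_left (f := fun t => Real.exp (σ * t))).comp_left
      (g := ofReal) ofReal_zero)
    (ofRealCLM.contDiff.comp (ContDiff.mul (by fun_prop) g.contDiff))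

lemma expWeight_apply (σ : ℝ) (g : 𝓓((⊤ : Opens ℝ), ℝ)) (t : ℝ) :
    expWeight σ g t = ((Real.exp (σ * t) * g t : ℝ) : ℂ) := rfl

lemma isExpWeighted_iff {σ : ℝ} {u : 𝓓'((⊤ : Opens ℝ), E)} {T : 𝓢'(ℝ, E)} :
    IsExpWeighted σ u T ↔ ∀ g, u g = T (expWeight σ g) := by
  refine ⟨fun h g => h g _ fun t => rfl, fun h g k hk => ?_⟩
  rw [h]
  congr 1
  ext t
  rw [hk, expWeight_apply]

lemma HasFourierLaplace.apply_eq {σ : ℝ} {u : 𝓓'((⊤ : Opens ℝ), E)} {f : ℝ → E}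
    (hf : HasFourierLaplace σ u f) (g : 𝓓((⊤ : Opens ℝ), ℝ)) :
    u g = ∫ ξ₀, expMapInv ℝ (expWeight σ g) ξ₀ • f ξ₀ := by
  obtain ⟨T, hT, H⟩ := hf.exists_expMap
  rw [← H, expMap_expMapInv, isExpWeighted_iff.1 hT]

/-- Integration against a function of at most polynomial growth, in the mean. -/
lemma exists_clm_integral_smul {f : ℝ → E} (hm : AEStronglyMeasurable f) (N : ℕ)
    (hf : Integrable fun ξ₀ : ℝ => (1 + ‖ξ₀‖) ^ (-(N : ℝ)) * ‖f ξ₀‖) :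
    ∃ Λ : 𝓢(ℝ, ℂ) →L[ℂ] E, ∀ k, Integrable (fun ξ₀ => k ξ₀ • f ξ₀) ∧
      Λ k = ∫ ξ₀, k ξ₀ • f ξ₀ := by
  -- No derivatives of `k` are needed: seminorms with at most `N` powers of `|x|` compensate the
  -- growth of `f`.
  let m : ℕ × ℕ := (N, 0)
  have hb (k : 𝓢(ℝ, ℂ)) (x : ℝ) : ‖k x • f x‖ ≤ (2 ^ N *
      ((Finset.Iic m).sup (fun m' => SchwartzMap.seminorm ℂ m'.1 m'.2) k)) *
      ((1 + ‖x‖) ^ (-(N : ℝ)) * ‖f x‖) := by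
    rw [norm_smul, ← mul_assoc]
    refine mul_le_mul_of_nonneg_right ?_ (norm_nonneg _)
    rw [Real.rpow_neg (by positivity), ← div_eq_mul_inv, le_div_iff₀' (by positivity),
      Real.rpow_natCast]
    simpa using SchwartzMap.one_add_le_sup_seminorm_apply (m := m) (k := N) (n := 0)
      le_rfl le_rfl k x
  have hi (k : 𝓢(ℝ, ℂ)) : Integrable (fun ξ₀ => k ξ₀ • f ξ₀) :=
    (hf.const_mul _).mono' (k.continuous.aestronglyMeasurable.smul hm)
      (Filter.Eventually.of_forall (hb k))
  refine ⟨SchwartzMap.mkCLMtoNormedSpace (fun k => ∫ ξ₀, k ξ₀ • f ξ₀) (fun k k' => ?_)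
    (fun a k => ?_) ⟨Finset.Iic m, 2 ^ N * ∫ x : ℝ, (1 + ‖x‖) ^ (-(N : ℝ)) * ‖f x‖, by positivity,
      fun k => ?_⟩, fun k => ⟨hi k, rfl⟩⟩
  · simp only [add_apply, add_smul]
    exact integral_add (hi k) (hi k')
  · simp only [smul_apply, smul_assoc, RingHom.id_apply]
    exact integral_smul _ _
  · refine (norm_integral_le_of_norm_le (hf.const_mul _)
      (Filter.Eventually.of_forall (hb k))).trans (le_of_eq ?_)
    rw [integral_const_mul]
    unfold schwartzSeminormFamily
    ring

/-- The inclusion of the test functions supported in `K` into the Schwartz functions. -/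
lemma exists_clm_toSchwartz (K : Compacts ℝ) :
    ∃ Λ : 𝓓_{K}(ℝ, ℂ) →L[ℝ] 𝓢(ℝ, ℂ), ∀ g t, Λ g t = g t := by
  let Φ : 𝓓_{K}(ℝ, ℂ) →ₗ[ℝ] 𝓢(ℝ, ℂ) :=
    { toFun g := g.hasCompactSupport.toSchwartzMap g.contDiff
      map_add' _ _ := rfl
      map_smul' _ _ := rfl }
  refine ⟨⟨Φ, ?_⟩, fun g t => rfl⟩
  obtain ⟨R, hR⟩ := K.isCompact.isBounded.exists_norm_le
  refine (ContDiffMapSupportedIn.withSeminorms ℝ ℝ ℂ ⊤ K).continuous_of_isBounded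
    (schwartz_withSeminorms ℝ ℝ ℂ) _ (.of_real ?_)
  rintro ⟨k, m⟩
  refine ⟨{m}, |R| ^ k, fun g => ?_⟩
  rw [Finset.sup_singleton]
  refine SchwartzMap.seminorm_le_bound ℝ k m _ (by positivity) fun t => ?_
  change ‖t‖ ^ k * ‖iteratedFDeriv ℝ m g t‖ ≤ _
  by_cases ht : t ∈ K
  · gcongr
    · exact (hR t ht).trans (le_abs_self R)
    · exact ContDiffMapSupportedIn.norm_iteratedFDeriv_apply_le_seminorm_top ℝ
  · rw [g.iteratedFDeriv_zero_on_compl ht]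
    simp only [Pi.zero_apply, norm_zero, mul_zero]
    positivity

/-- Testing a tempered distribution with `e^{σt} g` defines a distribution. -/
lemma exists_isExpWeighted (σ : ℝ) (T : 𝓢'(ℝ, E)) :
    ∃ u : 𝓓'((⊤ : Opens ℝ), E), IsExpWeighted σ u T := by
  have hc : Continuous fun h => T h := map_continuous T
  have hexp : ContDiff ℝ ((⊤ : ℕ∞) : WithTop ℕ∞) fun t : ℝ => ((Real.exp (σ * t) : ℝ) : ℂ) :=
    ofRealCLM.contDiff.comp (Real.contDiff_exp.comp (contDiff_const.mul contDiff_id))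
  let u : 𝓓((⊤ : Opens ℝ), ℝ) →L[ℝ] E := TestFunction.mkCLM ℝ (fun g => T (expWeight σ g))
    (fun g g' => by
      rw [← map_add]
      congr 1
      ext t
      simp [expWeight_apply, mul_add])
    (fun c g => by
      rw [← Complex.coe_smul, ← map_smul]
      congr 1
      ext t
      simp [expWeight_apply, mul_left_comm])
    (fun K hK => by
      obtain ⟨Λ, hΛ⟩ := exists_clm_toSchwartz K
      let B : 𝓓_{K}(ℝ, ℝ) →L[ℝ] 𝓓_{K}(ℝ, ℂ) :=
        ContDiffMapSupportedIn.bilinLeftCLM (ContinuousLinearMap.lsmul ℝ ℝ) hexp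
      refine (hc.comp (Λ.continuous.comp B.continuous)).congr fun g => ?_
      simp only [Function.comp]
      congr 1
      ext t
      rw [hΛ]
      simp [B, expWeight_apply, mul_comm])
  exact ⟨u, isExpWeighted_iff.2 fun g => rfl⟩

end FourierLaplace

/-! ### Pointwise bounds for the symbol -/

section Symbol

/-- The square root `(|ξ|² - c⁻² ω²)^{1/2}` with positive real part. -/
def realRoot (c a : ℝ) (ω : ℂ) : ℂ := (((a ^ 2 : ℝ) : ℂ) - ω ^ 2 / (c : ℂ) ^ 2) ^ (1 / 2 : ℂ)

lemma symbolRoot_eq {d : ℕ} (c : ℝ) (ω : ℂ) (ξ : Space d) :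
    symbolRoot c ω ξ = I * realRoot c ‖ξ‖ ω := rfl

lemma realRoot_sq (c a : ℝ) (ω : ℂ) :
    realRoot c a ω ^ 2 = ((a ^ 2 : ℝ) : ℂ) - ω ^ 2 / (c : ℂ) ^ 2 := by
  unfold realRoot
  rw [← cpow_nat_mul]
  norm_num

/-- The imaginary part is a nonzero multiple of `Re ω · Im ω`. It vanishes only for `Re ω = 0`, and
then the value is `a² + (Im ω)²/c² > 0`. Thus the cut is avoided and the root is holomorphic in the
upper half-plane. -/
lemma mem_slitPlane_of_im_pos {c : ℝ} (hc : 0 < c) (a : ℝ) {ω : ℂ} (hω : 0 < ω.im) :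
    ((a ^ 2 : ℝ) : ℂ) - ω ^ 2 / (c : ℂ) ^ 2 ∈ slitPlane := by
  have e : ((a ^ 2 : ℝ) : ℂ) - ω ^ 2 / (c : ℂ) ^ 2 =
      ((a ^ 2 - (ω.re ^ 2 - ω.im ^ 2) / c ^ 2 : ℝ) : ℂ) + ((-(2 * ω.re * ω.im) / c ^ 2 : ℝ) : ℂ) * I := by
    conv_lhs => rw [← re_add_im ω]
    have : (c : ℂ) ≠ 0 := by exact_mod_cast hc.ne'
    push_cast
    field_simp
    linear_combination (-(ω.im : ℂ) ^ 2) * I_sq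
  rw [e, mem_slitPlane_iff]
  simp only [add_re, add_im, ofReal_re, ofReal_im, mul_re, mul_im, I_re, I_im]
  by_cases h : ω.re = 0
  · left
    have : 0 < ω.im ^ 2 / c ^ 2 := by positivity
    rw [h]
    ring_nf at this ⊢
    nlinarith [sq_nonneg a]
  · right
    have : 2 * ω.re * ω.im / c ^ 2 ≠ 0 := by positivity
    simpa [neg_div] using this

lemma realRoot_re_nonneg (c a : ℝ) (ω : ℂ) : 0 ≤ (realRoot c a ω).re := by
  unfold realRoot
  set z := ((a ^ 2 : ℝ) : ℂ) - ω ^ 2 / (c : ℂ) ^ 2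
  by_cases hz : z = 0
  · simp [hz]
  rw [cpow_def_of_ne_zero hz, exp_re]
  -- The argument of the root is half that of `z`, so it lies in `(-π/2, π/2]`.
  refine mul_nonneg (Real.exp_pos _).le (Real.cos_nonneg_of_neg_pi_div_two_le_of_le ?_ ?_) <;>
  · have e : (log z * (1 / 2)).im = z.arg / 2 := by
      rw [show (1 / 2 : ℂ) = ((1 / 2 : ℝ) : ℂ) by norm_num, im_mul_ofReal, log_im]; ring
    rw [e]
    linarith [neg_pi_lt_arg z, arg_le_pi z]

lemma differentiableAt_realRoot {c : ℝ} (hc : 0 < c) (a : ℝ) {ω : ℂ} (hω : 0 < ω.im) :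
    DifferentiableAt ℂ (realRoot c a) ω :=
  DifferentiableAt.cpow (by fun_prop) (by fun_prop) (mem_slitPlane_of_im_pos hc a hω)

lemma continuous_realRoot {c : ℝ} (hc : 0 < c) {ω : ℂ} (hω : 0 < ω.im) :
    Continuous fun a : ℝ => realRoot c a ω :=
  Continuous.cpow (by fun_prop) (by fun_prop) fun a => mem_slitPlane_of_im_pos hc a hω

lemma norm_realRoot_le {c : ℝ} (hc : 0 < c) (a : ℝ) (ω : ℂ) :
    ‖realRoot c a ω‖ ≤ (1 + c⁻¹) * (‖ω‖ ^ 2 + a ^ 2) ^ (1 / 2 : ℝ) := by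
  rw [← Real.sqrt_eq_rpow]
  refine abs_le_of_sq_le_sq' ?_ (by positivity) |>.2
  rw [mul_pow, Real.sq_sqrt (by positivity), ← norm_pow, realRoot_sq]
  refine (norm_sub_le _ _).trans ?_
  rw [norm_div, norm_pow, norm_pow, norm_real, norm_real, Real.norm_of_nonneg (sq_nonneg a),
    Real.norm_of_nonneg hc.le]
  have : 0 < c⁻¹ := by positivity
  rw [div_eq_mul_inv, ← inv_pow]
  nlinarith [mul_nonneg this.le (sq_nonneg a), mul_nonneg this.le (sq_nonneg ‖ω‖),
    mul_nonneg (sq_nonneg c⁻¹) (sq_nonneg a), sq_nonneg ‖ω‖]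

/-- The lower bound for the real part of the symbol. -/
lemma le_re_realRoot {c : ℝ} (hc : 0 < c) (a : ℝ) {ω : ℂ} (hω : 0 < ω.im) :
    ω.im / Real.sqrt (2 + c ^ 2) * ‖ω‖⁻¹ * (‖ω‖ ^ 2 + a ^ 2) ^ (1 / 2 : ℝ) ≤
      (realRoot c a ω).re := by
  rw [← Real.sqrt_eq_rpow]
  set x := (realRoot c a ω).re with hx
  set y := (realRoot c a ω).im with hy
  have hx0 : 0 ≤ x := realRoot_re_nonneg c a ω
  have hsq := realRoot_sq c a ω
  set l := ω.im / c with hl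
  set m := ω.re / c with hm
  have hl0 : 0 < l := by positivity
  have hωsq : ω ^ 2 / (c : ℂ) ^ 2 = ((m : ℂ) + l * I) ^ 2 := by
    rw [hl, hm, ← div_pow]
    congr 1
    conv_lhs => rw [← re_add_im ω]
    push_cast; ring
  rw [hωsq] at hsq
  have hr : x ^ 2 - y ^ 2 = a ^ 2 - m ^ 2 + l ^ 2 := by
    have := congrArg re hsq
    simp [pow_two] at this
    nlinarith
  have hi : x * y = -(m * l) := by
    have := congrArg im hsq
    simp [pow_two] at this
    nlinarith
  -- If `x < l`, eliminating `y` gives `(l² - x²)(x² + m²) + x² a² = 0`. All terms are nonnegative,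
  -- so `x = m = 0`, and then `-y² = a² + l² > 0` is absurd.
  have hxl : l ≤ x := by
    by_contra! h
    have h1 : x ^ 2 * (x ^ 2 - l ^ 2 + m ^ 2 - a ^ 2) = m ^ 2 * l ^ 2 := by
      have : x ^ 2 * y ^ 2 = m ^ 2 * l ^ 2 := by rw [← mul_pow, hi]; ring
      nlinarith
    have h2 : x ^ 2 < l ^ 2 := by nlinarith
    nlinarith [mul_nonneg (sq_nonneg x) (sq_nonneg a), mul_nonneg (sq_nonneg m) (sub_nonneg.2 h2.le), mul_nonneg (sq_nonneg x) (sub_nonneg.2 h2.le), mul_pos hl0 hl0]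
  -- From `xy = -ml` and `l ≤ x` follows `x² l² y² = m² l⁴ ≤ m² x⁴`; dividing by `x²` gives `l² y² ≤
  -- m² x²`.
  have key : l ^ 2 * (x ^ 2 + y ^ 2) ≤ x ^ 2 * (l ^ 2 + m ^ 2) := by
    have : x ^ 2 * y ^ 2 = m ^ 2 * l ^ 2 := by rw [← mul_pow, hi]; ring
    have hx2 : l ^ 2 ≤ x ^ 2 := by nlinarith
    have : l ^ 2 * y ^ 2 ≤ m ^ 2 * x ^ 2 := by
      have h3 : x ^ 2 * (l ^ 2 * y ^ 2) ≤ x ^ 2 * (m ^ 2 * x ^ 2) := by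
        calc x ^ 2 * (l ^ 2 * y ^ 2) = m ^ 2 * (l ^ 2 * l ^ 2) := by linear_combination l ^ 2 * this
          _ ≤ m ^ 2 * (x ^ 2 * x ^ 2) := by gcongr
          _ = _ := by ring
      have hx1 : 0 < x := hl0.trans_le hxl
      exact le_of_mul_le_mul_left h3 (by positivity)
    linarith
  have hn : ‖ω‖ ^ 2 = c ^ 2 * (l ^ 2 + m ^ 2) := by
    rw [Complex.sq_norm, normSq_apply, hl, hm]
    field_simp; ring
  have hω0 : 0 < ‖ω‖ := norm_pos_iff.2 fun h => by simp [h] at hω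
  -- Since `a² = x² - y² + m² - l² ≤ (x² + y²) + (l² + m²)`, the term `l² a²` costs two copies of
  -- `x² (l² + m²)`; the term `|ω|² = c² (l² + m²)` costs `c²` copies.
  have fin : ω.im ^ 2 * (‖ω‖ ^ 2 + a ^ 2) ≤ (2 + c ^ 2) * ‖ω‖ ^ 2 * x ^ 2 := by
    rw [hn, show ω.im = c * l by rw [hl]; field_simp, mul_pow]
    have : l ^ 2 * (c ^ 2 * (l ^ 2 + m ^ 2) + a ^ 2) ≤ (2 + c ^ 2) * (l ^ 2 + m ^ 2) * x ^ 2 := by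
      have hx2 : l ^ 2 ≤ x ^ 2 := by nlinarith
      have h4 : l ^ 2 * (l ^ 2 + m ^ 2) ≤ x ^ 2 * (l ^ 2 + m ^ 2) := by gcongr
      have h5 : c ^ 2 * (l ^ 2 * (l ^ 2 + m ^ 2)) ≤ c ^ 2 * (x ^ 2 * (l ^ 2 + m ^ 2)) := by gcongr
      have h6 : l ^ 2 * a ^ 2 ≤ l ^ 2 * (x ^ 2 + y ^ 2) + l ^ 2 * (l ^ 2 + m ^ 2) := by
        rw [← mul_add]
        gcongr
        nlinarith [sq_nonneg y, sq_nonneg l]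
      nlinarith
    nlinarith [mul_le_mul_of_nonneg_left this (sq_nonneg c)]
  refine abs_le_of_sq_le_sq' ?_ hx0 |>.2
  rw [mul_pow, mul_pow, div_pow, Real.sq_sqrt (by positivity), Real.sq_sqrt (by positivity)]
  rw [inv_pow, ← div_eq_mul_inv, div_div, div_mul_eq_mul_div, div_le_iff₀ (by positivity)]
  linarith

end Symbol

/-! ### Holomorphic functions on the upper half-plane -/

section Holomorphic

/-- A holomorphic function of polynomial growth on the half-plane `Im ω > 0` has temperate growth
on each line `Im ω = σ`. -/
lemma hasTemperateGrowth_comp_line {F : ℂ → ℂ} (hF : ∀ ω : ℂ, 0 < ω.im → DifferentiableAt ℂ F ω)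
    {C : ℝ} (hC : ∀ ω : ℂ, 0 < ω.im → ‖F ω‖ ≤ C * (1 + ‖ω‖)) {σ : ℝ} (hσ : 0 < σ) :
    (fun x : ℝ => F (x + σ * I)).HasTemperateGrowth := by
  have hU : IsOpen {ω : ℂ | 0 < ω.im} := isOpen_lt continuous_const continuous_im
  have hFU : DifferentiableOn ℂ F {ω : ℂ | 0 < ω.im} := fun ω hω =>
    (hF ω hω).differentiableWithinAt
  have han : AnalyticOnNhd ℂ F {ω : ℂ | 0 < ω.im} := hFU.analyticOnNhd hU
  have hmem (x : ℝ) : (x + σ * I : ℂ) ∈ {ω : ℂ | 0 < ω.im} := by simpa using hσ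
  have hC0 : 0 ≤ C := by
    have := (norm_nonneg _).trans (hC I (by simp))
    exact nonneg_of_mul_nonneg_left this (by positivity)
  have hiter (n : ℕ) : iteratedDeriv n (fun x : ℝ => F (x + σ * I)) =
      fun x : ℝ => iteratedDeriv n F (x + σ * I) := by
    induction n with
    | zero => simp
    | succ n ih =>
      ext x
      rw [iteratedDeriv_succ, ih, iteratedDeriv_succ]
      have hd : HasDerivAt (iteratedDeriv n F) (deriv (iteratedDeriv n F) (x + σ * I))
          (x + σ * I) := by
        refine DifferentiableAt.hasDerivAt ?_
        rw [iteratedDeriv_eq_iterate]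
        exact ((han.iterated_deriv n) _ (hmem x)).differentiableAt
      exact (HasDerivAt.comp_ofReal (e := fun z => iteratedDeriv n F (z + σ * I))
        (hd.comp_add_const (x : ℂ) (σ * I))).deriv
  refine ⟨contDiff_iff_contDiffAt.2 fun x => ?_, fun n => ?_⟩
  · have h1 : ContDiffAt ℝ ((⊤ : ℕ∞) : WithTop ℕ∞) F (x + σ * I) :=
      ((han _ (hmem x)).contDiffAt).restrict_scalars ℝ
    exact h1.comp x ((ofRealCLM.contDiff.add contDiff_const).contDiffAt)
  -- Cauchy's estimate on the disc of radius `σ / 2`, which stays in the half-plane, bounds every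
  -- derivative by the same linear growth.
  · refine ⟨1, n.factorial * (C * (1 + 2 * σ)) / (σ / 2) ^ n, fun x => ?_⟩
    rw [norm_iteratedFDeriv_eq_norm_iteratedDeriv, hiter]
    have him {z : ℂ} (hz : z ∈ Metric.closedBall (x + σ * I : ℂ) (σ / 2)) : 0 < z.im := by
      have h1 := (abs_im_le_norm (z - (x + σ * I))).trans (mem_closedBall_iff_norm.1 hz)
      have h2 : (z - (x + σ * I)).im = z.im - σ := by simp
      rw [h2] at h1
      linarith [(abs_le.1 h1).1]
    refine (norm_iteratedDeriv_le_of_forall_mem_sphere_norm_le n (half_pos hσ)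
      (DifferentiableOn.diffContOnCl (hFU.mono ?_))
      (C := C * (1 + 2 * σ) * (1 + ‖x‖)) fun z hz => ?_).trans (le_of_eq ?_)
    · rw [closure_ball _ (half_pos hσ).ne']
      exact fun z hz => him hz
    · refine (hC z (him (Metric.sphere_subset_closedBall hz))).trans ?_
      rw [mul_assoc]
      refine mul_le_mul_of_nonneg_left ?_ hC0
      have h1 : ‖z‖ ≤ ‖(x + σ * I : ℂ)‖ + σ / 2 := by
        rw [← mem_sphere_iff_norm.1 hz]
        exact norm_le_norm_add_norm_sub' z _
      have h2 : ‖(x + σ * I : ℂ)‖ ≤ ‖x‖ + σ := by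
        refine (norm_add_le _ _).trans (le_of_eq ?_)
        simp [abs_of_pos hσ]
      nlinarith [norm_nonneg x]
    · rw [pow_one]; ring

/-- Shifting the contour upwards. -/
lemma integral_line_eq_zero {Φ : ℂ → ℂ} (hΦ : ∀ ω : ℂ, 0 < ω.im → DifferentiableAt ℂ Φ ω)
    {σ δ C : ℝ} (hσ : 0 < σ) (hδ : 0 < δ)
    (hC : ∀ ω : ℂ, σ ≤ ω.im → ‖Φ ω‖ ≤ C * Real.exp (-(δ * ω.im)) / (1 + ω.re ^ 2)) :
    ∫ x : ℝ, Φ (x + σ * I) = 0 := by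
  have hC0 : 0 ≤ C := by
    have := (norm_nonneg _).trans (hC (σ * I) (by simp))
    rw [div_eq_mul_inv, mul_assoc] at this
    exact nonneg_of_mul_nonneg_left this (by positivity)
  have hline {η : ℝ} (hη : σ ≤ η) (x : ℝ) :
      ‖Φ (x + η * I)‖ ≤ C * Real.exp (-(δ * η)) / (1 + x ^ 2) := by
    simpa using hC (x + η * I) (by simpa using hη)
  have hcont : Continuous fun x : ℝ => Φ (x + σ * I) := by
    refine continuous_iff_continuousAt.2 fun x => ?_
    exact ContinuousAt.comp (g := Φ) (f := fun x : ℝ => (x + σ * I : ℂ))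
      (hΦ _ (by simpa using hσ)).continuousAt (by fun_prop)
  have hint : Integrable fun x : ℝ => Φ (x + σ * I) := by
    refine (integrable_inv_one_add_sq.const_mul (C * Real.exp (-(δ * σ)))).mono'
      hcont.aestronglyMeasurable (Filter.Eventually.of_forall fun x => ?_)
    simpa [div_eq_mul_inv] using hline le_rfl x
  have hlim := (intervalIntegral_tendsto_integral hint Filter.tendsto_neg_atTop_atBot
    Filter.tendsto_id).norm
  rw [← norm_eq_zero]
  -- On the rectangle `[-R, R] × [σ, R]` the top side contributes at most `2 R C e^{-δR}`, and each
  -- vertical side at most `C (R - σ) / (1 + R²) ≤ C / R`.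
  have hzero : Filter.Tendsto (fun R : ℝ => 2 * C * δ⁻¹ * ((δ * R) ^ 1 * Real.exp (-(δ * R))) +
      2 * C * R⁻¹) Filter.atTop (nhds 0) := by
    have h1 := (Real.tendsto_pow_mul_exp_neg_atTop_nhds_zero 1).comp
      (Filter.tendsto_id.const_mul_atTop hδ)
    simpa using (h1.const_mul (2 * C * δ⁻¹)).add (tendsto_inv_atTop_zero.const_mul (2 * C))
  refine le_antisymm (le_of_tendsto_of_tendsto hlim hzero ?_) (norm_nonneg _)
  filter_upwards [Filter.eventually_gt_atTop (max σ 0)] with R hR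
  have hRσ : σ < R := (le_max_left _ _).trans_lt hR
  have hR0 : 0 < R := (le_max_right _ _).trans_lt hR
  have hrect := integral_boundary_rect_eq_zero_of_differentiableOn Φ (-R + σ * I) (R + R * I)
    fun ω hω => (hΦ ω (by
      have := hω.2
      simp only [Set.mem_preimage, add_im, neg_im, ofReal_im, mul_im, ofReal_re, I_im, mul_one,
        I_re, mul_zero, add_zero, neg_zero, zero_add, Set.uIcc_of_le hRσ.le] at this
      exact hσ.trans_le this.1)).differentiableWithinAt
  simp only [add_re, neg_re, ofReal_re, mul_re, I_re, mul_zero, ofReal_im, I_im, mul_one, sub_self,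
    add_zero, add_im, neg_im, mul_im, zero_add, neg_zero, smul_eq_mul] at hrect
  have htop : ‖∫ x in (-R)..R, Φ (x + R * I)‖ ≤ C * Real.exp (-(δ * R)) * |R - -R| := by
    refine intervalIntegral.norm_integral_le_of_norm_le_const fun x _ => ?_
    refine (hline hRσ.le x).trans (div_le_self (by positivity) ?_)
    nlinarith [sq_nonneg x]
  have hside (r : ℝ) (hr : r ^ 2 = R ^ 2) :
      ‖∫ y in σ..R, Φ (r + y * I)‖ ≤ C / (1 + R ^ 2) * |R - σ| := by
    refine intervalIntegral.norm_integral_le_of_norm_le_const fun y hy => ?_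
    rw [Set.uIoc_of_le hRσ.le] at hy
    refine (hline hy.1.le r).trans ?_
    rw [hr]
    gcongr
    refine mul_le_of_le_one_right hC0 (Real.exp_le_one_iff.2 ?_)
    have : 0 ≤ δ * y := mul_nonneg hδ.le (hσ.trans hy.1).le
    linarith
  have h1 := hside R rfl
  have h2 := hside (-R) (by ring)
  have hle : C / (1 + R ^ 2) * |R - σ| ≤ C * R⁻¹ := by
    rw [abs_of_pos (sub_pos.2 hRσ), div_mul_eq_mul_div, div_eq_mul_inv, mul_assoc]
    refine mul_le_mul_of_nonneg_left ?_ hC0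
    rw [← div_eq_mul_inv, div_le_iff₀ (by positivity), inv_mul_eq_div, le_div_iff₀ hR0]
    nlinarith
  have e : (∫ x in (-R)..R, Φ (x + σ * I)) = (∫ x in (-R)..R, Φ (x + R * I)) -
      I * (∫ y in σ..R, Φ (R + y * I)) + I * ∫ y in σ..R, Φ ((-R : ℝ) + y * I) := by
    linear_combination hrect
  simp only [id]
  rw [e]
  refine (norm_add_le _ _).trans ((add_le_add_left (norm_sub_le _ _) _).trans ?_)
  rw [norm_mul, norm_mul, norm_I, one_mul, one_mul]
  have e2 : 2 * C * δ⁻¹ * ((δ * R) ^ 1 * Real.exp (-(δ * R))) =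
      C * Real.exp (-(δ * R)) * |R - -R| := by
    rw [abs_of_pos (by linarith)]; field_simp; ring
  linarith

end Holomorphic

/-! ### Transforms of test functions and causality -/

section Laplace

/-- The Fourier-Laplace transform with the kernel `e^{-iωt}`. -/
def laplace (h : 𝓢(ℝ, ℂ)) (ω : ℂ) : ℂ := ∫ t : ℝ, cexp (-(I * ω * t)) * h t

lemma norm_cexp_kernel (ω : ℂ) (t : ℝ) : ‖cexp (-(I * ω * t))‖ = Real.exp (ω.im * t) := by
  rw [norm_exp]
  simp

lemma integrable_laplace {h : 𝓢(ℝ, ℂ)} (hc : HasCompactSupport h) (ω : ℂ) :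
    Integrable fun t : ℝ => cexp (-(I * ω * t)) * h t :=
  Continuous.integrable_of_hasCompactSupport (by have := h.continuous; fun_prop) hc.mul_left

lemma differentiable_laplace {h : 𝓢(ℝ, ℂ)} (hc : HasCompactSupport h) :
    Differentiable ℂ (laplace h) := by
  intro ω₀
  let bound : ℝ → ℝ := fun t => |t| * Real.exp ((‖ω₀‖ + 1) * |t|) * ‖h t‖
  have hb : Integrable bound :=
    Continuous.integrable_of_hasCompactSupport (by have := h.continuous; fun_prop)
      hc.norm.mul_left
  refine (hasDerivAt_integral_of_dominated_loc_of_deriv_le (bound := bound)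
    (F' := fun ω t => -(I * t) * cexp (-(I * ω * t)) * h t)
    (Metric.ball_mem_nhds ω₀ one_pos)
    (Filter.Eventually.of_forall fun ω => (integrable_laplace hc ω).aestronglyMeasurable)
    (integrable_laplace hc ω₀) ?_ (Filter.Eventually.of_forall fun t ω hω => ?_) hb
    (Filter.Eventually.of_forall fun t ω _ => ?_)).2.differentiableAt
  · exact Continuous.aestronglyMeasurable (by have := h.continuous; fun_prop)
  · rw [norm_mul, norm_mul, norm_neg, norm_mul, norm_I, one_mul, norm_real, norm_cexp_kernel,
      Real.norm_eq_abs]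
    change |t| * Real.exp (ω.im * t) * ‖h t‖ ≤ |t| * Real.exp ((‖ω₀‖ + 1) * |t|) * ‖h t‖
    have him : ω.im * t ≤ (‖ω₀‖ + 1) * |t| := by
      refine (le_abs_self _).trans ?_
      rw [abs_mul]
      refine mul_le_mul_of_nonneg_right ((abs_im_le_norm ω).trans ?_) (abs_nonneg t)
      linarith [mem_ball_iff_norm.1 hω, norm_le_norm_add_norm_sub' ω ω₀]
    refine mul_le_mul_of_nonneg_right (mul_le_mul_of_nonneg_left (Real.exp_le_exp.2 him)
      (abs_nonneg t)) (norm_nonneg _)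
  · have h1 : HasDerivAt (fun ω : ℂ => -(I * ω * t)) (-(I * t)) ω := by
      simpa using (((hasDerivAt_id ω).const_mul I).mul_const (t : ℂ)).fun_neg
    exact (h1.cexp.mul_const (h t)).congr_deriv (by ring)

/-- Integration by parts. As differentiation does not enlarge the support, iteration trades
derivatives for powers of `ω` without losing exponential decay. -/
lemma laplace_deriv {h : 𝓢(ℝ, ℂ)} (hc : HasCompactSupport h) (ω : ℂ) :
    laplace (SchwartzMap.derivCLM ℂ ℂ h) ω = I * ω * laplace h ω := by
  have hc' : HasCompactSupport (SchwartzMap.derivCLM ℂ ℂ h) :=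
    hc.mono' ((subset_tsupport _).trans (SchwartzMap.tsupport_derivCLM_subset ℂ h))
  have := integral_mul_deriv_eq_deriv_mul_of_integrable
    (u := fun t : ℝ => cexp (-(I * ω * t))) (v := h)
    (u' := fun t : ℝ => -(I * ω) * cexp (-(I * ω * t))) (v' := SchwartzMap.derivCLM ℂ ℂ h)
    (fun t _ => by
      have h1 : HasDerivAt (fun t : ℝ => -(I * ω * (t : ℂ))) (-(I * ω)) t := by
        simpa using ((ofRealCLM.hasDerivAt (x := t)).const_mul (I * ω)).fun_neg
      exact h1.cexp.congr_deriv (by ring))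
    (fun t _ => by simpa using h.hasDerivAt t)
    (integrable_laplace hc' ω)
    (((integrable_laplace hc ω).const_mul (-(I * ω))).congr
      (Filter.Eventually.of_forall fun t => by simp [mul_assoc]))
    (integrable_laplace hc ω)
  unfold laplace
  rw [this, ← integral_const_mul, ← integral_neg]
  congr 1 with t
  ring

lemma norm_laplace_le {h : 𝓢(ℝ, ℂ)} {ε : ℝ} (hs : tsupport h ⊆ Set.Iic (-ε)) {ω : ℂ}
    (hω : 0 ≤ ω.im) : ‖laplace h ω‖ ≤ (∫ t, ‖h t‖) * Real.exp (-(ε * ω.im)) := by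
  rw [← integral_mul_const]
  refine norm_integral_le_of_norm_le (h.integrable.norm.mul_const _)
    (Filter.Eventually.of_forall fun t => ?_)
  rw [norm_mul, norm_cexp_kernel, mul_comm]
  by_cases ht : t ∈ tsupport h
  · have := hs ht
    gcongr
    rw [Set.mem_Iic] at this
    nlinarith
  · simp [image_eq_zero_of_notMem_tsupport ht]

lemma exists_laplace_le {h : 𝓢(ℝ, ℂ)} (hc : HasCompactSupport h) {ε : ℝ}
    (hs : tsupport h ⊆ Set.Iic (-ε)) (n : ℕ) :
    ∃ M : ℝ, 0 ≤ M ∧ ∀ ω : ℂ, 0 ≤ ω.im →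
      ‖ω‖ ^ n * ‖laplace h ω‖ ≤ M * Real.exp (-(ε * ω.im)) := by
  induction n generalizing h with
  | zero => exact ⟨∫ t, ‖h t‖, by positivity, fun ω hω => by simpa using norm_laplace_le hs hω⟩
  | succ n ih =>
    have hsub := SchwartzMap.tsupport_derivCLM_subset ℂ h
    obtain ⟨M, hM, H⟩ := ih (h := SchwartzMap.derivCLM ℂ ℂ h)
      (hc.mono' ((subset_tsupport _).trans hsub)) (hsub.trans hs)
    refine ⟨M, hM, fun ω hω => ?_⟩
    have := H ω hω
    rw [laplace_deriv hc, norm_mul, norm_mul, norm_I, one_mul] at this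
    rw [pow_succ]
    linarith

/-- A holomorphic multiplier on the upper half-plane preserves the support condition. -/
lemma exists_schwartz_mul_holomorphic {F : ℂ → ℂ}
    (hF : ∀ ω : ℂ, 0 < ω.im → DifferentiableAt ℂ F ω) {C : ℝ}
    (hC : ∀ ω : ℂ, 0 < ω.im → ‖F ω‖ ≤ C * (1 + ‖ω‖)) {σ : ℝ} (hσ : 0 < σ)
    {g : 𝓓((⊤ : Opens ℝ), ℝ)} (hg : tsupport g ⊆ Set.Iio 0) :
    ∃ k : 𝓢(ℝ, ℂ), (∀ x : ℝ, k x = expMapInv ℝ (expWeight σ g) x * F (x + σ * I)) ∧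
      tsupport (expMap ℝ k) ⊆ Set.Iio 0 := by
  have hC0 : 0 ≤ C := by
    have := (norm_nonneg _).trans (hC I (by simp))
    exact nonneg_of_mul_nonneg_left this (by positivity)
  -- Compactness of the support leaves a gap before time `0`, which supplies the exponential decay.
  obtain ⟨ε, hε, hgε⟩ : ∃ ε : ℝ, 0 < ε ∧ tsupport g ⊆ Set.Iic (-ε) := by
    rcases (tsupport g).eq_empty_or_nonempty with h0 | h0
    · exact ⟨1, one_pos, by simp [h0]⟩
    · obtain ⟨x, hx, hmax⟩ := g.hasCompactSupport.exists_isMaxOn h0 continuousOn_id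
      exact ⟨-x, neg_pos.2 (hg hx), fun y hy => by simpa using hmax hy⟩
  let h : 𝓢(ℝ, ℂ) := (g.hasCompactSupport.comp_left (g := ofReal) ofReal_zero).toSchwartzMap
    (ofRealCLM.contDiff.comp g.contDiff)
  have hh (t : ℝ) : h t = (g t : ℂ) := rfl
  have hsub : tsupport h ⊆ tsupport g := closure_mono fun t ht => by
    contrapose! ht
    simp only [Function.mem_support, not_not] at ht ⊢
    rw [hh, ht, ofReal_zero]
  have hc : HasCompactSupport h := g.hasCompactSupport.mono' ((subset_tsupport _).trans hsub)
  -- One power of `|ω|` is spent on the growth of `F` and two on the integrable majorant `1 / (1 +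
  -- (Re ω)²)`.
  obtain ⟨M, hM, hlap⟩ := exists_laplace_le hc (hsub.trans hgε) 3
  have hG := hasTemperateGrowth_comp_line hF hC hσ
  have hinv (x : ℝ) : expMapInv ℝ (expWeight σ g) x =
      ((2 * Real.pi : ℝ) : ℂ)⁻¹ * laplace h (x + σ * I) := by
    rw [expMapInv_real_apply, laplace]
    congr 2 with t
    rw [expWeight_apply, hh, ofReal_mul, ← mul_assoc, ofReal_exp, ← Complex.exp_add]
    congr 2
    push_cast
    linear_combination ((σ : ℂ) * t) * I_sq
  refine ⟨SchwartzMap.smulLeftCLM ℂ (fun x : ℝ => F (x + σ * I)) (expMapInv ℝ (expWeight σ g)),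
    fun x => ?_, ?_⟩
  · rw [SchwartzMap.smulLeftCLM_apply_apply hG, smul_eq_mul, mul_comm]
  · refine (closure_minimal (fun t ht => ?_) isClosed_Iic).trans
      (Set.Iic_subset_Iio.2 (neg_lt_zero.2 hε))
    rw [Set.mem_Iic]
    by_contra! hεt
    refine ht ?_
    rw [expMap_apply]
    -- For `t > -ε` the kernel contributes `e^{-t Im ω}` and the transform `e^{-ε Im ω}`, so the
    -- integrand decays at rate `δ = t + ε > 0`. Up to the factor `e^{σt} / (2π)` its integral over
    -- the line is the value sought.
    have hshift := integral_line_eq_zero (Φ := fun ω => cexp (I * ω * t) * laplace h ω * F ω)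
      (fun ω hω => ((by fun_prop : DifferentiableAt ℂ (fun ω => cexp (I * ω * t)) ω).mul
        (differentiable_laplace hc ω)).mul (hF ω hω)) (δ := t + ε)
      (C := M * C * ((σ⁻¹ + 1) * (σ⁻¹ ^ 2 + 1))) hσ (by linarith) (fun ω hω => by
        have hωn : σ ≤ ‖ω‖ := hω.trans ((le_abs_self _).trans (abs_im_le_norm ω))
        have hω0 : 0 < ‖ω‖ := hσ.trans_le hωn
        have h1 : ‖cexp (I * ω * t)‖ = Real.exp (-(t * ω.im)) := by
          rw [norm_exp]; simp [mul_comm]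
        have h2 := hlap ω (hσ.le.trans hω)
        have h3 := hC ω (hσ.trans_le hω)
        rw [norm_mul, norm_mul, h1, le_div_iff₀ (by positivity), ← mul_le_mul_iff_right₀
          (show (0 : ℝ) < ‖ω‖ ^ 3 by positivity)]
        have h4 : Real.exp (-((t + ε) * ω.im)) =
            Real.exp (-(t * ω.im)) * Real.exp (-(ε * ω.im)) := by
          rw [← Real.exp_add]; ring_nf
        have h5 : (1 + ‖ω‖) * (1 + ω.re ^ 2) ≤ (σ⁻¹ + 1) * (σ⁻¹ ^ 2 + 1) * ‖ω‖ ^ 3 := by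
          have e1 : (1 : ℝ) ≤ σ⁻¹ * ‖ω‖ := by rwa [inv_mul_eq_div, one_le_div hσ]
          have e2 : ω.re ^ 2 ≤ ‖ω‖ ^ 2 := by
            rw [← sq_abs]; exact pow_le_pow_left₀ (abs_nonneg _) (abs_re_le_norm ω) 2
          have e3 : (1 : ℝ) ≤ (σ⁻¹ * ‖ω‖) ^ 2 := one_le_pow₀ e1
          calc (1 + ‖ω‖) * (1 + ω.re ^ 2) ≤ (σ⁻¹ * ‖ω‖ + ‖ω‖) * ((σ⁻¹ * ‖ω‖) ^ 2 + ‖ω‖ ^ 2) := by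
                gcongr
            _ = _ := by ring
        rw [h4]
        calc ‖ω‖ ^ 3 * (Real.exp (-(t * ω.im)) * ‖laplace h ω‖ * ‖F ω‖ * (1 + ω.re ^ 2))
            = Real.exp (-(t * ω.im)) * (‖ω‖ ^ 3 * ‖laplace h ω‖) * ‖F ω‖ * (1 + ω.re ^ 2) := by
              ring
          _ ≤ Real.exp (-(t * ω.im)) * (M * Real.exp (-(ε * ω.im))) * (C * (1 + ‖ω‖)) *
              (1 + ω.re ^ 2) := by gcongr
          _ = Real.exp (-(t * ω.im)) * Real.exp (-(ε * ω.im)) * (M * C) *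
              ((1 + ‖ω‖) * (1 + ω.re ^ 2)) := by ring
          _ ≤ Real.exp (-(t * ω.im)) * Real.exp (-(ε * ω.im)) * (M * C) *
              ((σ⁻¹ + 1) * (σ⁻¹ ^ 2 + 1) * ‖ω‖ ^ 3) := by gcongr
          _ = _ := by ring)
    rw [← mul_zero (cexp (σ * t) * ((2 * Real.pi : ℝ) : ℂ)⁻¹), ← hshift, ← integral_const_mul]
    congr 1 with x
    rw [SchwartzMap.smulLeftCLM_apply_apply hG, hinv, smul_eq_mul]
    have e : cexp (I * (inner ℝ x t : ℝ)) = cexp (σ * t) * cexp (I * (x + σ * I) * t) := by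
      rw [← Complex.exp_add]
      congr 1
      simp only [RCLike.inner_apply, conj_trivial]
      push_cast
      linear_combination (-(σ : ℂ) * t) * I_sq
    rw [e]
    ring

end Laplace

/-! ### Sobolev spaces, Fourier multipliers and the duality pairing -/

section SobolevSpaces

variable {d : ℕ} {r r' : ℝ}

lemma measurable_ofReal_bessel (r : ℝ) :
    Measurable fun ξ : Space d => ENNReal.ofReal (bessel r ξ) :=
  (continuous_bessel r).measurable.ennreal_ofReal

lemma bessel_add (r r' : ℝ) (ξ : Space d) : bessel (r + r') ξ = bessel r ξ * bessel r' ξ :=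
  Real.rpow_add (by positivity) r r'

lemma ae_sobolevMeasure_iff {p : Space d → Prop} :
    (∀ᵐ ξ ∂(sobolevMeasure d r), p ξ) ↔ ∀ᵐ ξ, p ξ := by
  constructor
  · intro h
    refine (withDensity_absolutelyContinuous' (μ := (volume : Measure (Space d)))
      (measurable_ofReal_bessel r).aemeasurable
      (Filter.Eventually.of_forall fun ξ => ?_)).ae_le h
    simpa using bessel_pos r ξ
  · intro h
    exact (withDensity_absolutelyContinuous _ _).ae_le h

lemma aestronglyMeasurable_sobolevMeasure_iff {f : Space d → ℂ} :
    AEStronglyMeasurable f (sobolevMeasure d r) ↔ AEStronglyMeasurable f volume := by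
  constructor
  · rintro ⟨g, hg, h⟩
    exact ⟨g, hg, ae_sobolevMeasure_iff.1 h⟩
  · rintro ⟨g, hg, h⟩
    exact ⟨g, hg, ae_sobolevMeasure_iff.2 h⟩

lemma sobolev_ext {u v : Sobolev d r} (h : ∀ᵐ ξ, u ξ = v ξ) : u = v :=
  Lp.ext (ae_sobolevMeasure_iff.2 h)

lemma aestronglyMeasurable_sobolev (u : Sobolev d r) : AEStronglyMeasurable u volume :=
  aestronglyMeasurable_sobolevMeasure_iff.1 (Lp.aestronglyMeasurable u)

lemma lintegral_sobolevMeasure {f : Space d → ℝ≥0∞} :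
    ∫⁻ ξ, f ξ ∂(sobolevMeasure d r) = ∫⁻ ξ, ENNReal.ofReal (bessel r ξ) * f ξ :=
  lintegral_withDensity_eq_lintegral_mul_non_measurable _ (measurable_ofReal_bessel r)
    (Filter.Eventually.of_forall fun _ => ENNReal.ofReal_lt_top) f

lemma eLpNorm_two_sq (f : Space d → ℂ) :
    eLpNorm f 2 (sobolevMeasure d r) ^ 2 = ∫⁻ ξ, ENNReal.ofReal (bessel r ξ) * ‖f ξ‖ₑ ^ 2 := by
  rw [eLpNorm_eq_lintegral_rpow_enorm_toReal (by simp) (by simp), ← lintegral_sobolevMeasure,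
    ← ENNReal.rpow_natCast, ← ENNReal.rpow_mul]
  norm_num

lemma enorm_sobolev_sq (u : Sobolev d r) :
    ‖u‖ₑ ^ 2 = ∫⁻ ξ, ENNReal.ofReal (bessel r ξ) * ‖u ξ‖ₑ ^ 2 := by
  rw [← eLpNorm_two_sq, Lp.enorm_def]

lemma memLp_sobolevMeasure {f : Space d → ℂ} (hf : AEStronglyMeasurable f volume)
    (h : ∫⁻ ξ, ENNReal.ofReal (bessel r ξ) * ‖f ξ‖ₑ ^ 2 < ⊤) : MemLp f 2 (sobolevMeasure d r) := by
  refine ⟨aestronglyMeasurable_sobolevMeasure_iff.2 hf, ?_⟩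
  rw [← eLpNorm_two_sq] at h
  by_contra h'
  rw [not_lt, top_le_iff] at h'
  simp [h'] at h

lemma exists_sobolev {f : Space d → ℂ} (hf : AEStronglyMeasurable f volume)
    (h : ∫⁻ ξ, ENNReal.ofReal (bessel r ξ) * ‖f ξ‖ₑ ^ 2 < ⊤) :
    ∃ u : Sobolev d r, ∀ᵐ ξ, u ξ = f ξ :=
  ⟨(memLp_sobolevMeasure hf h).toLp f, ae_sobolevMeasure_iff.1 (memLp_sobolevMeasure hf h).coeFn_toLp⟩

variable (r r') in
/-- The function `m` multiplies the Fourier transforms of `H^r` into those of `H^{r'}`, with norm at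
most `C`. -/
structure IsMultiplier (C : ℝ) (m : Space d → ℂ) : Prop where
  measurable : Measurable m
  nonneg : 0 ≤ C
  bound : ∀ ξ, ‖m ξ‖ ^ 2 * bessel r' ξ ≤ C ^ 2 * bessel r ξ

lemma IsMultiplier.lintegrand_le {C : ℝ} {m : Space d → ℂ} (hm : IsMultiplier r r' C m)
    (ξ : Space d) (z : ℂ) : ENNReal.ofReal (bessel r' ξ) * ‖m ξ * z‖ₑ ^ 2 ≤
      ENNReal.ofReal (C ^ 2) * (ENNReal.ofReal (bessel r ξ) * ‖z‖ₑ ^ 2) := by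
  rw [enorm_mul, mul_pow, ← mul_assoc, ← mul_assoc, ← ENNReal.ofReal_mul (by positivity)]
  gcongr
  rw [← ofReal_norm, ← ENNReal.ofReal_pow (norm_nonneg _),
    ← ENNReal.ofReal_mul (bessel_pos _ _).le]
  exact ENNReal.ofReal_le_ofReal (by linarith [hm.bound ξ])

lemma IsMultiplier.exists_clm {C : ℝ} {m : Space d → ℂ} (hm : IsMultiplier r r' C m) :
    ∃ M : Sobolev d r →L[ℂ] Sobolev d r', (∀ u, ∀ᵐ ξ, M u ξ = m ξ * u ξ) ∧
      ∀ u, ‖M u‖ ≤ C * ‖u‖ := by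
  have hex (u : Sobolev d r) : ∃ v : Sobolev d r', ∀ᵐ ξ, v ξ = m ξ * u ξ := by
    refine exists_sobolev (hm.measurable.aestronglyMeasurable.mul (aestronglyMeasurable_sobolev u))
      ((lintegral_mono fun ξ => hm.lintegrand_le ξ (u ξ)).trans_lt ?_)
    rw [lintegral_const_mul' _ _ ENNReal.ofReal_ne_top, ← enorm_sobolev_sq]
    exact ENNReal.mul_lt_top ENNReal.ofReal_lt_top (by simp)
  choose M hM using hex
  have hb (u : Sobolev d r) : ‖M u‖ ≤ C * ‖u‖ := by
    have h1 : ‖M u‖ₑ ^ 2 ≤ (ENNReal.ofReal C * ‖u‖ₑ) ^ 2 := by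
      rw [enorm_sobolev_sq, mul_pow, enorm_sobolev_sq u, ← ENNReal.ofReal_pow hm.nonneg,
        ← lintegral_const_mul' _ _ ENNReal.ofReal_ne_top]
      refine lintegral_mono_ae ?_
      filter_upwards [hM u] with ξ hξ
      rw [hξ]
      exact hm.lintegrand_le ξ (u ξ)
    have h2 : ‖M u‖ₑ ≤ ENNReal.ofReal C * ‖u‖ₑ := (ENNReal.pow_le_pow_left_iff two_ne_zero).1 h1
    rw [← ofReal_norm, ← ofReal_norm, ← ENNReal.ofReal_mul hm.nonneg] at h2
    exact (ENNReal.ofReal_le_ofReal_iff (mul_nonneg hm.nonneg (norm_nonneg _))).1 h2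
  refine ⟨LinearMap.mkContinuous
    { toFun := M
      map_add' u v := sobolev_ext ?_
      map_smul' a u := sobolev_ext ?_ } C hb, hM, hb⟩
  · filter_upwards [hM u, hM v, hM (u + v), ae_sobolevMeasure_iff.1 (Lp.coeFn_add u v),
      ae_sobolevMeasure_iff.1 (Lp.coeFn_add (M u) (M v))] with ξ h1 h2 h3 h4 h5
    rw [h3, h4, h5, Pi.add_apply, Pi.add_apply, h1, h2, mul_add]
  · filter_upwards [hM u, hM (a • u), ae_sobolevMeasure_iff.1 (Lp.coeFn_smul a u),
      ae_sobolevMeasure_iff.1 (Lp.coeFn_smul a (M u))] with ξ h1 h2 h3 h4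
    rw [h2, h3, RingHom.id_apply, h4, Pi.smul_apply, Pi.smul_apply, h1, smul_eq_mul, smul_eq_mul,
      mul_left_comm]

open Classical in
variable (d r r') in
/-- Multiplication of the Fourier transform by `m`. -/
def multiplier (m : Space d → ℂ) : Sobolev d r →L[ℂ] Sobolev d r' :=
  if h : ∃ C, IsMultiplier r r' C m then h.choose_spec.exists_clm.choose else 0

lemma IsMultiplier.ae_eq {C : ℝ} {m : Space d → ℂ} (hm : IsMultiplier r r' C m)
    (u : Sobolev d r) : ∀ᵐ ξ, multiplier d r r' m u ξ = m ξ * u ξ := by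
  have h : ∃ C, IsMultiplier r r' C m := ⟨C, hm⟩
  rw [multiplier, dif_pos h]
  exact h.choose_spec.exists_clm.choose_spec.1 u

lemma IsMultiplier.norm_le {C : ℝ} {m : Space d → ℂ} (hm : IsMultiplier r r' C m)
    (u : Sobolev d r) : ‖multiplier d r r' m u‖ ≤ C * ‖u‖ := by
  obtain ⟨M, hM, hb⟩ := hm.exists_clm
  have : multiplier d r r' m u = M u := sobolev_ext (by
    filter_upwards [hm.ae_eq u, hM u] with ξ h1 h2
    rw [h1, h2])
  rw [this]
  exact hb u

/-- Dominated convergence for multipliers. -/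
lemma tendsto_multiplier {C : ℝ} {m : Space d → ℂ} {M : ℕ → Space d → ℂ}
    (hm : IsMultiplier r r' C m) (hM : ∀ n, IsMultiplier r r' C (M n))
    (h : ∀ ξ, Filter.Tendsto (fun n => M n ξ) Filter.atTop (nhds (m ξ))) (u : Sobolev d r) :
    Filter.Tendsto (fun n => multiplier d r r' (M n) u) Filter.atTop
      (nhds (multiplier d r r' m u)) := by
  -- By `|p - q|² ≤ 2|p|² + 2|q|²` the squared bound is `4C²`. It supplies the dominating function
  -- below.
  have hdiff (n : ℕ) : IsMultiplier r r' (2 * C) fun ξ => M n ξ - m ξ :=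
    ⟨(hM n).measurable.sub hm.measurable, mul_nonneg zero_le_two hm.nonneg, fun ξ => by
      have h1 : ‖M n ξ - m ξ‖ ^ 2 ≤ 2 * ‖M n ξ‖ ^ 2 + 2 * ‖m ξ‖ ^ 2 := by
        have := norm_sub_le (M n ξ) (m ξ)
        nlinarith [norm_nonneg (M n ξ - m ξ), sq_nonneg (‖M n ξ‖ - ‖m ξ‖)]
      have := mul_le_mul_of_nonneg_right h1 (bessel_pos r' ξ).le
      nlinarith [(hM n).bound ξ, hm.bound ξ]⟩
  have hlim : Filter.Tendsto (fun n => ∫⁻ ξ, ENNReal.ofReal (bessel r' ξ) *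
      ‖(M n ξ - m ξ) * u ξ‖ₑ ^ 2) Filter.atTop (nhds 0) := by
    have := tendsto_lintegral_of_dominated_convergence' (μ := (volume : Measure (Space d)))
      (F := fun n ξ => ENNReal.ofReal (bessel r' ξ) * ‖(M n ξ - m ξ) * u ξ‖ₑ ^ 2)
      (f := fun _ => 0)
      (fun ξ => ENNReal.ofReal ((2 * C) ^ 2) * (ENNReal.ofReal (bessel r ξ) * ‖u ξ‖ₑ ^ 2))
      (fun n => ((measurable_ofReal_bessel r').aemeasurable).mul
        (((hdiff n).measurable.aestronglyMeasurable.mul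
          (aestronglyMeasurable_sobolev u)).enorm.pow_const 2))
      (fun n => Filter.Eventually.of_forall fun ξ => (hdiff n).lintegrand_le ξ (u ξ))
      (by
        rw [lintegral_const_mul' _ _ ENNReal.ofReal_ne_top, ← enorm_sobolev_sq]
        exact (ENNReal.mul_lt_top ENNReal.ofReal_lt_top (by simp)).ne)
      (Filter.Eventually.of_forall fun ξ => by
        have h1 : Filter.Tendsto (fun n => (M n ξ - m ξ) * u ξ) Filter.atTop (nhds 0) := by
          simpa using ((h ξ).sub_const (m ξ)).mul_const (u ξ)
        have h2 := ENNReal.Tendsto.const_mul (a := ENNReal.ofReal (bessel r' ξ))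
          (ENNReal.Tendsto.pow (n := 2) h1.enorm) (Or.inr ENNReal.ofReal_ne_top)
        simpa using h2)
    simpa using this
  rw [tendsto_iff_edist_tendsto_0]
  have hsq : Filter.Tendsto (fun n => edist (multiplier d r r' (M n) u)
      (multiplier d r r' m u) ^ 2) Filter.atTop (nhds 0) := by
    refine hlim.congr fun n => ?_
    rw [edist_eq_enorm_sub, enorm_sobolev_sq]
    refine lintegral_congr_ae ?_
    filter_upwards [hm.ae_eq u, (hM n).ae_eq u, ae_sobolevMeasure_iff.1
      (Lp.coeFn_sub (multiplier d r r' (M n) u) (multiplier d r r' m u))] with ξ h1 h2 h3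
    rw [h3, Pi.sub_apply, h1, h2, sub_mul]
  have := (ENNReal.continuous_rpow_const (y := 1 / 2)).tendsto 0 |>.comp hsq
  refine (this.congr fun n => ?_).trans (by simp)
  simp only [Function.comp]
  rw [← ENNReal.rpow_natCast, ← ENNReal.rpow_mul]
  norm_num

/-- Dividing `k` by the weight leaves a Schwartz function, so the product is one of two square
integrable functions for the weighted measure. -/
lemma integrable_schwartz_smul (u : Sobolev d r) (k : 𝓢(Space d, ℂ)) :
    Integrable fun ξ => k ξ • u ξ := by
  have hb : (fun ξ : Space d => ((bessel (-r) ξ : ℝ) : ℂ)).HasTemperateGrowth := by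
    unfold bessel; fun_prop
  let h : 𝓢(Space d, ℂ) :=
    SchwartzMap.smulLeftCLM ℂ (fun ξ : Space d => ((bessel (-r) ξ : ℝ) : ℂ)) k
  have h1 : Integrable (fun ξ => h ξ * u ξ) (sobolevMeasure d r) :=
    (h.memLp 2 (sobolevMeasure d r)).integrable_mul (Lp.memLp u)
  unfold sobolevMeasure at h1
  rw [integrable_withDensity_iff_integrable_smul' (measurable_ofReal_bessel r)
    (Filter.Eventually.of_forall fun _ => ENNReal.ofReal_lt_top)] at h1
  refine h1.congr (Filter.Eventually.of_forall fun ξ => ?_)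
  have h2 : (bessel r ξ : ℂ) * (bessel (-r) ξ : ℂ) = 1 := by
    rw [← ofReal_mul, ← bessel_add]; simp [bessel]
  simp only [h]
  rw [ENNReal.toReal_ofReal (bessel_pos r ξ).le, SchwartzMap.smulLeftCLM_apply_apply hb, real_smul,
    smul_eq_mul, smul_eq_mul]
  rw [← mul_assoc, ← mul_assoc, h2, one_mul]
  rfl

lemma expTransform_eq (g : 𝓢(Space d, ℂ)) (ξ : Space d) :
    expTransform g ξ = expMap (Space d) g ξ := (expMap_apply g ξ).symm

/-- An element of the Sobolev space is determined by its distribution. -/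
lemma toDistribution_injective {u v : Sobolev d r}
    (h : ∀ g, toDistribution u g = toDistribution v g) : u = v := by
  refine sobolev_ext (ae_eq_of_integral_schwartz_smul_eq (integrable_schwartz_smul u)
    (integrable_schwartz_smul v) fun k => ?_)
  have hpi : (((2 * Real.pi : ℝ) : ℂ) ^ d)⁻¹ ≠ 0 := by
    have := Real.pi_ne_zero
    simp [this]
  have := mul_left_cancel₀ hpi (h (expMapInv _ k))
  simpa only [expTransform_eq, expMap_expMapInv, smul_eq_mul, mul_comm] using this

lemma toDistribution_sum {ι : Type*} (s : Finset ι) (u : ι → Sobolev d r) (g : 𝓢(Space d, ℂ)) :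
    toDistribution (∑ i ∈ s, u i) g = ∑ i ∈ s, toDistribution (u i) g := by
  obtain ⟨Λ, hΛ⟩ := exists_clm_toDistribution (r := r) g
  simp only [← hΛ, map_sum]

lemma isMultiplier_bessel_half :
    IsMultiplier (1 / 2) (-1 / 2) 1 fun ξ : Space d => ((bessel (1 / 2) ξ : ℝ) : ℂ) :=
  ⟨by have := (continuous_bessel (d := d) (1 / 2)).measurable; fun_prop, zero_le_one, fun ξ => by
    rw [norm_real, Real.norm_of_nonneg (bessel_pos _ _).le, pow_two, ← bessel_add, ← bessel_add]
    norm_num⟩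

lemma inner_bessel_half (a b : ℂ) (ξ : Space d) :
    (bessel (-1 / 2) ξ : ℂ) * inner ℂ ((bessel (1 / 2) ξ : ℂ) * b) a =
      a * starRingEnd ℂ b := by
  have h2 : (bessel (-1 / 2) ξ : ℂ) * (bessel (1 / 2) ξ : ℂ) = 1 := by
    rw [← ofReal_mul, ← bessel_add]; norm_num [bessel]
  rw [RCLike.inner_apply, map_mul, conj_ofReal]
  linear_combination (a * starRingEnd ℂ b) * h2

/-- Multiplication by `(1 + |ξ|²)^{1/2}` maps `H^{1/2}` to `H^{-1/2}` and turns the pairing into the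
Hilbert space inner product. Integrability, additivity and joint continuity follow. -/
lemma sobolevPairing_eq_inner (u : Sobolev d (-1 / 2)) (v : Sobolev d (1 / 2)) :
    Integrable (fun ξ => u ξ * starRingEnd ℂ (v ξ)) ∧
    sobolevPairing u v = (((2 * Real.pi : ℝ) : ℂ) ^ d)⁻¹ *
      inner ℂ (multiplier d (1 / 2) (-1 / 2) (fun ξ => ((bessel (1 / 2) ξ : ℝ) : ℂ)) v) u := by
  set J := multiplier d (1 / 2) (-1 / 2) (fun ξ => ((bessel (1 / 2) ξ : ℝ) : ℂ)) v
  have hJ := isMultiplier_bessel_half.ae_eq v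
  have h1 := L2.integrable_inner (𝕜 := ℂ) J u
  have e : ∀ᵐ ξ, (ENNReal.ofReal (bessel (-1 / 2) ξ)).toReal • inner ℂ (J ξ) (u ξ) =
      u ξ * starRingEnd ℂ (v ξ) := by
    filter_upwards [hJ] with ξ hξ
    rw [hξ, ENNReal.toReal_ofReal (bessel_pos _ _).le, real_smul, inner_bessel_half]
  unfold sobolevMeasure at h1
  rw [integrable_withDensity_iff_integrable_smul' (measurable_ofReal_bessel _)
    (Filter.Eventually.of_forall fun _ => ENNReal.ofReal_lt_top)] at h1
  refine ⟨h1.congr e, ?_⟩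
  rw [L2.inner_def, sobolevPairing]
  congr 1
  rw [← integral_congr_ae e]
  unfold sobolevMeasure
  rw [integral_withDensity_eq_integral_toReal_smul (measurable_ofReal_bessel _)
    (Filter.Eventually.of_forall fun _ => ENNReal.ofReal_lt_top)]

lemma continuous_sobolevPairing :
    Continuous fun p : Sobolev d (-1 / 2) × Sobolev d (1 / 2) => sobolevPairing p.1 p.2 := by
  simp only [(sobolevPairing_eq_inner _ _).2]
  fun_prop

lemma sobolevPairing_sum_right {ι : Type*} (s : Finset ι) (u : Sobolev d (-1 / 2))
    (v : ι → Sobolev d (1 / 2)) :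
    sobolevPairing u (∑ i ∈ s, v i) = ∑ i ∈ s, sobolevPairing u (v i) := by
  simp only [(sobolevPairing_eq_inner _ _).2, map_sum, sum_inner, Finset.mul_sum]

lemma sobolevPairing_sub_left (u u' : Sobolev d (-1 / 2)) (v : Sobolev d (1 / 2)) :
    sobolevPairing (u - u') v = sobolevPairing u v - sobolevPairing u' v := by
  simp only [(sobolevPairing_eq_inner _ _).2, inner_sub_right, mul_sub]

end SobolevSpaces

/-! ### The operator at fixed frequency and its causality -/

section DirichletToNeumann

variable {d : ℕ}

/-- The point `ξ₀ + iσ`. -/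
abbrev freq (σ ξ₀ : ℝ) : ℂ := ξ₀ + σ * I

lemma norm_freq_le (σ ξ₀ : ℝ) : ‖freq σ ξ₀‖ ≤ |ξ₀| + |σ| := by
  refine (norm_add_le _ _).trans (le_of_eq ?_)
  simp

/-- The symbol of the Dirichlet-to-Neumann operator. -/
def dtnSymbol (μ c : ℝ) (ω : ℂ) (ξ : Space d) : ℂ := -I * μ * symbolRoot c ω ξ

lemma dtnSymbol_eq (μ c : ℝ) (ω : ℂ) (ξ : Space d) :
    dtnSymbol μ c ω ξ = μ * realRoot c ‖ξ‖ ω := by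
  rw [dtnSymbol, symbolRoot_eq]
  linear_combination (-(μ : ℂ) * realRoot c ‖ξ‖ ω) * I_sq

lemma continuous_dtnSymbol (μ : ℝ) {c : ℝ} (hc : 0 < c) {ω : ℂ} (hω : 0 < ω.im) :
    Continuous (dtnSymbol μ c ω : Space d → ℂ) := by
  have := continuous_realRoot hc hω
  have h2 : Continuous fun ξ : Space d => (μ : ℂ) * realRoot c ‖ξ‖ ω := by fun_prop
  convert h2 using 2
  exact dtnSymbol_eq _ _ _ _

lemma norm_dtnSymbol_sq_le {μ c : ℝ} (hμ : 0 < μ) (hc : 0 < c) (ω : ℂ) (ξ : Space d) :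
    ‖dtnSymbol μ c ω ξ‖ ^ 2 ≤ (μ * (1 + c⁻¹)) ^ 2 * (‖ω‖ ^ 2 + ‖ξ‖ ^ 2) := by
  rw [dtnSymbol_eq, norm_mul, norm_real, Real.norm_of_nonneg hμ.le]
  have h := norm_realRoot_le hc ‖ξ‖ ω
  rw [← Real.sqrt_eq_rpow] at h
  calc (μ * ‖realRoot c ‖ξ‖ ω‖) ^ 2 ≤ (μ * ((1 + c⁻¹) * √(‖ω‖ ^ 2 + ‖ξ‖ ^ 2))) ^ 2 := by gcongr
    _ = _ := by rw [← mul_assoc, mul_pow, Real.sq_sqrt (by positivity)]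

/-- The substitution `s` covers both the identity and its simple approximations, which satisfy `‖s
ξ‖ ≤ 2‖ξ‖`. The constant comes from `‖ω‖² + 4‖ξ‖² ≤ (2 + ‖ω‖)² (1 + ‖ξ‖²)`. -/
lemma isMultiplier_dtnSymbol_comp {μ c : ℝ} (hμ : 0 < μ) (hc : 0 < c) {ω : ℂ} (hω : 0 < ω.im)
    {s : Space d → Space d} (hs : Measurable s) (hs2 : ∀ ξ, ‖s ξ‖ ≤ ‖ξ‖ + ‖ξ‖) :
    IsMultiplier (1 / 2) (-1 / 2) (μ * (1 + c⁻¹) * (2 + ‖ω‖)) fun ξ => dtnSymbol μ c ω (s ξ) where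
  measurable := (continuous_dtnSymbol μ hc hω).measurable.comp hs
  nonneg := by positivity
  bound ξ := by
    have hb : bessel (1 / 2) ξ = (1 + ‖ξ‖ ^ 2) * bessel (-1 / 2) ξ := by
      have : bessel 1 ξ = 1 + ‖ξ‖ ^ 2 := Real.rpow_one _
      rw [← this, ← bessel_add]; norm_num
    rw [hb, ← mul_assoc]
    refine mul_le_mul_of_nonneg_right ?_ (bessel_pos _ ξ).le
    refine (norm_dtnSymbol_sq_le hμ hc ω (s ξ)).trans ?_
    rw [mul_pow (μ * (1 + c⁻¹)), mul_assoc]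
    refine mul_le_mul_of_nonneg_left ?_ (by positivity)
    have h1 : ‖s ξ‖ ^ 2 ≤ (‖ξ‖ + ‖ξ‖) ^ 2 := by have := hs2 ξ; gcongr
    nlinarith [norm_nonneg ω, norm_nonneg ξ, mul_nonneg (norm_nonneg ω) (sq_nonneg ‖ξ‖),
      mul_nonneg (sq_nonneg ‖ω‖) (sq_nonneg ‖ξ‖)]

lemma isMultiplier_dtnSymbol {μ c : ℝ} (hμ : 0 < μ) (hc : 0 < c) {ω : ℂ} (hω : 0 < ω.im) :
    IsMultiplier (d := d) (1 / 2) (-1 / 2) (μ * (1 + c⁻¹) * (2 + ‖ω‖)) (dtnSymbol μ c ω) :=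
  isMultiplier_dtnSymbol_comp hμ hc hω measurable_id fun ξ => by simp

variable (d) in
/-- The Dirichlet-to-Neumann operator at the frequency `ω`. -/
def dtnOp (μ c : ℝ) (ω : ℂ) : Sobolev d (1 / 2) →L[ℂ] Sobolev d (-1 / 2) :=
  multiplier d (1 / 2) (-1 / 2) (dtnSymbol μ c ω)

variable (d) in
/-- Simple functions converging to the identity. -/
def simpleId (n : ℕ) : SimpleFunc (Space d) (Space d) :=
  SimpleFunc.approxOn id measurable_id Set.univ 0 (Set.mem_univ _) n

variable (d) in
/-- The operator whose symbol is that of `dtnOp` with the space frequency made discrete. -/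
def dtnApprox (μ c : ℝ) (n : ℕ) (ω : ℂ) (u : Sobolev d (1 / 2)) : Sobolev d (-1 / 2) :=
  ∑ η ∈ (simpleId d n).range, dtnSymbol μ c ω η •
    multiplier d (1 / 2) (-1 / 2) ((simpleId d n ⁻¹' {η}).indicator 1) u

lemma isMultiplier_indicator {s : Set (Space d)} (hs : MeasurableSet s) :
    IsMultiplier (1 / 2) (-1 / 2) 1 (s.indicator (1 : Space d → ℂ)) where
  measurable := measurable_one.indicator hs
  nonneg := zero_le_one
  bound ξ := by
    have h1 : ‖s.indicator (1 : Space d → ℂ) ξ‖ ≤ 1 := by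
      by_cases h : ξ ∈ s <;> simp [h]
    have h2 : bessel (-1 / 2) ξ ≤ bessel (1 / 2) ξ :=
      Real.rpow_le_rpow_of_exponent_le (by nlinarith [sq_nonneg ‖ξ‖]) (by norm_num)
    have h3 := bessel_pos (-1 / 2) ξ
    calc _ ≤ 1 ^ 2 * bessel (-1 / 2) ξ := by gcongr
      _ ≤ _ := by gcongr

/-- The approximation is the multiplier with symbol evaluated at the simple function. Continuity of
the symbol gives pointwise convergence, and the bound uniform in `n` permits dominated convergence.
-/
lemma tendsto_dtnApprox {μ c : ℝ} (hμ : 0 < μ) (hc : 0 < c) {ω : ℂ} (hω : 0 < ω.im)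
    (u : Sobolev d (1 / 2)) :
    Filter.Tendsto (fun n => dtnApprox d μ c n ω u) Filter.atTop (nhds (dtnOp d μ c ω u)) ∧
      ∀ n, ‖dtnApprox d μ c n ω u‖ ≤ μ * (1 + c⁻¹) * (2 + ‖ω‖) * ‖u‖ := by
  have hM (n : ℕ) : IsMultiplier (1 / 2) (-1 / 2) (μ * (1 + c⁻¹) * (2 + ‖ω‖))
      fun ξ => dtnSymbol μ c ω (simpleId d n ξ) :=
    isMultiplier_dtnSymbol_comp hμ hc hω (simpleId d n).measurable fun ξ =>
      SimpleFunc.norm_approxOn_zero_le measurable_id (Set.mem_univ _) ξ n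
  have he (n : ℕ) : multiplier d (1 / 2) (-1 / 2) (fun ξ => dtnSymbol μ c ω (simpleId d n ξ)) u =
      dtnApprox d μ c n ω u := by
    refine sobolev_ext ?_
    have h1 : ∀ᵐ ξ, dtnApprox d μ c n ω u ξ = ∑ η ∈ (simpleId d n).range,
        (dtnSymbol μ c ω η •
          multiplier d (1 / 2) (-1 / 2) ((simpleId d n ⁻¹' {η}).indicator 1) u) ξ := by
      refine ae_sobolevMeasure_iff.1 (((Lp.coeFn_finsetSum _ _)).trans ?_)
      exact Filter.Eventually.of_forall fun ξ => by simp
    have h2 : ∀ η ∈ (simpleId d n).range, ∀ᵐ ξ, (dtnSymbol μ c ω η •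
          multiplier d (1 / 2) (-1 / 2) ((simpleId d n ⁻¹' {η}).indicator 1) u) ξ =
        dtnSymbol μ c ω η * ((simpleId d n ⁻¹' {η}).indicator 1 ξ * u ξ) := fun η _ => by
      filter_upwards [ae_sobolevMeasure_iff.1 (Lp.coeFn_smul (dtnSymbol μ c ω η)
        (multiplier d (1 / 2) (-1 / 2) ((simpleId d n ⁻¹' {η}).indicator 1) u)),
        (isMultiplier_indicator ((simpleId d n).measurableSet_fiber η)).ae_eq u] with ξ h3 h4
      rw [h3, Pi.smul_apply, h4, smul_eq_mul]
    filter_upwards [(hM n).ae_eq u, h1, (Finset.eventually_all _).2 h2] with ξ h3 h4 h5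
    -- The fibres partition the space, so only the value taken at `ξ` contributes.
    rw [h3, h4, Finset.sum_congr rfl h5, Finset.sum_eq_single (simpleId d n ξ)]
    · simp
    · intro η _ hη
      simp [hη.symm]
    · exact fun h => absurd (SimpleFunc.mem_range_self _ ξ) h
  refine ⟨?_, fun n => he n ▸ (hM n).norm_le u⟩
  refine (tendsto_multiplier (isMultiplier_dtnSymbol hμ hc hω) hM (fun ξ => ?_) u).congr he
  refine ((continuous_dtnSymbol μ hc hω).tendsto ξ).comp ?_
  exact SimpleFunc.tendsto_approxOn measurable_id (Set.mem_univ _) (by simp)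

lemma norm_dtnOp_le {μ c : ℝ} (hμ : 0 < μ) (hc : 0 < c) {ω : ℂ} (hω : 0 < ω.im)
    (u : Sobolev d (1 / 2)) : ‖dtnOp d μ c ω u‖ ≤ μ * (1 + c⁻¹) * (2 + ‖ω‖) * ‖u‖ :=
  (isMultiplier_dtnSymbol hμ hc hω).norm_le u

lemma freq_im_pos {σ : ℝ} (hσ : 0 < σ) (ξ₀ : ℝ) : 0 < (freq σ ξ₀).im := by simpa using hσ

lemma continuous_dtnSymbol_freq (μ : ℝ) {c : ℝ} (hc : 0 < c) {σ : ℝ} (hσ : 0 < σ) (η : Space d) :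
    Continuous fun ξ₀ => dtnSymbol μ c (freq σ ξ₀) η := by
  simp only [dtnSymbol_eq]
  refine continuous_const.mul (continuous_iff_continuousAt.2 fun ξ₀ => ?_)
  exact ContinuousAt.comp (g := realRoot c ‖η‖) (f := fun ξ₀ : ℝ => freq σ ξ₀)
    (differentiableAt_realRoot hc _ (freq_im_pos hσ ξ₀)).continuousAt (by fun_prop)

lemma aestronglyMeasurable_dtnApprox (μ : ℝ) {c : ℝ} (hc : 0 < c) {σ : ℝ} (hσ : 0 < σ)
    {f : ℝ → Sobolev d (1 / 2)} (hf : AEStronglyMeasurable f) (n : ℕ) :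
    AEStronglyMeasurable fun ξ₀ => dtnApprox d μ c n (freq σ ξ₀) (f ξ₀) := by
  unfold dtnApprox
  refine Finset.aestronglyMeasurable_fun_sum _ fun η _ => ?_
  exact (continuous_dtnSymbol_freq μ hc hσ η).aestronglyMeasurable.smul
    ((ContinuousLinearMap.continuous _).comp_aestronglyMeasurable hf)

lemma aestronglyMeasurable_dtnOp {μ c : ℝ} (hμ : 0 < μ) (hc : 0 < c) {σ : ℝ} (hσ : 0 < σ)
    {f : ℝ → Sobolev d (1 / 2)} (hf : AEStronglyMeasurable f) :
    AEStronglyMeasurable fun ξ₀ => dtnOp d μ c (freq σ ξ₀) (f ξ₀) :=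
  aestronglyMeasurable_of_tendsto_ae Filter.atTop
    (fun n => aestronglyMeasurable_dtnApprox μ hc hσ hf n)
    (Filter.Eventually.of_forall fun ξ₀ => (tendsto_dtnApprox hμ hc (freq_im_pos hσ ξ₀) (f ξ₀)).1)

/-- The polynomial weight is absorbed into `k`, whose product with it is again a Schwartz function.
-/
lemma integrable_schwartz_growth {E : Type*} [NormedAddCommGroup E] [NormedSpace ℂ E] {f : ℝ → E}
    (hf : ∀ k : 𝓢(ℝ, ℂ), Integrable fun ξ₀ => k ξ₀ • f ξ₀) (σ : ℝ) (k : 𝓢(ℝ, ℂ)) :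
    Integrable fun ξ₀ => ‖k ξ₀‖ * ((3 + |σ|) * (1 + ξ₀ ^ 2) * ‖f ξ₀‖) := by
  have hp : (fun x : ℝ => ((1 + ‖x‖ ^ 2 : ℝ) : ℂ)).HasTemperateGrowth := by fun_prop
  have := ((hf (SchwartzMap.smulLeftCLM ℂ (fun x : ℝ => ((1 + ‖x‖ ^ 2 : ℝ) : ℂ)) k)).norm).const_mul
    (3 + |σ|)
  refine this.congr (Filter.Eventually.of_forall fun x => ?_)
  beta_reduce
  rw [SchwartzMap.smulLeftCLM_apply_apply hp, norm_smul, norm_smul, norm_real,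
    Real.norm_of_nonneg (by positivity), Real.norm_eq_abs, sq_abs]
  ring

lemma two_add_norm_freq_le (σ ξ₀ : ℝ) : 2 + ‖freq σ ξ₀‖ ≤ (3 + |σ|) * (1 + ξ₀ ^ 2) := by
  have := norm_freq_le σ ξ₀
  have h2 : |ξ₀| ≤ 1 + ξ₀ ^ 2 := by nlinarith [sq_abs ξ₀, sq_nonneg (|ξ₀| - 1), abs_nonneg ξ₀]
  nlinarith [abs_nonneg σ, mul_nonneg (abs_nonneg σ) (sq_nonneg ξ₀)]

/-- The Dirichlet-to-Neumann operator is causal. -/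
lemma integral_dtnOp_eq_zero {μ c : ℝ} (hμ : 0 < μ) (hc : 0 < c) {σ : ℝ} (hσ : 0 < σ)
    {f : ℝ → Sobolev d (1 / 2)} (hfm : AEStronglyMeasurable f)
    (hfi : ∀ k : 𝓢(ℝ, ℂ), Integrable fun ξ₀ => k ξ₀ • f ξ₀)
    (hf : ∀ k : 𝓢(ℝ, ℂ), tsupport (expMap ℝ k) ⊆ Set.Iio 0 → ∫ ξ₀, k ξ₀ • f ξ₀ = 0)
    {g : 𝓓((⊤ : Opens ℝ), ℝ)} (hg : tsupport g ⊆ Set.Iio 0) :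
    ∫ ξ₀, expMapInv ℝ (expWeight σ g) ξ₀ • dtnOp d μ c (freq σ ξ₀) (f ξ₀) = 0 := by
  set k := expMapInv ℝ (expWeight σ g)
  have hlim : Filter.Tendsto (fun n => ∫ ξ₀, k ξ₀ • dtnApprox d μ c n (freq σ ξ₀) (f ξ₀))
      Filter.atTop (nhds (∫ ξ₀, k ξ₀ • dtnOp d μ c (freq σ ξ₀) (f ξ₀))) := by
    refine tendsto_integral_of_dominated_convergence (fun ξ₀ => μ * (1 + c⁻¹) *
      (‖k ξ₀‖ * ((3 + |σ|) * (1 + ξ₀ ^ 2) * ‖f ξ₀‖)))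
      (fun n => k.continuous.aestronglyMeasurable.smul
        (aestronglyMeasurable_dtnApprox μ hc hσ hfm n))
      ((integrable_schwartz_growth hfi σ k).const_mul _)
      (fun n => Filter.Eventually.of_forall fun ξ₀ => ?_)
      (Filter.Eventually.of_forall fun ξ₀ =>
        (tendsto_dtnApprox hμ hc (freq_im_pos hσ ξ₀) (f ξ₀)).1.const_smul (k ξ₀))
    rw [norm_smul]
    calc _ ≤ ‖k ξ₀‖ * (μ * (1 + c⁻¹) * (2 + ‖freq σ ξ₀‖) * ‖f ξ₀‖) := by
          gcongr
          exact (tendsto_dtnApprox hμ hc (freq_im_pos hσ ξ₀) (f ξ₀)).2 n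
      _ ≤ ‖k ξ₀‖ * (μ * (1 + c⁻¹) * ((3 + |σ|) * (1 + ξ₀ ^ 2)) * ‖f ξ₀‖) := by
          gcongr
          exact two_add_norm_freq_le σ ξ₀
      _ = _ := by ring
  refine tendsto_nhds_unique hlim (tendsto_const_nhds.congr fun n => ?_)
  -- With `η` frozen the symbol is a scalar function of `ω` and can be moved onto `k` while the
  -- support in time stays negative. What remains is an operator independent of `ξ₀`, which commutes
  -- with the integral.
  have hterm (η : Space d) : ∃ k' : 𝓢(ℝ, ℂ), (∀ ξ₀, k' ξ₀ = k ξ₀ * dtnSymbol μ c (freq σ ξ₀) η) ∧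
      ∫ ξ₀, k' ξ₀ • f ξ₀ = 0 := by
    obtain ⟨k', hk', hs⟩ := exists_schwartz_mul_holomorphic (F := fun ω => dtnSymbol μ c ω η)
      (fun ω hω => by
        simp only [dtnSymbol_eq]
        exact (differentiableAt_realRoot hc _ hω).const_mul _)
      (C := μ * (1 + c⁻¹) * (1 + ‖η‖)) (fun ω _ => by
        refine abs_le_of_sq_le_sq' ((norm_dtnSymbol_sq_le hμ hc ω η).trans ?_) (by positivity) |>.2
        rw [mul_assoc (μ * (1 + c⁻¹)), mul_pow (μ * (1 + c⁻¹))]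
        refine mul_le_mul_of_nonneg_left ?_ (by positivity)
        have h0 := mul_nonneg (norm_nonneg ω) (norm_nonneg η)
        have h1 : ‖ω‖ + ‖η‖ ≤ (1 + ‖η‖) * (1 + ‖ω‖) := by nlinarith
        calc ‖ω‖ ^ 2 + ‖η‖ ^ 2 ≤ (‖ω‖ + ‖η‖) ^ 2 := by nlinarith
          _ ≤ _ := by gcongr)
      hσ hg
    exact ⟨k', hk', hf k' hs⟩
  choose k' hk' hz using hterm
  have e (ξ₀ : ℝ) : k ξ₀ • dtnApprox d μ c n (freq σ ξ₀) (f ξ₀) =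
      ∑ η ∈ (simpleId d n).range, (multiplier d (1 / 2) (-1 / 2)
        ((simpleId d n ⁻¹' {η}).indicator (1 : Space d → ℂ))) (k' η ξ₀ • f ξ₀) := by
    rw [dtnApprox, Finset.smul_sum]
    refine Finset.sum_congr rfl fun η _ => ?_
    rw [map_smul, smul_smul, hk']
  simp only [e]
  rw [integral_finsetSum _ fun η _ => (ContinuousLinearMap.integrable_comp _ (hfi (k' η)))]
  refine (Finset.sum_eq_zero fun η _ => ?_).symm
  rw [ContinuousLinearMap.integral_comp_comm _ (hfi (k' η)), hz, map_zero]

end DirichletToNeumann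

/-! ### Multiplication by cutoff functions on `H^{1/2}` -/

section Cutoff

variable {d : ℕ}

/-- Cauchy–Schwarz for `f^{1/2}` and `f^{1/2} g`. -/
lemma lintegral_mul_sq_le {α : Type*} [MeasurableSpace α] {ν : Measure α} {f g : α → ℝ≥0∞}
    (hf : AEMeasurable f ν) (hg : AEMeasurable g ν) :
    (∫⁻ x, f x * g x ∂ν) ^ 2 ≤ (∫⁻ x, f x ∂ν) * ∫⁻ x, f x * g x ^ 2 ∂ν := by
  have h := ENNReal.lintegral_mul_le_Lp_mul_Lq ν (p := 2) (q := 2)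
    (Real.HolderConjugate.two_two) (f := fun x => f x ^ (1 / 2 : ℝ))
    (g := fun x => f x ^ (1 / 2 : ℝ) * g x) (hf.pow_const _) ((hf.pow_const _).mul hg)
  have e1 (a : ℝ≥0∞) : (a ^ (1 / 2 : ℝ)) ^ (2 : ℝ) = a := by
    rw [← ENNReal.rpow_mul]; norm_num
  have e2 (a : ℝ≥0∞) : a ^ (1 / 2 : ℝ) * a ^ (1 / 2 : ℝ) = a := by
    rw [← ENNReal.rpow_add_of_nonneg _ _ (by norm_num) (by norm_num)]; norm_num
  have e3 (a : ℝ≥0∞) : (a ^ (1 / 2 : ℝ)) ^ 2 = a := by rw [pow_two, e2]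
  simp only [Pi.mul_apply, ← mul_assoc, e2, e1, ENNReal.mul_rpow_of_nonneg _ _ zero_le_two,
    ENNReal.rpow_two] at h
  calc _ ≤ ((∫⁻ x, f x ∂ν) ^ (1 / 2 : ℝ) * (∫⁻ x, f x * g x ^ 2 ∂ν) ^ (1 / 2 : ℝ)) ^ 2 := by
        gcongr
    _ = _ := by rw [mul_pow, e3, e3]

/-- Peetre's inequality. The factor is the root of the `4` in `1 + (p + q)² ≤ 4 (1 + p²)(1 + q²)`.
-/
lemma bessel_half_le (ξ θ : Space d) :
    bessel (1 / 2) ξ ≤ 2 * (bessel (1 / 2) θ * bessel (1 / 2) (ξ - θ)) := by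
  unfold bessel
  rw [← Real.mul_rpow (by positivity) (by positivity)]
  calc (1 + ‖ξ‖ ^ 2) ^ (1 / 2 : ℝ)
      ≤ (2 ^ 2 * ((1 + ‖θ‖ ^ 2) * (1 + ‖ξ - θ‖ ^ 2))) ^ (1 / 2 : ℝ) := by
        refine Real.rpow_le_rpow (by positivity) ?_ (by norm_num)
        have h : ‖ξ‖ ≤ ‖θ‖ + ‖ξ - θ‖ := norm_le_norm_add_norm_sub' ξ θ
        have h1 : ‖ξ‖ ^ 2 ≤ (‖θ‖ + ‖ξ - θ‖) ^ 2 := by gcongr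
        nlinarith [sq_nonneg (‖θ‖ - ‖ξ - θ‖), mul_nonneg (sq_nonneg ‖θ‖) (sq_nonneg ‖ξ - θ‖)]
    _ = _ := by
        rw [Real.mul_rpow (by positivity) (by positivity), ← Real.sqrt_eq_rpow (2 ^ 2),
          Real.sqrt_sq zero_le_two]

/-- Young's inequality for the convolution of a Schwartz function with the Fourier transform of an
element of `H^{1/2}`. -/
lemma lintegral_convolution_lt_top (a : 𝓢(Space d, ℂ)) (v : Sobolev d (1 / 2)) :
    ∫⁻ ξ, ENNReal.ofReal (bessel (1 / 2) ξ) * (∫⁻ θ, ‖a θ‖ₑ * ‖v (ξ - θ)‖ₑ) ^ 2 < ⊤ := by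
  have ham : Measurable fun θ => ‖a θ‖ₑ := a.continuous.measurable.enorm
  have hvm : Measurable fun ξ => ‖v ξ‖ₑ := (Lp.stronglyMeasurable v).measurable.enorm
  have hbm := measurable_ofReal_bessel (d := d) (1 / 2)
  have hA : ∫⁻ θ, ‖a θ‖ₑ < ⊤ := a.integrable.2
  have hB : ∫⁻ θ, ‖a θ‖ₑ * ENNReal.ofReal (bessel (1 / 2) θ) < ⊤ := by
    have hb : (fun ξ : Space d => ((bessel (1 / 2) ξ : ℝ) : ℂ)).HasTemperateGrowth := by
      unfold bessel; fun_prop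
    have h := (SchwartzMap.smulLeftCLM ℂ (fun ξ : Space d => ((bessel (1 / 2) ξ : ℝ) : ℂ))
      a).integrable (μ := volume).2
    refine lt_of_eq_of_lt (lintegral_congr fun θ => ?_) h
    rw [SchwartzMap.smulLeftCLM_apply_apply hb, enorm_smul, mul_comm,
      ← ofReal_norm ((bessel (1 / 2) θ : ℝ) : ℂ), norm_real, Real.norm_of_nonneg (bessel_pos _ _).le]
  -- Cauchy–Schwarz with respect to `|a| dθ`, then the weight is split between `a` and `v`.
  -- Tonelli's theorem and translation invariance separate the two integrals.
  calc _ ≤ ∫⁻ ξ, ∫⁻ θ, (∫⁻ θ, ‖a θ‖ₑ) * 2 * (‖a θ‖ₑ * ENNReal.ofReal (bessel (1 / 2) θ) *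
        (ENNReal.ofReal (bessel (1 / 2) (ξ - θ)) * ‖v (ξ - θ)‖ₑ ^ 2)) := by
        refine lintegral_mono fun ξ => ?_
        calc _ ≤ ENNReal.ofReal (bessel (1 / 2) ξ) *
              ((∫⁻ θ, ‖a θ‖ₑ) * ∫⁻ θ, ‖a θ‖ₑ * ‖v (ξ - θ)‖ₑ ^ 2) := by
              gcongr
              exact lintegral_mul_sq_le ham.aemeasurable
                (hvm.comp (measurable_const.sub measurable_id)).aemeasurable
          _ = ∫⁻ θ, ENNReal.ofReal (bessel (1 / 2) ξ) * ((∫⁻ θ, ‖a θ‖ₑ) *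
              (‖a θ‖ₑ * ‖v (ξ - θ)‖ₑ ^ 2)) := by
              rw [lintegral_const_mul' _ _ ENNReal.ofReal_ne_top, lintegral_const_mul' _ _ hA.ne]
          _ ≤ _ := by
              refine lintegral_mono fun θ => ?_
              calc _ ≤ ENNReal.ofReal (2 * (bessel (1 / 2) θ * bessel (1 / 2) (ξ - θ))) *
                    ((∫⁻ θ, ‖a θ‖ₑ) * (‖a θ‖ₑ * ‖v (ξ - θ)‖ₑ ^ 2)) := by
                    gcongr
                    exact bessel_half_le ξ θ
                _ = _ := by
                    rw [ENNReal.ofReal_mul zero_le_two, ENNReal.ofReal_mul (bessel_pos _ _).le]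
                    simp only [ENNReal.ofReal_ofNat]
                    ring
    _ = ∫⁻ θ, ∫⁻ ξ, (∫⁻ θ, ‖a θ‖ₑ) * 2 * (‖a θ‖ₑ * ENNReal.ofReal (bessel (1 / 2) θ) *
        (ENNReal.ofReal (bessel (1 / 2) (ξ - θ)) * ‖v (ξ - θ)‖ₑ ^ 2)) := by
        refine lintegral_lintegral_swap (Measurable.aemeasurable ?_)
        have h1 : Measurable fun p : Space d × Space d => p.1 - p.2 := measurable_fst.sub measurable_snd
        exact measurable_const.mul ((ham.comp measurable_snd |>.mul (hbm.comp measurable_snd)).mul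
          ((hbm.comp h1).mul ((hvm.comp h1).pow_const 2)))
    _ = (∫⁻ θ, ‖a θ‖ₑ) * 2 * ((∫⁻ θ, ‖a θ‖ₑ * ENNReal.ofReal (bessel (1 / 2) θ)) *
        ‖v‖ₑ ^ 2) := by
        have hne : (∫⁻ θ, ‖a θ‖ₑ) * 2 ≠ ⊤ := ENNReal.mul_ne_top hA.ne (by simp)
        have (θ : Space d) : ∫⁻ ξ, (∫⁻ θ, ‖a θ‖ₑ) * 2 * (‖a θ‖ₑ * ENNReal.ofReal (bessel (1 / 2) θ) *
            (ENNReal.ofReal (bessel (1 / 2) (ξ - θ)) * ‖v (ξ - θ)‖ₑ ^ 2)) =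
            (∫⁻ θ, ‖a θ‖ₑ) * 2 * (‖a θ‖ₑ * ENNReal.ofReal (bessel (1 / 2) θ) * ‖v‖ₑ ^ 2) := by
          rw [lintegral_const_mul' _ _ hne, lintegral_const_mul' _ _
            (ENNReal.mul_ne_top (by simp) ENNReal.ofReal_ne_top), lintegral_sub_right_eq_self
            (fun ξ => ENNReal.ofReal (bessel (1 / 2) ξ) * ‖v ξ‖ₑ ^ 2), enorm_sobolev_sq]
        simp only [this]
        rw [lintegral_const_mul' _ _ hne, lintegral_mul_const' _ _ (by simp)]
    _ < ⊤ := ENNReal.mul_lt_top (ENNReal.mul_lt_top hA (by simp))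
        (ENNReal.mul_lt_top hB (by simp))

/-- A product is at most the sum of the squares, and the weight is at least `1`. The finiteness
justifies the uses of Fubini's theorem in `exists_cutoff`. -/
lemma lintegral_convolution_mul_lt_top (a k : 𝓢(Space d, ℂ)) (v : Sobolev d (1 / 2)) :
    ∫⁻ ξ, ∫⁻ θ, ‖a θ * v (ξ - θ) * k ξ‖ₑ < ⊤ := by
  have hk : ∫⁻ ξ, ‖k ξ‖ₑ ^ 2 < ⊤ := by
    have h := (k.memLp 2 (volume : Measure (Space d))).eLpNorm_lt_top
    rw [eLpNorm_lt_top_iff_lintegral_rpow_enorm_lt_top (by simp) (by simp)] at h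
    simpa using h
  calc _ ≤ ∫⁻ ξ, (ENNReal.ofReal (bessel (1 / 2) ξ) * (∫⁻ θ, ‖a θ‖ₑ * ‖v (ξ - θ)‖ₑ) ^ 2 +
        ‖k ξ‖ₑ ^ 2) := by
        refine lintegral_mono fun ξ => ?_
        simp only [enorm_mul]
        rw [lintegral_mul_const' _ _ (by simp)]
        set A := ∫⁻ θ, ‖a θ‖ₑ * ‖v (ξ - θ)‖ₑ
        have h1 : A ^ 2 ≤ ENNReal.ofReal (bessel (1 / 2) ξ) * A ^ 2 := by
          refine le_mul_of_one_le_left (by positivity) ?_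
          rw [ENNReal.one_le_ofReal]
          exact Real.one_le_rpow (by nlinarith [sq_nonneg ‖ξ‖]) (by norm_num)
        refine le_trans ?_ (add_le_add_left h1 _)
        rcases le_total A ‖k ξ‖ₑ with h | h
        · calc A * ‖k ξ‖ₑ ≤ ‖k ξ‖ₑ * ‖k ξ‖ₑ := by gcongr
            _ ≤ _ := by rw [← pow_two]; exact le_add_self
        · calc A * ‖k ξ‖ₑ ≤ A * A := by gcongr
            _ ≤ _ := by rw [← pow_two]; exact le_self_add
    _ = _ := lintegral_add_right _ (k.continuous.measurable.enorm.pow_const 2)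
    _ < ⊤ := ENNReal.add_lt_top.2 ⟨lintegral_convolution_lt_top a v, hk⟩

/-- Multiplication by a smooth compactly supported function acts on `H^{1/2}`. -/
lemma exists_cutoff {χ : Space d → ℝ} (hχ : ContDiff ℝ ((⊤ : ℕ∞) : WithTop ℕ∞) χ)
    (hχc : HasCompactSupport χ) (v : Sobolev d (1 / 2)) :
    ∃ w : Sobolev d (1 / 2), ∀ g g' : 𝓢(Space d, ℂ), (∀ x, g' x = χ x * g x) →
      toDistribution w g = toDistribution v g' := by
  let X : 𝓢(Space d, ℂ) := (hχc.comp_left (g := ofReal) ofReal_zero).toSchwartzMap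
    (ofRealCLM.contDiff.comp hχ)
  set a := expMapInv (Space d) X with ha
  -- Multiplication by `χ` is thus convolution with `a` on the frequency side, which defines `w`.
  have hX (x : Space d) : (χ x : ℂ) = ∫ θ, cexp (I * (inner ℝ θ x : ℝ)) * a θ := by
    rw [← expMap_apply, ha, expMap_expMapInv]; rfl
  have hvm : Measurable v := (Lp.stronglyMeasurable v).measurable
  have ham : Measurable a := a.continuous.measurable
  have h1 : Measurable fun p : Space d × Space d => p.1 - p.2 := measurable_fst.sub measurable_snd
  have hFm : Measurable fun p : Space d × Space d => a p.2 * v (p.1 - p.2) :=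
    (ham.comp measurable_snd).mul (hvm.comp h1)
  have hfin : ∫⁻ ξ, ENNReal.ofReal (bessel (1 / 2) ξ) * ‖∫ θ, a θ * v (ξ - θ)‖ₑ ^ 2 < ⊤ := by
    refine lt_of_le_of_lt (lintegral_mono fun ξ => ?_) (lintegral_convolution_lt_top a v)
    gcongr
    refine (enorm_integral_le_lintegral_enorm _).trans (le_of_eq ?_)
    simp only [enorm_mul]
  obtain ⟨w, hw⟩ := exists_sobolev (r := 1 / 2) (f := fun ξ => ∫ θ, a θ * v (ξ - θ))
    (hFm.stronglyMeasurable.integral_prod_right (f := fun ξ θ => a θ * v (ξ - θ))).aestronglyMeasurable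
    hfin
  refine ⟨w, fun g g' hg => ?_⟩
  unfold toDistribution
  congr 1
  set k := expMap (Space d) g
  have hkm : Measurable k := k.continuous.measurable
  have htr (η : Space d) : expTransform g' η = ∫ θ, a θ * k (η + θ) := by
    have e1 (x : Space d) : cexp (I * (inner ℝ x η : ℝ)) * g' x =
        ∫ θ, a θ * (cexp (I * (inner ℝ x (η + θ) : ℝ)) * g x) := by
      rw [hg, hX, ← integral_mul_const, ← integral_const_mul]
      congr 1 with θ
      rw [inner_add_right, ofReal_add, mul_add, Complex.exp_add, real_inner_comm θ x]
      ring
    have e2 (θ : Space d) : a θ * k (η + θ) =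
        ∫ x, a θ * (cexp (I * (inner ℝ x (η + θ) : ℝ)) * g x) := by
      rw [integral_const_mul, expMap_apply]
    simp only [expTransform, e1, e2]
    refine integral_integral_swap ?_
    have h2 : Integrable (fun p : Space d × Space d => ‖g p.1‖ * ‖a p.2‖) :=
      g.integrable.norm.mul_prod a.integrable.norm
    refine h2.mono' (Measurable.aestronglyMeasurable ?_) (Filter.Eventually.of_forall fun p => ?_)
    · have := g.continuous
      have := a.continuous
      exact Continuous.measurable (by fun_prop)
    · simp only [Function.uncurry, norm_mul, mul_comm I, norm_exp_ofReal_mul_I, one_mul]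
      exact (mul_comm _ _).le
  have hswap1 : ∫ ξ, w ξ * expTransform g ξ = ∫ θ, ∫ ξ, a θ * v (ξ - θ) * k ξ := by
    rw [← integral_integral_swap (f := fun ξ θ => a θ * v (ξ - θ) * k ξ)]
    · refine integral_congr_ae ?_
      filter_upwards [hw] with ξ hξ
      rw [hξ, expTransform_eq, ← integral_mul_const]
    · refine ⟨(hFm.mul (hkm.comp measurable_fst)).aestronglyMeasurable, ?_⟩
      exact (lintegral_prod _ (hFm.mul (hkm.comp measurable_fst)).enorm.aemeasurable).trans_lt
        (lintegral_convolution_mul_lt_top a k v)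
  rw [hswap1]
  have hshift (θ : Space d) : ∫ ξ, a θ * v (ξ - θ) * k ξ = ∫ η, a θ * v η * k (η + θ) := by
    rw [← integral_sub_right_eq_self (fun η => a θ * v η * k (η + θ)) θ]
    simp
  simp only [hshift]
  have hGm : Measurable fun p : Space d × Space d => a p.1 * v p.2 * k (p.2 + p.1) :=
    ((ham.comp measurable_fst).mul (hvm.comp measurable_snd)).mul
      (hkm.comp (measurable_snd.add measurable_fst))
  rw [integral_integral_swap (f := fun θ η => a θ * v η * k (η + θ))]
  · congr 1 with η
    rw [htr, ← integral_const_mul]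
    congr 1 with θ
    ring
  · refine ⟨hGm.aestronglyMeasurable, ?_⟩
    refine (lintegral_prod _ hGm.enorm.aemeasurable).trans_lt ?_
    have e (θ : Space d) : ∫⁻ η, ‖a θ * v η * k (η + θ)‖ₑ = ∫⁻ ξ, ‖a θ * v (ξ - θ) * k ξ‖ₑ := by
      rw [← lintegral_sub_right_eq_self (fun η => ‖a θ * v η * k (η + θ)‖ₑ) θ]
      simp
    simp only [e]
    rw [← lintegral_lintegral_swap (f := fun ξ θ => ‖a θ * v (ξ - θ) * k ξ‖ₑ)
      (hFm.mul (hkm.comp measurable_fst)).enorm.aemeasurable]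
    exact lintegral_convolution_mul_lt_top a k v

end Cutoff

/-! ### Vanishing of the pairing for separated supports -/

section Mollification

variable {d : ℕ}

lemma integral_expMap_mul (q : 𝓢(Space d, ℂ)) {b : Space d → ℂ} (hb : Integrable b) :
    ∫ ξ, expMap (Space d) q ξ * b ξ =
      ∫ x, q x * ∫ ξ, cexp (I * (inner ℝ ξ x : ℝ)) * b ξ := by
  simp only [expMap_apply, ← integral_mul_const, ← integral_const_mul]
  rw [integral_integral_swap]
  · congr 1 with x
    congr 1 with ξ
    rw [real_inner_comm]
    ring
  · refine (hb.norm.mul_prod q.integrable.norm).mono' ?_ (Filter.Eventually.of_forall fun p => ?_)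
    · refine AEStronglyMeasurable.mul ?_ hb.1.comp_fst
      have := q.continuous
      exact Continuous.aestronglyMeasurable (by fun_prop)
    · simp only [Function.uncurry, norm_mul, mul_comm I, norm_exp_ofReal_mul_I, one_mul]
      exact (mul_comm _ _).le

/-- Fourier inversion for an integrable function whose Fourier integral is a Schwartz function. -/
lemma ae_eq_expMapInv {b : Space d → ℂ} (hb : Integrable b) {V : 𝓢(Space d, ℂ)}
    (hV : ∀ x, V x = ∫ ξ, cexp (I * (inner ℝ ξ x : ℝ)) * b ξ) :
    ∀ᵐ ξ, b ξ = expMapInv (Space d) V ξ := by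
  have hbk (k : 𝓢(Space d, ℂ)) : Integrable fun ξ => k ξ • b ξ := by
    refine Integrable.bdd_mul hb k.continuous.aestronglyMeasurable (c := SchwartzMap.seminorm ℝ 0 0 k)
      (Filter.Eventually.of_forall fun ξ => ?_)
    exact SchwartzMap.norm_le_seminorm ℝ k ξ
  have hVk (k : 𝓢(Space d, ℂ)) : Integrable fun ξ => k ξ • expMapInv (Space d) V ξ := by
    refine Integrable.bdd_mul (expMapInv (Space d) V).integrable k.continuous.aestronglyMeasurable
      (c := SchwartzMap.seminorm ℝ 0 0 k) (Filter.Eventually.of_forall fun ξ => ?_)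
    exact SchwartzMap.norm_le_seminorm ℝ k ξ
  refine ae_eq_of_integral_schwartz_smul_eq hbk hVk fun k => ?_
  have h1 := integral_expMap_mul (expMapInv (Space d) k) hb
  have h2 := integral_expMap_mul (expMapInv (Space d) k) (expMapInv (Space d) V).integrable
  rw [expMap_expMapInv] at h1 h2
  simp only [smul_eq_mul]
  rw [h1, h2]
  congr 1 with x
  rw [← hV, ← expMap_apply, expMap_expMapInv]

/-- This converts the sesquilinear pairing with `V` into the bilinear testing against the conjugate
of `V`. -/
lemma conj_expMapInv_apply (V g : 𝓢(Space d, ℂ)) (hg : ∀ x, g x = starRingEnd ℂ (V x))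
    (ξ : Space d) : starRingEnd ℂ (expMapInv (Space d) V ξ) =
      (((2 * Real.pi : ℝ) : ℂ) ^ d)⁻¹ * expTransform g ξ := by
  have h1 := Measure.integral_comp_smul (volume : Measure (Space d))
    (fun x : Space d => cexp (I * (inner ℝ x ξ : ℝ)) * g x) (2 * Real.pi)
  rw [abs_of_pos (by positivity), finrank_euclideanSpace_fin, real_smul] at h1
  simp only [expMapInv, ContinuousLinearMap.comp_apply, FourierTransform.fourierCLM_apply,
    SchwartzMap.fourier_coe, Real.fourier_eq', smul_eq_mul,
    SchwartzMap.compCLMOfContinuousLinearEquiv_apply, Function.comp, dilation_symm_apply]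
  rw [← integral_conj, expTransform]
  push_cast at h1 ⊢
  rw [← h1]
  congr 1 with x
  rw [map_mul, hg, ← Complex.exp_conj]
  congr 2
  have h2 : starRingEnd ℂ 2 = 2 := Complex.conj_ofNat 2
  simp [inner_smul_left, h2]
  ring

lemma contDiff_fourierIntegral_of_moments {b : Space d → ℂ}
    (hb : ∀ n : ℕ, Integrable fun ξ => ‖ξ‖ ^ n * ‖b ξ‖) :
    ContDiff ℝ ((⊤ : ℕ∞) : WithTop ℕ∞) fun x : Space d =>
      ∫ ξ, cexp (I * (inner ℝ ξ x : ℝ)) * b ξ := by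
  have h := (Real.contDiff_fourier (f := b) (N := ⊤) fun n _ => hb n).comp
    (contDiff_id.const_smul _ : ContDiff ℝ ((⊤ : ℕ∞) : WithTop ℕ∞)
      fun x : Space d => (-(2 * Real.pi)⁻¹ : ℝ) • x)
  rw [← contDiffOn_univ] at h ⊢
  refine h.congr fun x _ => ?_
  simp only [Function.comp, id, Real.fourier_eq', smul_eq_mul]
  congr 1 with ξ
  congr 2
  have hp : (Real.pi : ℂ) ≠ 0 := by exact_mod_cast Real.pi_ne_zero
  simp only [inner_smul_right]
  push_cast
  field_simp

/-- The pairing of a distribution with a smooth compactly supported function on whose support it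
vanishes. -/
lemma sobolevPairing_eq_zero_of_smooth {F : Set (Space d)} {w : Sobolev d (-1 / 2)}
    (hw : w ∈ supportedIn d (-1 / 2) F) {u : Sobolev d (1 / 2)} {b : Space d → ℂ}
    (hub : ∀ᵐ ξ, u ξ = b ξ) (hb : ∀ n : ℕ, Integrable fun ξ => ‖ξ‖ ^ n * ‖b ξ‖)
    {K : Set (Space d)} (hK : IsCompact K) (hKF : Disjoint K F)
    (hV : ∀ x ∉ K, ∫ ξ, cexp (I * (inner ℝ ξ x : ℝ)) * b ξ = 0) :
    sobolevPairing w u = 0 := by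
  -- Up to a constant, `V₀` is the function on space whose transform is `u`. The moments make it
  -- smooth and its support lies in `K`, so the pairing is a multiple of `w` tested against the
  -- conjugate of `V₀`, away from `F`.
  set V₀ : Space d → ℂ := fun x => ∫ ξ, cexp (I * (inner ℝ ξ x : ℝ)) * b ξ
  have hVc := contDiff_fourierIntegral_of_moments hb
  have hVs : tsupport V₀ ⊆ K := closure_minimal
    (fun x hx => by_contra fun h => hx (hV x h)) hK.isClosed
  have hVK : HasCompactSupport V₀ := hK.of_isClosed_subset (isClosed_tsupport _) hVs
  let V : 𝓢(Space d, ℂ) := hVK.toSchwartzMap hVc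
  let g : 𝓢(Space d, ℂ) := (hVK.comp_left (g := starRingEnd ℂ) (map_zero _)).toSchwartzMap
    (conjCLE.contDiff.comp hVc)
  have hbm : AEStronglyMeasurable b volume :=
    (aestronglyMeasurable_sobolev u).congr hub
  have hbi : Integrable b := by
    have := hb 0
    simp only [pow_zero, one_mul] at this
    exact (integrable_norm_iff hbm).1 this
  have hbV := ae_eq_expMapInv hbi (V := V) fun x => rfl
  have hgs : tsupport g ⊆ Fᶜ := by
    have : tsupport g ⊆ tsupport V₀ := closure_mono fun x hx h => hx (by
      show starRingEnd ℂ (V₀ x) = 0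
      rw [h, map_zero])
    exact (this.trans hVs).trans hKF.subset_compl_right
  have h0 := hw g hgs
  rw [toDistribution, mul_eq_zero] at h0
  have hpi : (((2 * Real.pi : ℝ) : ℂ) ^ d)⁻¹ ≠ 0 := by
    have := Real.pi_ne_zero
    simp [this]
  have h1 := h0.resolve_left hpi
  rw [sobolevPairing]
  have e : ∀ᵐ ξ, w ξ * starRingEnd ℂ (u ξ) =
      (((2 * Real.pi : ℝ) : ℂ) ^ d)⁻¹ * (w ξ * expTransform g ξ) := by
    filter_upwards [hub, hbV] with ξ h2 h3
    rw [h2, h3, conj_expMapInv_apply V g fun x => rfl]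
    ring
  rw [integral_congr_ae e, integral_const_mul, h1]
  simp

lemma tsupport_compSubConst (g : 𝓢(Space d, ℂ)) (a : Space d) {x : Space d}
    (hx : x ∈ tsupport (g.compSubConstCLM ℂ a)) : x - a ∈ tsupport g := by
  have h : tsupport (g.compSubConstCLM ℂ a) ⊆ (fun x => x - a) ⁻¹' tsupport g :=
    closure_minimal (fun y hy => subset_tsupport _ hy)
      ((isClosed_tsupport _).preimage (by fun_prop))
  exact h hx

lemma expTransform_compSubConst (g : 𝓢(Space d, ℂ)) (a ξ : Space d) :
    expTransform (g.compSubConstCLM ℂ a) ξ = cexp (I * (inner ℝ a ξ : ℝ)) * expTransform g ξ := by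
  rw [expTransform, expTransform, ← integral_const_mul,
    ← integral_add_right_eq_self _ a]
  congr 1 with x
  rw [SchwartzMap.compSubConstCLM_apply, add_sub_cancel_right, inner_add_left, ofReal_add, mul_add,
    Complex.exp_add]
  ring

/-- The pairing with a mollification vanishes if the supports are separated. -/
lemma sobolevPairing_mollify_eq_zero {K F : Set (Space d)} (hK : IsCompact K)
    {w : Sobolev d (-1 / 2)} (hw : w ∈ supportedIn d (-1 / 2) F)
    {v : Sobolev d (1 / 2)} (hv : v ∈ supportedIn d (1 / 2) K) {ε : ℝ}
    (hKF : Disjoint (Metric.cthickening ε K) F) {ρ : 𝓢(Space d, ℂ)}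
    (hρ : tsupport ρ ⊆ Metric.closedBall 0 ε) {u : Sobolev d (1 / 2)}
    (hu : ∀ᵐ ξ, u ξ = expTransform ρ ξ * v ξ) : sobolevPairing w u = 0 := by
  refine sobolevPairing_eq_zero_of_smooth hw hu (fun n => ?_) hK.cthickening hKF fun x hx => ?_
  · have hp : (fun x : Space d => ((‖x‖ ^ 2 : ℝ) : ℂ) ^ n).HasTemperateGrowth := by fun_prop
    have h0 := ((integrable_schwartz_smul v (expMap (Space d) ρ)).norm).add
      (integrable_schwartz_smul v (SchwartzMap.smulLeftCLM ℂ
        (fun x : Space d => ((‖x‖ ^ 2 : ℝ) : ℂ) ^ n) (expMap (Space d) ρ))).norm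
    refine h0.mono' ?_ (Filter.Eventually.of_forall fun ξ => ?_)
    · simp only [expTransform_eq]
      exact (continuous_norm.pow n).aestronglyMeasurable.mul
        ((expMap (Space d) ρ).continuous.aestronglyMeasurable.mul
          (aestronglyMeasurable_sobolev v)).norm
    · rw [Pi.add_apply, SchwartzMap.smulLeftCLM_apply_apply hp, expTransform_eq, norm_smul,
        norm_smul, norm_smul, norm_pow, norm_real, Real.norm_of_nonneg (sq_nonneg ‖ξ‖), norm_mul,
        norm_pow, norm_norm, norm_norm, norm_mul]
      -- Odd powers of the norm are not smooth at `0`; the even power is, and can be absorbed into a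
      -- Schwartz function.
      have : ‖ξ‖ ^ n ≤ 1 + (‖ξ‖ ^ 2) ^ n := by
        rw [← pow_mul, mul_comm, pow_mul]
        nlinarith [sq_nonneg (‖ξ‖ ^ n - 1)]
      calc _ ≤ (1 + (‖ξ‖ ^ 2) ^ n) * (‖expMap (Space d) ρ ξ‖ * ‖v ξ‖) := by gcongr
        _ = _ := by ring
  -- Up to a constant, the mollification at `x` is `v` tested against the translate of `ρ` to `x`,
  -- whose support misses `K` when `x` is farther than `ε` from it.
  · have h1 : toDistribution v (ρ.compSubConstCLM ℂ x) = 0 := by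
      refine hv _ fun y hy hyK => hx ?_
      have := hρ (tsupport_compSubConst ρ x hy)
      rw [mem_closedBall_zero_iff] at this
      exact Metric.mem_cthickening_of_dist_le x y ε K hyK (by rwa [dist_comm, dist_eq_norm])
    rw [toDistribution, mul_eq_zero] at h1
    have hpi : (((2 * Real.pi : ℝ) : ℂ) ^ d)⁻¹ ≠ 0 := by
      have := Real.pi_ne_zero
      simp [this]
    rw [← h1.resolve_left hpi]
    congr 1 with ξ
    rw [expTransform_compSubConst, real_inner_comm]
    ring

lemma isMultiplier_of_norm_le_one {m : Space d → ℂ} (hm : Measurable m) (h : ∀ ξ, ‖m ξ‖ ≤ 1) :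
    IsMultiplier (1 / 2) (1 / 2) 1 m :=
  ⟨hm, zero_le_one, fun ξ => mul_le_mul_of_nonneg_right (by have := h ξ; gcongr) (bessel_pos _ _).le⟩

/-- The pairing vanishes if it does so after the application of multipliers which converge to the
identity. -/
lemma sobolevPairing_eq_zero_of_tendsto {w : Sobolev d (-1 / 2)} {v : Sobolev d (1 / 2)}
    {M : ℕ → Space d → ℂ} (hM : ∀ n, Measurable (M n)) (h1 : ∀ n ξ, ‖M n ξ‖ ≤ 1)
    (hlim : ∀ ξ, Filter.Tendsto (fun n => M n ξ) Filter.atTop (nhds 1))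
    (h : ∀ᶠ n in Filter.atTop, ∀ u : Sobolev d (1 / 2), (∀ᵐ ξ, u ξ = M n ξ * v ξ) →
      sobolevPairing w u = 0) : sobolevPairing w v = 0 := by
  have hm (n : ℕ) := isMultiplier_of_norm_le_one (hM n) (h1 n)
  have hone : IsMultiplier (d := d) (1 / 2) (1 / 2) 1 1 :=
    isMultiplier_of_norm_le_one measurable_one fun ξ => by simp
  have hid : multiplier d (1 / 2) (1 / 2) 1 v = v := sobolev_ext (by
    filter_upwards [hone.ae_eq v] with ξ hξ
    simp [hξ])
  have ht := tendsto_multiplier hone hm hlim v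
  rw [hid] at ht
  have ht' := (continuous_sobolevPairing.comp (Continuous.prodMk_right w)).tendsto v |>.comp ht
  refine tendsto_nhds_unique ht' (tendsto_const_nhds.congr' ?_)
  filter_upwards [h] with n hn
  exact (hn _ ((hm n).ae_eq v)).symm

/-- For a nonnegative bump of integral `1`, the bounds are `|e^{iθ}| = 1` and `|e^{iθ} - 1| ≤ |θ|`
with `|⟨x, ξ⟩| ≤ ε ‖ξ‖` on the support. -/
lemma exists_mollifier (ε : ℝ) (hε : 0 < ε) : ∃ ρ : 𝓢(Space d, ℂ),
    tsupport ρ ⊆ Metric.closedBall 0 ε ∧ (∀ ξ, ‖expTransform ρ ξ‖ ≤ 1) ∧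
    ∀ ξ, ‖expTransform ρ ξ - 1‖ ≤ ε * ‖ξ‖ := by
  let φ : ContDiffBump (0 : Space d) := ⟨ε / 2, ε, by positivity, by linarith⟩
  have hc : HasCompactSupport (φ.normed volume) := φ.hasCompactSupport_normed
  let ρ : 𝓢(Space d, ℂ) := (hc.comp_left (g := ofReal) ofReal_zero).toSchwartzMap
    (ofRealCLM.contDiff.comp φ.contDiff_normed)
  have hρ (x : Space d) : ρ x = (φ.normed volume x : ℂ) := rfl
  have hn (x : Space d) : ‖ρ x‖ = φ.normed volume x := by
    rw [hρ, norm_real, Real.norm_of_nonneg (φ.nonneg_normed x)]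
  refine ⟨ρ, ?_, fun ξ => ?_, fun ξ => ?_⟩
  · rw [show ε = φ.rOut from rfl, ← φ.tsupport_normed_eq (μ := volume)]
    exact closure_mono fun x hx h => hx (by rw [hρ, h, ofReal_zero])
  · refine (norm_integral_le_integral_norm _).trans (le_of_eq ?_)
    simp only [norm_mul, mul_comm I, norm_exp_ofReal_mul_I, one_mul, hn]
    exact φ.integral_normed
  · have h1 : (1 : ℂ) = ∫ x, ρ x := by
      simp only [hρ]
      rw [integral_complex_ofReal, φ.integral_normed, ofReal_one]
    have hi : Integrable fun x => cexp (I * (inner ℝ x ξ : ℝ)) * ρ x :=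
      Integrable.bdd_mul ρ.integrable (Continuous.aestronglyMeasurable (by fun_prop)) (c := 1)
        (Filter.Eventually.of_forall fun x => by rw [mul_comm, norm_exp_ofReal_mul_I])
    rw [expTransform, h1, ← integral_sub hi ρ.integrable]
    calc _ ≤ ∫ x, ε * ‖ξ‖ * φ.normed volume x := by
          refine norm_integral_le_of_norm_le (φ.integrable_normed.const_mul _)
            (Filter.Eventually.of_forall fun x => ?_)
          rw [← sub_one_mul, norm_mul, hn]
          by_cases hx : x ∈ Function.support (φ.normed volume)
          · refine mul_le_mul_of_nonneg_right ?_ (φ.nonneg_normed x)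
            rw [φ.support_normed_eq, mem_ball_zero_iff] at hx
            refine (Real.norm_exp_I_mul_ofReal_sub_one_le).trans ?_
            refine (norm_inner_le_norm x ξ).trans ?_
            have : ‖x‖ ≤ ε := hx.le
            gcongr
          · rw [Function.notMem_support.1 hx]
            simp
      _ = _ := by rw [integral_const_mul, φ.integral_normed, mul_one]

/-- The pairing vanishes if the supports are disjoint and one of them is compact. -/
lemma sobolevPairing_eq_zero_of_disjoint {K F : Set (Space d)} (hK : IsCompact K)
    (hF : IsClosed F) (hKF : Disjoint K F) {w : Sobolev d (-1 / 2)}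
    (hw : w ∈ supportedIn d (-1 / 2) F) {v : Sobolev d (1 / 2)}
    (hv : v ∈ supportedIn d (1 / 2) K) : sobolevPairing w v = 0 := by
  obtain ⟨δ, hδ, hd⟩ := hKF.exists_cthickenings hK hF
  choose ρ hρs hρ1 hρ using fun n : ℕ =>
    exists_mollifier (d := d) (1 / ((n : ℝ) + 1)) Nat.one_div_pos_of_nat
  refine sobolevPairing_eq_zero_of_tendsto (M := fun n => expTransform (ρ n)) (fun n => ?_) hρ1
    (fun ξ => ?_) ?_
  · have := (expMap (Space d) (ρ n)).continuous.measurable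
    convert this using 1
    exact funext fun ξ => expTransform_eq _ ξ
  · rw [tendsto_iff_norm_sub_tendsto_zero]
    refine squeeze_zero (fun _ => norm_nonneg _) (fun n => hρ n ξ) ?_
    simpa using tendsto_one_div_add_atTop_nhds_zero_nat.mul_const ‖ξ‖
  · filter_upwards [(tendsto_order.1 (tendsto_one_div_add_atTop_nhds_zero_nat (𝕜 := ℝ))).2 δ hδ]
      with n hn u hu
    refine sobolevPairing_mollify_eq_zero hK hw hv ?_ ((hρs n).trans
      (Metric.closedBall_subset_closedBall hn.le)) hu
    exact hd.mono_right (Metric.self_subset_cthickening F)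

end Mollification

/-! ### Lipschitz domains and the duality on `G` -/

section Duality

variable {d : ℕ}

lemma translate_mem_supportedIn {r : ℝ} {K K' : Set (Space d)} {v u : Sobolev d r}
    (hv : v ∈ supportedIn d r K) (a : Space d)
    (hu : ∀ᵐ ξ, u ξ = cexp (I * (inner ℝ (-a) ξ : ℝ)) * v ξ) (hK : ∀ x ∈ K, x + a ∈ K') :
    u ∈ supportedIn d r K' := by
  intro g hg
  have h1 : toDistribution v (g.compSubConstCLM ℂ (-a)) = 0 := by
    refine hv _ fun y hy hyK => hg (tsupport_compSubConst g (-a) hy) ?_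
    rw [sub_neg_eq_add]
    exact hK y hyK
  rw [← h1, toDistribution, toDistribution]
  congr 1
  refine integral_congr_ae ?_
  filter_upwards [hu] with ξ hξ
  rw [hξ, expTransform_compSubConst]
  ring

/-- The pairing vanishes if the supports become disjoint after arbitrarily small translations. -/
lemma sobolevPairing_eq_zero_of_translate {K F : Set (Space d)} (hK : IsCompact K)
    (hF : IsClosed F) {w : Sobolev d (-1 / 2)} (hw : w ∈ supportedIn d (-1 / 2) F)
    {v : Sobolev d (1 / 2)} (hv : v ∈ supportedIn d (1 / 2) K) {e : Space d} {δ : ℝ} (hδ : 0 < δ)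
    (h : ∀ τ, 0 < τ → τ < δ → ∀ x ∈ K, x + τ • e ∉ F) : sobolevPairing w v = 0 := by
  refine sobolevPairing_eq_zero_of_tendsto
    (M := fun n ξ => cexp (I * (inner ℝ (-((1 / ((n : ℝ) + 1)) • e)) ξ : ℝ)))
    (fun n => Continuous.measurable (by fun_prop))
    (fun n ξ => by rw [mul_comm, norm_exp_ofReal_mul_I]) (fun ξ => ?_) ?_
  · have h1 : Continuous fun τ : ℝ => cexp (I * (inner ℝ (-(τ • e)) ξ : ℝ)) := by fun_prop
    have h2 := (h1.tendsto 0).comp (tendsto_one_div_add_atTop_nhds_zero_nat (𝕜 := ℝ))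
    simpa [Function.comp_def] using h2
  · filter_upwards [(tendsto_order.1 (tendsto_one_div_add_atTop_nhds_zero_nat (𝕜 := ℝ))).2 δ hδ]
      with n hn u hu
    refine sobolevPairing_eq_zero_of_disjoint
      (hK.image (f := fun x => x + (1 / ((n : ℝ) + 1)) • e) (by fun_prop)) hF ?_ hw
      (translate_mem_supportedIn hv _ hu fun x hx => Set.mem_image_of_mem _ hx)
    rw [Set.disjoint_left]
    rintro _ ⟨x, hx, rfl⟩
    exact h _ Nat.one_div_pos_of_nat hn x hx

/-- A move along `e` keeps the component orthogonal to `e` and raises the height by `τ`. Points of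
the closure lie on or above the graph, so they end strictly above it. -/
lemma add_smul_mem_of_graph {G U : Set (Space d)} {e : Space d} {γ : Space d → ℝ}
    (he : ‖e‖ = 1) (hγ : Continuous γ) (hU : IsOpen U)
    (h : ∀ x ∈ U, x ∈ G ↔ γ (x - (inner ℝ e x : ℝ) • e) < inner ℝ e x) {x : Space d}
    (hx : x ∈ closure G) (hxU : x ∈ U) {τ : ℝ} (hτ : 0 < τ) (hxτ : x + τ • e ∈ U) :
    x + τ • e ∈ G := by
  have hcl : x ∈ closure (U ∩ G) := hU.inter_closure ⟨hxU, hx⟩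
  have hle : γ (x - (inner ℝ e x : ℝ) • e) ≤ inner ℝ e x := by
    have hc : IsClosed {y : Space d | γ (y - (inner ℝ e y : ℝ) • e) ≤ inner ℝ e y} :=
      isClosed_le (by fun_prop) (by fun_prop)
    exact closure_minimal (fun y hy => ((h y hy.1).1 hy.2).le) hc hcl
  rw [h _ hxτ, inner_add_right, inner_smul_right, real_inner_self_eq_norm_sq, he]
  have : x + τ • e - (inner ℝ e x + τ * 1 ^ 2 : ℝ) • e = x - (inner ℝ e x : ℝ) • e := by
    module
  rw [this]
  linarith

lemma exists_linearMap_toDistribution {r : ℝ} (v : Sobolev d r) :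
    ∃ Λ : 𝓢(Space d, ℂ) →ₗ[ℂ] ℂ, ∀ g, Λ g = toDistribution v g := by
  have h (g : 𝓢(Space d, ℂ)) : toDistribution v g =
      (((2 * Real.pi : ℝ) : ℂ) ^ d)⁻¹ * ∫ ξ, expMap (Space d) g ξ • v ξ := by
    rw [toDistribution]
    congr 2 with ξ
    rw [expTransform_eq, smul_eq_mul, mul_comm]
  refine ⟨{ toFun := toDistribution v, map_add' := fun g g' => ?_, map_smul' := fun a g => ?_ },
    fun _ => rfl⟩
  · simp only [h, map_add, _root_.add_apply, add_smul]
    rw [integral_add (integrable_schwartz_smul v _) (integrable_schwartz_smul v _), mul_add]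
  · simp only [h, map_smul, _root_.smul_apply, smul_assoc, integral_smul, RingHom.id_apply]
    rw [smul_eq_mul, smul_eq_mul, mul_left_comm]

lemma exists_schwartz_cutoff {χ : Space d → ℝ} (hχ : ContDiff ℝ ((⊤ : ℕ∞) : WithTop ℕ∞) χ)
    (hχc : HasCompactSupport χ) (g : 𝓢(Space d, ℂ)) :
    ∃ g' : 𝓢(Space d, ℂ), ∀ x, g' x = χ x * g x :=
  ⟨((hχc.comp_left (g := ofReal) ofReal_zero).mul_right (f' := g)).toSchwartzMap
    ((ofRealCLM.contDiff.comp hχ).mul (g.smooth _)), fun _ => rfl⟩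

lemma tsupport_subset_of_eq_mul {χ : Space d → ℝ} {g g' : Space d → ℂ}
    (h : ∀ x, g' x = χ x * g x) : tsupport g' ⊆ tsupport χ ∩ tsupport g := by
  refine Set.subset_inter (closure_mono fun x hx h0 => hx ?_) (closure_mono fun x hx h0 => hx ?_)
  · simp [h, h0]
  · simp [h, h0]

lemma cutoff_mem_supportedIn {r : ℝ} {K : Set (Space d)} {χ : Space d → ℝ}
    (hχ : ContDiff ℝ ((⊤ : ℕ∞) : WithTop ℕ∞) χ) (hχc : HasCompactSupport χ) {v w : Sobolev d r}
    (hv : v ∈ supportedIn d r K) (hw : ∀ g g' : 𝓢(Space d, ℂ), (∀ x, g' x = χ x * g x) →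
      toDistribution w g = toDistribution v g') : w ∈ supportedIn d r (K ∩ tsupport χ) := by
  intro g hg
  obtain ⟨g', hg'⟩ := exists_schwartz_cutoff hχ hχc g
  rw [hw g g' hg']
  refine hv g' fun x hx hxK => ?_
  have := tsupport_subset_of_eq_mul hg' hx
  exact hg this.2 ⟨hxK, this.1⟩

/-- Each point of the closure of a Lipschitz domain has a neighbourhood such that the pairing of a
distribution supported in the closure of the exterior with a distribution supported in the part of
the closed domain in this neighbourhood vanishes. -/
lemma exists_nhds_sobolevPairing_eq_zero {G : Set (Space d)} (hG : IsLipschitzDomain G)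
    {w : Sobolev d (-1 / 2)} (hw : w ∈ supportedIn d (-1 / 2) (closure (closure G)ᶜ))
    {p : Space d} (hp : p ∈ closure G) :
    ∃ r > 0, ∀ K ⊆ Metric.ball p r, IsClosed K → ∀ v ∈ supportedIn d (1 / 2) (closure G ∩ K),
      sobolevPairing w v = 0 := by
  have hGF : ∀ x ∈ G, x ∉ closure (closure G)ᶜ := fun x hx => by
    rw [closure_compl, Set.notMem_compl_iff]
    exact (interior_mono subset_closure) (hG.1.interior_eq.symm ▸ hx)
  have hcompact {K : Set (Space d)} {r : ℝ} (hK : K ⊆ Metric.ball p r) (hKc : IsClosed K) :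
      IsCompact (closure G ∩ K) :=
    Metric.isCompact_of_isClosed_isBounded (isClosed_closure.inter hKc)
      (Metric.isBounded_ball.subset (Set.inter_subset_right.trans hK))
  by_cases hpG : p ∈ G
  · obtain ⟨r, hr, hrG⟩ := Metric.isOpen_iff.1 hG.1 p hpG
    refine ⟨r, hr, fun K hK hKc v hv => ?_⟩
    refine sobolevPairing_eq_zero_of_disjoint (hcompact hK hKc) isClosed_closure ?_ hw hv
    rw [Set.disjoint_left]
    exact fun x hx => hGF x (hrG (hK hx.2))
  · obtain ⟨e, L, γ, U, he, hγ, hU, hpU, h⟩ := hG.2 p ⟨hp, by rwa [hG.1.interior_eq]⟩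
    obtain ⟨r, hr, hrU⟩ := Metric.isOpen_iff.1 hU p hpU
    -- Half the radius leaves room for translations shorter than `r / 2` to stay in the chart.
    refine ⟨r / 2, half_pos hr, fun K hK hKc v hv => ?_⟩
    refine sobolevPairing_eq_zero_of_translate (hcompact hK hKc) isClosed_closure hw hv (e := e)
      (half_pos hr) fun τ hτ hτr x hx => hGF _ ?_
    have hx1 : dist x p < r / 2 := hK hx.2
    refine add_smul_mem_of_graph he hγ.continuous hU h hx.1 (hrU ?_) hτ (hrU ?_)
    · rw [Metric.mem_ball]; linarith
    · rw [Metric.mem_ball]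
      have h1 : dist (x + τ • e) x = τ := by
        rw [dist_eq_norm, add_sub_cancel_left, norm_smul, he, mul_one, Real.norm_of_nonneg hτ.le]
      linarith [dist_triangle (x + τ • e) x p]

open scoped Manifold in
/-- The duality of `H^{-1/2}(G)` and `H̃^{1/2}(G)` is well defined. -/
lemma sobolevPairing_eq_zero {G : Set (Space d)} (hG : IsLipschitzDomain G)
    (hbdd : Bornology.IsBounded G)
    {w : Sobolev d (-1 / 2)} (hw : w ∈ supportedIn d (-1 / 2) (closure (closure G)ᶜ))
    {v : Sobolev d (1 / 2)} (hv : v ∈ supportedIn d (1 / 2) (closure G)) :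
    sobolevPairing w v = 0 := by
  choose! r hr h using fun p (hp : p ∈ closure G) => exists_nhds_sobolevPairing_eq_zero hG hw hp
  obtain ⟨t, htG, ht⟩ := hbdd.isCompact_closure.elim_nhds_subcover (fun p => Metric.ball p (r p))
    fun p hp => Metric.ball_mem_nhds p (hr p hp)
  -- The index `none` stands for the complement of the closed domain, so that the partition of unity
  -- covers the whole space.
  let U : Option t → Set (Space d) := fun i =>
    i.elim (closure G)ᶜ fun p => Metric.ball p.1 (r p.1)
  have hUo : ∀ i, IsOpen (U i) := by
    rintro (_ | p)
    · exact isClosed_closure.isOpen_compl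
    · exact Metric.isOpen_ball
  have hcov : Set.univ ⊆ ⋃ i, U i := fun x _ => by
    by_cases hx : x ∈ closure G
    · obtain ⟨p, hp, hxp⟩ := Set.mem_iUnion₂.1 (ht hx)
      exact Set.mem_iUnion.2 ⟨some ⟨p, hp⟩, hxp⟩
    · exact Set.mem_iUnion.2 ⟨none, hx⟩
  obtain ⟨χ, hχ⟩ := SmoothPartitionOfUnity.exists_isSubordinate 𝓘(ℝ, Space d) isClosed_univ U hUo hcov
  have hχd (i : Option t) : ContDiff ℝ ((⊤ : ℕ∞) : WithTop ℕ∞) (χ i) := (χ i).contMDiff.contDiff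
  have hχc (p : t) : HasCompactSupport (χ (some p)) :=
    Metric.isCompact_of_isClosed_isBounded (isClosed_tsupport _)
      (Metric.isBounded_ball.subset (hχ (some p)))
  have hsum (x : Space d) : (χ none x : ℂ) = 1 - ∑ p : t, (χ (some p) x : ℂ) := by
    have h1 := χ.sum_eq_one (Set.mem_univ x)
    rw [finsum_eq_sum_of_fintype, Fintype.sum_option] at h1
    rw [← ofReal_sum, eq_sub_iff_add_eq, ← ofReal_add, h1, ofReal_one]
  choose u hu using fun p : t => exists_cutoff (hχd (some p)) (hχc p) v
  -- The difference tests `v` against `χ none · g`, which is supported off the closure of `G`, so it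
  -- vanishes.
  have hvu : v = ∑ p, u p := toDistribution_injective fun g => by
    choose g' hg' using fun p : t => exists_schwartz_cutoff (hχd (some p)) (hχc p) g
    rw [toDistribution_sum, Finset.sum_congr rfl fun p _ => hu p g (g' p) (hg' p)]
    obtain ⟨Λ, hΛ⟩ := exists_linearMap_toDistribution v
    simp only [← hΛ]
    rw [← map_sum, ← sub_eq_zero, ← map_sub, hΛ]
    refine hv _ (Set.Subset.trans (fun x hx => ?_) (hχ none))
    refine (tsupport_subset_of_eq_mul (χ := χ none) (g := g) (fun x => ?_) hx).1
    rw [hsum, sub_mul, one_mul, _root_.sub_apply, Finset.sum_mul]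
    simp [hg']
  rw [hvu, sobolevPairing_sum_right]
  exact Finset.sum_eq_zero fun p _ => h p.1 (htG _ p.2) _ (hχ (some p)) (isClosed_tsupport _) _
    (cutoff_mem_supportedIn (hχd (some p)) (hχc p) hv (hu p))

end Duality

/-! ### Distributions with a prescribed transform -/

section SpaceTime

variable {E : Type*} [NormedAddCommGroup E] [NormedSpace ℂ E]

lemma exists_hasFourierLaplace (σ : ℝ) {f : ℝ → E} (hm : AEStronglyMeasurable f) (N : ℕ)
    (hf : Integrable fun ξ₀ : ℝ => (1 + ‖ξ₀‖) ^ (-(N : ℝ)) * ‖f ξ₀‖) :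
    ∃ u, HasFourierLaplace σ u f := by
  obtain ⟨Λ, hΛ⟩ := exists_clm_integral_smul hm N hf
  let T : 𝓢'(ℝ, E) :=
    ContinuousLinearMap.toPointwiseConvergenceCLM ℂ (RingHom.id ℂ) 𝓢(ℝ, ℂ) E (Λ.comp (expMapInv ℝ))
  obtain ⟨u, hu⟩ := exists_isExpWeighted σ T
  refine ⟨u, hm, fun k => (hΛ k).1, T, hu, fun k h hkh => ?_⟩
  have : h = expMap ℝ k := by
    ext t
    rw [hkh, expMap_apply]
    congr 1 with ξ
    simp [mul_comm, mul_left_comm]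
  rw [← (hΛ k).2, this]
  change Λ (expMapInv ℝ (expMap ℝ k)) = Λ k
  rw [expMapInv_expMap]

lemma HasFourierLaplace.congr {σ : ℝ} {u : 𝓓'((⊤ : Opens ℝ), E)} {f f' : ℝ → E}
    (hf : HasFourierLaplace σ u f) (h : f =ᵐ[volume] f') : HasFourierLaplace σ u f' := by
  obtain ⟨T, hT, H⟩ := hf.exists_tempered
  have e (k : 𝓢(ℝ, ℂ)) : (fun ξ₀ => k ξ₀ • f ξ₀) =ᵐ[volume] fun ξ₀ => k ξ₀ • f' ξ₀ := by
    filter_upwards [h] with ξ₀ h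
    rw [h]
  exact ⟨hf.aestronglyMeasurable.congr h, fun k => (hf.integrable k).congr (e k), T, hT,
    fun k g hk => (H k g hk).trans (integral_congr_ae (e k))⟩

lemma HasFourierLaplace.unique {σ : ℝ} {u u' : 𝓓'((⊤ : Opens ℝ), E)} {f : ℝ → E}
    (h : HasFourierLaplace σ u f) (h' : HasFourierLaplace σ u' f) : u = u' := by
  ext g
  rw [h.apply_eq, h'.apply_eq]

/-- The transform is unique up to null sets, so the infimum is over a single value and any
representative computes it. -/
lemma HasFourierLaplace.spaceTimeNorm_sq [CompleteSpace E] {σ : ℝ} {u : 𝓓'((⊤ : Opens ℝ), E)}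
    {f : ℝ → E} (hf : HasFourierLaplace σ u f) (s : ℝ) (N : ℂ → E → ℝ≥0∞) :
    spaceTimeNorm σ s N u ^ 2 =
      ∫⁻ ξ₀ : ℝ, ENNReal.ofReal (‖freq σ ξ₀‖ ^ (2 * s)) * N (freq σ ξ₀) (f ξ₀) ^ 2 := by
  have h : spaceTimeNorm σ s N u = (∫⁻ ξ₀ : ℝ, ENNReal.ofReal (‖freq σ ξ₀‖ ^ (2 * s)) *
      N (freq σ ξ₀) (f ξ₀) ^ 2) ^ (1 / 2 : ℝ) := by
    refine le_antisymm (iInf₂_le f hf) (le_iInf₂ fun f' hf' => le_of_eq ?_)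
    congr 1
    refine lintegral_congr_ae ?_
    filter_upwards [hf.ae_eq hf'] with ξ₀ h
    rw [h]
  rw [h, ← ENNReal.rpow_natCast, ← ENNReal.rpow_mul]
  norm_num

lemma exists_hasFourierLaplace_of_spaceTimeNorm_lt_top {σ s : ℝ} {N : ℂ → E → ℝ≥0∞}
    {u : 𝓓'((⊤ : Opens ℝ), E)} (h : spaceTimeNorm σ s N u < ⊤) :
    ∃ f, HasFourierLaplace σ u f := by
  simp only [spaceTimeNorm, iInf_lt_iff] at h
  obtain ⟨f, hf, -⟩ := h
  exact ⟨f, hf⟩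

lemma HasFourierLaplace.exists_isExpWeighted {σ : ℝ} {u : 𝓓'((⊤ : Opens ℝ), E)} {f : ℝ → E}
    (hf : HasFourierLaplace σ u f) : ∃ T, IsExpWeighted σ u T :=
  ⟨_, hf.exists_tempered.choose_spec.1⟩

lemma le_norm_freq (σ ξ₀ : ℝ) : σ ≤ ‖freq σ ξ₀‖ := by
  have h := abs_im_le_norm (freq σ ξ₀)
  have h2 : (freq σ ξ₀).im = σ := by simp
  rw [h2] at h
  exact (le_abs_self σ).trans h

lemma rpow_le_rpow_abs {y B : ℝ} (hy : 0 < y) (h1 : y ≤ B) (h2 : y⁻¹ ≤ B) (t : ℝ) :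
    y ^ t ≤ B ^ |t| := by
  rcases le_total 0 t with ht | ht
  · rw [abs_of_nonneg ht]
    exact Real.rpow_le_rpow hy.le h1 ht
  · rw [abs_of_nonpos ht, ← neg_neg t, Real.rpow_neg hy.le, ← Real.inv_rpow hy.le, neg_neg]
    exact Real.rpow_le_rpow (inv_pos.2 hy).le h2 (neg_nonneg.2 ht)

/-- A function with finite weighted square mean has at most polynomial growth in the mean. -/
lemma exists_integrable_growth {E : Type*} [NormedAddCommGroup E] {σ : ℝ} (hσ : 0 < σ) (s : ℝ)
    {f : ℝ → E}
    (hm : AEStronglyMeasurable f)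
    (h : ∫⁻ ξ₀ : ℝ, ENNReal.ofReal (‖freq σ ξ₀‖ ^ (2 * s)) * ‖f ξ₀‖ₑ ^ 2 < ⊤) :
    ∃ N : ℕ, Integrable fun ξ₀ : ℝ => (1 + ‖ξ₀‖) ^ (-(N : ℝ)) * ‖f ξ₀‖ := by
  -- This makes `-2N + 2|s| ≤ -2`, so the squared quotient of the weights is integrable.
  obtain ⟨N, hN⟩ := exists_nat_ge (|s| + 1)
  have hpos (x : ℝ) : 0 < ‖freq σ x‖ := hσ.trans_le (le_norm_freq σ x)
  have hwc : Continuous fun x : ℝ => ‖freq σ x‖ ^ (2 * s) := by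
    refine Continuous.rpow_const (by unfold freq; fun_prop) fun x => Or.inl (hpos x).ne'
  have h2 : Integrable fun x : ℝ => ‖freq σ x‖ ^ (2 * s) * ‖f x‖ ^ 2 := by
    refine ⟨hwc.aestronglyMeasurable.mul (hm.norm.pow 2), lt_of_eq_of_lt ?_ h⟩
    refine lintegral_congr fun x => ?_
    rw [Real.enorm_of_nonneg (by positivity), ENNReal.ofReal_mul (by positivity),
      ENNReal.ofReal_pow (norm_nonneg _), ofReal_norm]
  set M := 1 + σ + σ⁻¹
  have hM : 0 < M := by positivity
  have h1 : Integrable fun x : ℝ => M ^ |(-(2 * s))| * (1 + ‖x‖) ^ (-(2 : ℝ)) :=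
    (integrable_one_add_norm (by simp)).const_mul _
  refine ⟨N, (h1.add h2).mono' ?_ (Filter.Eventually.of_forall fun x => ?_)⟩
  · refine AEStronglyMeasurable.mul (Continuous.aestronglyMeasurable ?_) hm.norm
    exact Continuous.rpow_const (by fun_prop) fun x => Or.inl (by positivity)
  · have hx : 1 ≤ 1 + ‖x‖ := by linarith [norm_nonneg x]
    have hx0 : 0 < 1 + ‖x‖ := by positivity
    have hw : ‖freq σ x‖ ^ (-(2 * s)) ≤ (M * (1 + ‖x‖)) ^ |(-(2 * s))| := by
      refine rpow_le_rpow_abs (hpos x) ?_ ?_ _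
      · have := norm_freq_le σ x
        rw [abs_of_pos hσ, ← Real.norm_eq_abs] at this
        have h0 : 0 < σ⁻¹ := by positivity
        simp only [M]
        nlinarith [norm_nonneg x, mul_nonneg hσ.le (norm_nonneg x), mul_nonneg h0.le (norm_nonneg x)]
      · calc ‖freq σ x‖⁻¹ ≤ σ⁻¹ := inv_anti₀ hσ (le_norm_freq σ x)
          _ ≤ M := by simp only [M]; linarith
          _ ≤ _ := le_mul_of_one_le_right hM.le hx
    set a := (1 + ‖x‖) ^ (-(N : ℝ))
    set w := ‖freq σ x‖ ^ s
    have hw0 : 0 < w := Real.rpow_pos_of_pos (hpos x) _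
    have hw2 : ‖freq σ x‖ ^ (2 * s) = w ^ 2 := by
      rw [mul_comm, Real.rpow_mul (hpos x).le, Real.rpow_two]
    have ha : (a * w⁻¹) ^ 2 ≤ M ^ |(-(2 * s))| * (1 + ‖x‖) ^ (-(2 : ℝ)) := by
      rw [mul_pow, inv_pow, ← hw2, ← Real.rpow_neg (hpos x).le]
      calc a ^ 2 * ‖freq σ x‖ ^ (-(2 * s)) ≤ a ^ 2 * (M * (1 + ‖x‖)) ^ |(-(2 * s))| := by gcongr
        _ = M ^ |(-(2 * s))| * (1 + ‖x‖) ^ (-(2 * N : ℝ) + |(-(2 * s))|) := by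
            rw [Real.mul_rpow hM.le hx0.le, Real.rpow_add hx0, ← Real.rpow_two,
              ← Real.rpow_mul hx0.le]
            ring_nf
        _ ≤ _ := by
            refine mul_le_mul_of_nonneg_left ?_ (by positivity)
            refine Real.rpow_le_rpow_of_exponent_le hx ?_
            rw [abs_neg, abs_mul, abs_two]
            linarith
    have ha0 : 0 ≤ a := by positivity
    rw [Real.norm_of_nonneg (by positivity), Pi.add_apply]
    -- A product is at most the sum of the squares, and both squares have integrable bounds.
    have key : a * ‖f x‖ = (a * w⁻¹) * (w * ‖f x‖) := by field_simp
    rw [hw2, key]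
    nlinarith [sq_nonneg (a * w⁻¹ - w * ‖f x‖), sq_nonneg (a * w⁻¹), sq_nonneg (w * ‖f x‖)]

end SpaceTime

/-! ### Estimates at fixed frequency -/

section FrequencyNorms

variable {d : ℕ} {G : Set (Space d)}

lemma freqNorm_sq {r : ℝ} (ω : ℂ) (u : Sobolev d r) : freqNorm ω u ^ 2 =
    ∫⁻ ξ, ENNReal.ofReal ((‖ω‖ ^ 2 + ‖ξ‖ ^ 2) ^ r) * ‖u ξ‖ₑ ^ 2 := by
  rw [freqNorm, ← ENNReal.rpow_natCast, ← ENNReal.rpow_mul]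
  norm_num

/-- Since `1 ≤ σ⁻² ‖ω‖²`, the fixed norm is controlled uniformly on the line. -/
lemma enorm_sq_le_freqNorm {σ : ℝ} (hσ : 0 < σ) {ω : ℂ} (hω : σ ≤ ‖ω‖) (u : Sobolev d (1 / 2)) :
    ‖u‖ₑ ^ 2 ≤ ENNReal.ofReal (1 + σ⁻¹) * freqNorm ω u ^ 2 := by
  rw [enorm_sobolev_sq, freqNorm_sq, ← lintegral_const_mul' _ _ ENNReal.ofReal_ne_top]
  refine lintegral_mono fun ξ => ?_
  beta_reduce
  rw [← mul_assoc, ← ENNReal.ofReal_mul (by positivity)]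
  gcongr
  rw [bessel, ← Real.sqrt_eq_rpow, ← Real.sqrt_eq_rpow]
  refine Real.sqrt_le_iff.2 ⟨by positivity, ?_⟩
  rw [mul_pow, Real.sq_sqrt (by positivity)]
  have h1 : 1 ≤ σ⁻¹ ^ 2 * ‖ω‖ ^ 2 := by
    rw [← mul_pow]
    refine one_le_pow₀ ?_
    rw [inv_mul_eq_div, one_le_div hσ]
    exact hω
  have h0 : 0 < σ⁻¹ := by positivity
  nlinarith [sq_nonneg ‖ξ‖, sq_nonneg ‖ω‖, mul_nonneg h0.le (sq_nonneg ‖ω‖),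
    mul_nonneg h0.le (sq_nonneg ‖ξ‖), mul_nonneg (sq_nonneg σ⁻¹) (sq_nonneg ‖ξ‖)]

lemma dtnOp_ae_eq {μ c : ℝ} (hμ : 0 < μ) (hc : 0 < c) {ω : ℂ} (hω : 0 < ω.im)
    (u : Sobolev d (1 / 2)) : ∀ᵐ ξ, dtnOp d μ c ω u ξ = dtnSymbol μ c ω ξ * u ξ :=
  (isMultiplier_dtnSymbol hμ hc hω).ae_eq u

lemma weight_pos {ω : ℂ} (hω : 0 < ω.im) (ξ : Space d) : 0 < ‖ω‖ ^ 2 + ‖ξ‖ ^ 2 := by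
  have : 0 < ‖ω‖ := norm_pos_iff.2 fun h => by simp [h] at hω
  positivity

lemma freqNorm_dtnOp_sq_le {μ c : ℝ} (hμ : 0 < μ) (hc : 0 < c) {ω : ℂ} (hω : 0 < ω.im)
    (u : Sobolev d (1 / 2)) :
    freqNorm ω (dtnOp d μ c ω u) ^ 2 ≤ ENNReal.ofReal (μ * (1 + c⁻¹)) ^ 2 * freqNorm ω u ^ 2 := by
  rw [freqNorm_sq, freqNorm_sq, ← ENNReal.ofReal_pow (by positivity),
    ← lintegral_const_mul' _ _ ENNReal.ofReal_ne_top]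
  refine lintegral_mono_ae ?_
  filter_upwards [dtnOp_ae_eq hμ hc hω u] with ξ hξ
  rw [hξ, enorm_mul, mul_pow, ← mul_assoc, ← mul_assoc, ← ofReal_norm (dtnSymbol μ c ω ξ),
    ← ENNReal.ofReal_pow (norm_nonneg _), ← ENNReal.ofReal_mul (by positivity),
    ← ENNReal.ofReal_mul (by positivity)]
  refine mul_le_mul' (ENNReal.ofReal_le_ofReal ?_) le_rfl
  have hA := weight_pos hω ξ
  calc _ ≤ (‖ω‖ ^ 2 + ‖ξ‖ ^ 2) ^ (-1 / 2 : ℝ) *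
        ((μ * (1 + c⁻¹)) ^ 2 * (‖ω‖ ^ 2 + ‖ξ‖ ^ 2)) := by
        gcongr
        exact norm_dtnSymbol_sq_le hμ hc ω ξ
    _ = (μ * (1 + c⁻¹)) ^ 2 * ((‖ω‖ ^ 2 + ‖ξ‖ ^ 2) ^ (-1 / 2 : ℝ) *
        (‖ω‖ ^ 2 + ‖ξ‖ ^ 2) ^ (1 : ℝ)) := by rw [Real.rpow_one]; ring
    _ = _ := by rw [← Real.rpow_add hA]; norm_num

lemma quotNorm_restrict_le {r : ℝ} (ω : ℂ) (v : Sobolev d r) :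
    quotNorm ω (restrict G v) ≤ freqNorm ω v := by
  unfold quotNorm
  exact iInf_le_of_le v (iInf_le_of_le rfl le_rfl)

lemma quotNorm_dtnOp_sq_le {μ c : ℝ} (hμ : 0 < μ) (hc : 0 < c) {ω : ℂ} (hω : 0 < ω.im)
    (u : TildeH d (1 / 2) G) :
    quotNorm ω (restrict G (dtnOp d μ c ω u.1)) ^ 2 ≤
      ENNReal.ofReal (μ * (1 + c⁻¹)) ^ 2 * tildeNorm ω u ^ 2 := by
  have h1 := quotNorm_restrict_le (G := G) ω (dtnOp d μ c ω u.1)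
  have h2 := freqNorm_dtnOp_sq_le hμ hc hω u.1
  exact le_trans (by gcongr) h2

/-- The form is the mean of the symbol against `|û|²`, so pointwise bounds of the root pass to it.
-/
lemma sobolevPairing_dtnOp_eq {μ c : ℝ} (hμ : 0 < μ) (hc : 0 < c) {ω : ℂ} (hω : 0 < ω.im)
    (u : Sobolev d (1 / 2)) :
    Integrable (fun ξ => (((‖u ξ‖ ^ 2 * μ : ℝ) : ℂ)) * realRoot c ‖ξ‖ ω) ∧
    sobolevPairing (dtnOp d μ c ω u) u = ((((2 * Real.pi) ^ d)⁻¹ : ℝ) : ℂ) *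
      ∫ ξ, (((‖u ξ‖ ^ 2 * μ : ℝ) : ℂ)) * realRoot c ‖ξ‖ ω := by
  have e : ∀ᵐ ξ, dtnOp d μ c ω u ξ * starRingEnd ℂ (u ξ) =
      (((‖u ξ‖ ^ 2 * μ : ℝ) : ℂ)) * realRoot c ‖ξ‖ ω := by
    filter_upwards [dtnOp_ae_eq hμ hc hω u] with ξ hξ
    rw [hξ, dtnSymbol_eq, mul_assoc, mul_conj, normSq_eq_norm_sq]
    push_cast
    ring
  refine ⟨(sobolevPairing_eq_inner _ u).1.congr e, ?_⟩
  rw [sobolevPairing, integral_congr_ae e]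
  push_cast
  rfl

lemma enorm_sobolevPairing_dtnOp_le {μ c : ℝ} (hμ : 0 < μ) (hc : 0 < c) {ω : ℂ} (hω : 0 < ω.im)
    (u : Sobolev d (1 / 2)) :
    ‖sobolevPairing (dtnOp d μ c ω u) u‖ₑ ≤
      ENNReal.ofReal (((2 * Real.pi) ^ d)⁻¹ * (μ * (1 + c⁻¹))) * freqNorm ω u ^ 2 := by
  rw [(sobolevPairing_dtnOp_eq hμ hc hω u).2, enorm_mul, freqNorm_sq,
    ENNReal.ofReal_mul (by positivity), mul_assoc]
  refine mul_le_mul' (le_of_eq ?_) ?_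
  · rw [← ofReal_norm, norm_real, Real.norm_of_nonneg (by positivity)]
  · rw [← lintegral_const_mul' _ _ ENNReal.ofReal_ne_top]
    refine (enorm_integral_le_lintegral_enorm _).trans (lintegral_mono fun ξ => ?_)
    beta_reduce
    rw [← ofReal_norm, ← ofReal_norm, ← ENNReal.ofReal_pow (norm_nonneg _),
      ← ENNReal.ofReal_mul (by positivity), ← ENNReal.ofReal_mul (by positivity), norm_mul,
      norm_real, Real.norm_of_nonneg (by positivity)]
    refine ENNReal.ofReal_le_ofReal ?_
    calc _ ≤ ‖u ξ‖ ^ 2 * μ * ((1 + c⁻¹) * (‖ω‖ ^ 2 + ‖ξ‖ ^ 2) ^ (1 / 2 : ℝ)) := by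
          gcongr
          exact norm_realRoot_le hc _ _
      _ = _ := by ring

lemma le_re_sobolevPairing_dtnOp {μ c : ℝ} (hμ : 0 < μ) (hc : 0 < c) {ω : ℂ} (hω : 0 < ω.im)
    (u : Sobolev d (1 / 2)) :
    0 ≤ (sobolevPairing (dtnOp d μ c ω u) u).re ∧
    ENNReal.ofReal (((2 * Real.pi) ^ d)⁻¹ * (μ * (ω.im / √(2 + c ^ 2) * ‖ω‖⁻¹))) *
      freqNorm ω u ^ 2 ≤ ENNReal.ofReal (sobolevPairing (dtnOp d μ c ω u) u).re := by
  obtain ⟨hi, he⟩ := sobolevPairing_dtnOp_eq hμ hc hω u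
  have hre : (sobolevPairing (dtnOp d μ c ω u) u).re =
      ((2 * Real.pi) ^ d)⁻¹ * ∫ ξ, ‖u ξ‖ ^ 2 * μ * (realRoot c ‖ξ‖ ω).re := by
    rw [he, re_ofReal_mul]
    congr 1
    rw [← reCLM_apply, ← reCLM.integral_comp_comm hi]
    simp only [reCLM_apply, re_ofReal_mul]
  have hlow (ξ : Space d) := le_re_realRoot hc ‖ξ‖ hω
  have hnn (ξ : Space d) : 0 ≤ ‖u ξ‖ ^ 2 * μ * (realRoot c ‖ξ‖ ω).re :=
    mul_nonneg (by positivity) ((by positivity : 0 ≤ ω.im / √(2 + c ^ 2) * ‖ω‖⁻¹ *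
      (‖ω‖ ^ 2 + ‖ξ‖ ^ 2) ^ (1 / 2 : ℝ)).trans (hlow ξ))
  have hi' : Integrable fun ξ => ‖u ξ‖ ^ 2 * μ * (realRoot c ‖ξ‖ ω).re := by
    have := hi.re
    refine this.congr (Filter.Eventually.of_forall fun ξ => ?_)
    exact re_ofReal_mul _ _
  rw [hre]
  refine ⟨mul_nonneg (by positivity) (integral_nonneg hnn), ?_⟩
  rw [ENNReal.ofReal_mul (p := ((2 * Real.pi) ^ d)⁻¹) (by positivity),
    ENNReal.ofReal_mul (p := ((2 * Real.pi) ^ d)⁻¹) (by positivity), mul_assoc,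
    ofReal_integral_eq_lintegral_ofReal hi' (Filter.Eventually.of_forall hnn), freqNorm_sq,
    ← lintegral_const_mul' _ _ ENNReal.ofReal_ne_top]
  refine mul_le_mul' le_rfl (lintegral_mono fun ξ => ?_)
  beta_reduce
  rw [← ofReal_norm, ← ENNReal.ofReal_pow (norm_nonneg _), ← ENNReal.ofReal_mul (by positivity),
    ← ENNReal.ofReal_mul (by positivity)]
  refine ENNReal.ofReal_le_ofReal ?_
  calc _ = ‖u ξ‖ ^ 2 * μ * (ω.im / √(2 + c ^ 2) * ‖ω‖⁻¹ *
        (‖ω‖ ^ 2 + ‖ξ‖ ^ 2) ^ (1 / 2 : ℝ)) := by ring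
    _ ≤ _ := mul_le_mul_of_nonneg_left (hlow ξ) (by positivity)

end FrequencyNorms

/-! ### Integration over the line `Im ω = σ` -/

section MainResult

variable {d : ℕ} {G : Set (Space d)} {μ c σ : ℝ}

instance (r : ℝ) : CompleteSpace (TildeH d r G) :=
  (inferInstance : IsClosed (supportedIn d r (closure G) : Set (Sobolev d r))).completeSpace_coe

variable (d) in
/-- The restriction map as a continuous linear map. -/
def restrictCLM (r : ℝ) (G : Set (Space d)) : Sobolev d r →L[ℂ] QuotH d r G :=
  (supportedIn d r (closure (closure G)ᶜ)).mkQL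

lemma norm_restrict_le {r : ℝ} (u : Sobolev d r) : ‖restrict G u‖ ≤ ‖u‖ :=
  Submodule.Quotient.norm_mk_le _ u

/-- The Fourier-Laplace transform of the Dirichlet-to-Neumann operator. -/
def dtnTransform (σ μ c : ℝ) (f : ℝ → TildeH d (1 / 2) G) (ξ₀ : ℝ) : QuotH d (-1 / 2) G :=
  restrict G (dtnOp d μ c (freq σ ξ₀) (f ξ₀).1)

lemma aestronglyMeasurable_dtnTransform (hμ : 0 < μ) (hc : 0 < c) (hσ : 0 < σ)
    {f : ℝ → TildeH d (1 / 2) G} (hf : AEStronglyMeasurable f) :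
    AEStronglyMeasurable (dtnTransform σ μ c f) :=
  (restrictCLM d (-1 / 2) G).continuous.comp_aestronglyMeasurable
    (aestronglyMeasurable_dtnOp hμ hc hσ (continuous_subtype_val.comp_aestronglyMeasurable hf))

lemma norm_dtnTransform_le (hμ : 0 < μ) (hc : 0 < c) (hσ : 0 < σ)
    (f : ℝ → TildeH d (1 / 2) G) (ξ₀ : ℝ) :
    ‖dtnTransform σ μ c f ξ₀‖ ≤ μ * (1 + c⁻¹) * ((3 + |σ|) * (1 + ξ₀ ^ 2)) * ‖f ξ₀‖ :=
  calc ‖dtnTransform σ μ c f ξ₀‖ ≤ ‖dtnOp d μ c (freq σ ξ₀) (f ξ₀).1‖ := norm_restrict_le _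
    _ ≤ μ * (1 + c⁻¹) * (2 + ‖freq σ ξ₀‖) * ‖(f ξ₀).1‖ := norm_dtnOp_le hμ hc (freq_im_pos hσ ξ₀) _
    _ ≤ _ := by
      refine mul_le_mul_of_nonneg_right ?_ (norm_nonneg _)
      gcongr
      exact two_add_norm_freq_le σ ξ₀

lemma exists_hasFourierLaplace_dtnTransform (hμ : 0 < μ) (hc : 0 < c) (hσ : 0 < σ) {s : ℝ}
    {φ : 𝓓'((⊤ : Opens ℝ), TildeH d (1 / 2) G)} {f : ℝ → TildeH d (1 / 2) G}
    (hf : HasFourierLaplace σ φ f) (hφ : spaceTimeNorm σ s tildeNorm φ < ⊤) :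
    ∃ ψ, HasFourierLaplace σ ψ (dtnTransform σ μ c f) := by
  have h1 : ∫⁻ ξ₀ : ℝ, ENNReal.ofReal (‖freq σ ξ₀‖ ^ (2 * s)) * ‖f ξ₀‖ₑ ^ 2 < ⊤ := by
    have h2 : spaceTimeNorm σ s tildeNorm φ ^ 2 < ⊤ := ENNReal.pow_lt_top hφ
    rw [hf.spaceTimeNorm_sq] at h2
    refine lt_of_le_of_lt ?_ (ENNReal.mul_lt_top (ENNReal.ofReal_lt_top (r := 1 + σ⁻¹)) h2)
    rw [← lintegral_const_mul' _ _ ENNReal.ofReal_ne_top]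
    refine lintegral_mono fun ξ₀ => ?_
    beta_reduce
    rw [mul_left_comm]
    exact mul_le_mul' le_rfl (enorm_sq_le_freqNorm hσ (le_norm_freq σ ξ₀) (f ξ₀).1)
  obtain ⟨N, hN⟩ := exists_integrable_growth hσ s hf.aestronglyMeasurable h1
  have hm := aestronglyMeasurable_dtnTransform hμ hc hσ hf.aestronglyMeasurable
  -- The two extra powers pay for the quadratic bound of the operator norm in `ξ₀`.
  refine exists_hasFourierLaplace σ hm (N + 2)
    ((hN.const_mul (μ * (1 + c⁻¹) * (3 + |σ|))).mono' ?_ (Filter.Eventually.of_forall fun x => ?_))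
  · refine AEStronglyMeasurable.mul (Continuous.aestronglyMeasurable ?_) hm.norm
    exact Continuous.rpow_const (by fun_prop) fun x => Or.inl (by positivity)
  · have hx0 : 0 < 1 + ‖x‖ := by positivity
    rw [Real.norm_of_nonneg (by positivity)]
    calc _ ≤ (1 + ‖x‖) ^ (-((N + 2 : ℕ) : ℝ)) *
          (μ * (1 + c⁻¹) * ((3 + |σ|) * (1 + x ^ 2)) * ‖f x‖) := by
          gcongr
          exact norm_dtnTransform_le hμ hc hσ f x
      _ ≤ (1 + ‖x‖) ^ (-((N + 2 : ℕ) : ℝ)) *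
          (μ * (1 + c⁻¹) * ((3 + |σ|) * (1 + ‖x‖) ^ 2) * ‖f x‖) := by
          gcongr
          rw [Real.norm_eq_abs]
          nlinarith [sq_abs x, abs_nonneg x]
      _ = ((1 + ‖x‖) ^ (-((N + 2 : ℕ) : ℝ)) * (1 + ‖x‖) ^ (2 : ℝ)) *
          (μ * (1 + c⁻¹) * (3 + |σ|) * ‖f x‖) := by
          rw [Real.rpow_two]; ring
      _ = _ := by
          rw [← Real.rpow_add hx0]
          push_cast
          ring_nf

lemma isDirichletToNeumann_of_hasFourierLaplace (hμ : 0 < μ) (hc : 0 < c) (hσ : 0 < σ)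
    {φ : 𝓓'((⊤ : Opens ℝ), TildeH d (1 / 2) G)} {ψ : 𝓓'((⊤ : Opens ℝ), QuotH d (-1 / 2) G)}
    {f : ℝ → TildeH d (1 / 2) G} (hf : HasFourierLaplace σ φ f)
    (hψ : HasFourierLaplace σ ψ (dtnTransform σ μ c f)) : IsDirichletToNeumann σ μ c G φ ψ :=
  ⟨f, _, fun ξ₀ => dtnOp d μ c (freq σ ξ₀) (f ξ₀).1, hf, hψ,
    Filter.Eventually.of_forall fun ξ₀ => dtnOp_ae_eq hμ hc (freq_im_pos hσ ξ₀) _,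
    Filter.Eventually.of_forall fun _ => rfl⟩

/-- The witnesses in the definition agree almost everywhere with the canonical ones, so every image
has the canonical transform and is unique. -/
lemma IsDirichletToNeumann.hasFourierLaplace (hμ : 0 < μ) (hc : 0 < c) (hσ : 0 < σ)
    {φ : 𝓓'((⊤ : Opens ℝ), TildeH d (1 / 2) G)} {ψ : 𝓓'((⊤ : Opens ℝ), QuotH d (-1 / 2) G)}
    (h : IsDirichletToNeumann σ μ c G φ ψ) {f : ℝ → TildeH d (1 / 2) G}
    (hf : HasFourierLaplace σ φ f) : HasFourierLaplace σ ψ (dtnTransform σ μ c f) := by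
  obtain ⟨f', k, F, hf', hk, hF, hkF⟩ := h
  refine hk.congr ?_
  filter_upwards [hF, hkF, hf.ae_eq hf'] with ξ₀ h1 h2 h3
  have h4 : F ξ₀ = dtnOp d μ c (freq σ ξ₀) (f ξ₀).1 := sobolev_ext (by
    filter_upwards [h1, dtnOp_ae_eq hμ hc (freq_im_pos hσ ξ₀) (f ξ₀).1] with ξ h5 h6
    rw [h5, h6, h3]
    rfl)
  rw [h2, h4]
  rfl

/-- Causality is proved for values in `H^{-1/2}(ℝ^d)`, before the restriction to `G`, which is
continuous and linear and commutes with the integral. -/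
lemma isVanishingOn_dtn (hμ : 0 < μ) (hc : 0 < c) (hσ : 0 < σ)
    {φ : 𝓓'((⊤ : Opens ℝ), TildeH d (1 / 2) G)} {ψ : 𝓓'((⊤ : Opens ℝ), QuotH d (-1 / 2) G)}
    {f : ℝ → TildeH d (1 / 2) G} (hf : HasFourierLaplace σ φ f)
    (hψ : HasFourierLaplace σ ψ (dtnTransform σ μ c f))
    (hφ : Distribution.IsVanishingOn φ (Set.Iio (0 : ℝ))) :
    Distribution.IsVanishingOn ψ (Set.Iio (0 : ℝ)) := by
  intro g hg
  set ι := (supportedIn d (1 / 2) (closure G)).subtypeL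
  have hfm : AEStronglyMeasurable fun ξ₀ => (f ξ₀).1 :=
    continuous_subtype_val.comp_aestronglyMeasurable hf.aestronglyMeasurable
  have hfi (k : 𝓢(ℝ, ℂ)) : Integrable fun ξ₀ => k ξ₀ • (f ξ₀).1 := ι.integrable_comp (hf.integrable k)
  have h0 (k : 𝓢(ℝ, ℂ)) (hk : tsupport (expMap ℝ k) ⊆ Set.Iio 0) : ∫ ξ₀, k ξ₀ • (f ξ₀).1 = 0 := by
    exact (ι.integral_comp_comm (hf.integrable k)).trans
      ((congrArg ι (hf.integral_eq_zero hφ hk)).trans (map_zero ι))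
  have h1 := integral_dtnOp_eq_zero hμ hc hσ hfm hfi h0 hg
  set k := expMapInv ℝ (expWeight σ g)
  have hi : Integrable fun ξ₀ => k ξ₀ • dtnOp d μ c (freq σ ξ₀) (f ξ₀).1 := by
    refine ((integrable_schwartz_growth hfi σ k).const_mul (μ * (1 + c⁻¹))).mono'
      (k.continuous.aestronglyMeasurable.smul (aestronglyMeasurable_dtnOp hμ hc hσ hfm))
      (Filter.Eventually.of_forall fun ξ₀ => ?_)
    rw [norm_smul]
    calc _ ≤ ‖k ξ₀‖ * (μ * (1 + c⁻¹) * (2 + ‖freq σ ξ₀‖) * ‖(f ξ₀).1‖) := by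
          gcongr
          exact norm_dtnOp_le hμ hc (freq_im_pos hσ ξ₀) _
      _ ≤ ‖k ξ₀‖ * (μ * (1 + c⁻¹) * ((3 + |σ|) * (1 + ξ₀ ^ 2)) * ‖(f ξ₀).1‖) := by
          gcongr
          exact two_add_norm_freq_le σ ξ₀
      _ = _ := by ring
  have h2 := (restrictCLM d (-1 / 2) G).integral_comp_comm hi
  rw [h1, map_zero] at h2
  refine (hψ.apply_eq g).trans (Eq.trans ?_ h2)
  congr 1

lemma spaceTimeNorm_dtn_le (hμ : 0 < μ) (hc : 0 < c) (hσ : 0 < σ)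
    {φ : 𝓓'((⊤ : Opens ℝ), TildeH d (1 / 2) G)} {ψ : 𝓓'((⊤ : Opens ℝ), QuotH d (-1 / 2) G)}
    {f : ℝ → TildeH d (1 / 2) G} (hf : HasFourierLaplace σ φ f)
    (hψ : HasFourierLaplace σ ψ (dtnTransform σ μ c f)) (s : ℝ) :
    spaceTimeNorm σ s quotNorm ψ ≤
      (μ * (1 + c⁻¹)).toNNReal * spaceTimeNorm σ s tildeNorm φ := by
  refine (ENNReal.pow_le_pow_left_iff two_ne_zero).1 ?_
  rw [mul_pow, hf.spaceTimeNorm_sq, hψ.spaceTimeNorm_sq,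
    ← lintegral_const_mul' _ _ (ENNReal.pow_ne_top ENNReal.coe_ne_top)]
  refine lintegral_mono fun ξ₀ => ?_
  beta_reduce
  rw [mul_left_comm]
  exact mul_le_mul' le_rfl (quotNorm_dtnOp_sq_le hμ hc (freq_im_pos hσ ξ₀) (f ξ₀))

lemma isDualPairing_dtn (hG : IsLipschitzDomain G) (hbdd : Bornology.IsBounded G)
    (f : ℝ → TildeH d (1 / 2) G) (ξ₀ : ℝ) :
    IsDualPairing (dtnTransform σ μ c f ξ₀) (f ξ₀)
      (sobolevPairing (dtnOp d μ c (freq σ ξ₀) (f ξ₀).1) (f ξ₀).1) := by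
  intro u hu
  rw [← sub_eq_zero, ← sobolevPairing_sub_left]
  exact sobolevPairing_eq_zero hG hbdd ((Submodule.Quotient.eq _).1 hu) (f ξ₀).2

lemma lintegral_enorm_dtnPairing_le (hμ : 0 < μ) (hc : 0 < c) (hσ : 0 < σ)
    {φ : 𝓓'((⊤ : Opens ℝ), TildeH d (1 / 2) G)} {f : ℝ → TildeH d (1 / 2) G}
    (hf : HasFourierLaplace σ φ f) :
    ∫⁻ ξ₀, ‖sobolevPairing (dtnOp d μ c (freq σ ξ₀) (f ξ₀).1) (f ξ₀).1‖ₑ ≤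
      ENNReal.ofReal (((2 * Real.pi) ^ d)⁻¹ * (μ * (1 + c⁻¹))) *
        spaceTimeNorm σ 0 tildeNorm φ ^ 2 := by
  rw [hf.spaceTimeNorm_sq, ← lintegral_const_mul' _ _ ENNReal.ofReal_ne_top]
  refine lintegral_mono fun ξ₀ => ?_
  have h := enorm_sobolevPairing_dtnOp_le hμ hc (freq_im_pos hσ ξ₀) (f ξ₀).1
  rw [mul_zero, Real.rpow_zero, ENNReal.ofReal_one, one_mul]
  exact h

lemma integrable_dtnPairing (hμ : 0 < μ) (hc : 0 < c) (hσ : 0 < σ)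
    {φ : 𝓓'((⊤ : Opens ℝ), TildeH d (1 / 2) G)} {f : ℝ → TildeH d (1 / 2) G}
    (hf : HasFourierLaplace σ φ f) (hφ : spaceTimeNorm σ 0 tildeNorm φ < ⊤) :
    Integrable fun ξ₀ => sobolevPairing (dtnOp d μ c (freq σ ξ₀) (f ξ₀).1) (f ξ₀).1 := by
  have hfm : AEStronglyMeasurable fun ξ₀ => (f ξ₀).1 :=
    continuous_subtype_val.comp_aestronglyMeasurable hf.aestronglyMeasurable
  have hFm := aestronglyMeasurable_dtnOp hμ hc hσ hfm
  have hpm := continuous_sobolevPairing.comp_aestronglyMeasurable (hFm.prodMk hfm)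
  have hfin : ENNReal.ofReal (((2 * Real.pi) ^ d)⁻¹ * (μ * (1 + c⁻¹))) *
      spaceTimeNorm σ 0 tildeNorm φ ^ 2 < ⊤ :=
    ENNReal.mul_lt_top ENNReal.ofReal_lt_top (ENNReal.pow_lt_top hφ)
  refine ⟨hpm, ?_⟩
  exact (lintegral_enorm_dtnPairing_le hμ hc hσ hf).trans_lt hfin

lemma le_lintegral_re_dtnPairing (hμ : 0 < μ) (hc : 0 < c) (hσ : 0 < σ)
    {φ : 𝓓'((⊤ : Opens ℝ), TildeH d (1 / 2) G)} {f : ℝ → TildeH d (1 / 2) G}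
    (hf : HasFourierLaplace σ φ f) :
    ENNReal.ofReal (((2 * Real.pi) ^ d)⁻¹ * (μ * (σ / √(2 + c ^ 2)))) *
      spaceTimeNorm σ (-1 / 2) tildeNorm φ ^ 2 ≤
    ∫⁻ ξ₀, ENNReal.ofReal (sobolevPairing (dtnOp d μ c (freq σ ξ₀) (f ξ₀).1) (f ξ₀).1).re := by
  rw [hf.spaceTimeNorm_sq, ← lintegral_const_mul' _ _ ENNReal.ofReal_ne_top]
  refine lintegral_mono fun ξ₀ => ?_
  have h := (le_re_sobolevPairing_dtnOp hμ hc (freq_im_pos hσ ξ₀) (f ξ₀).1).2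
  have him : (freq σ ξ₀).im = σ := by simp
  rw [him, ← mul_assoc, ← mul_assoc, ENNReal.ofReal_mul (by positivity)] at h
  -- The weight `|ω|^{2s}` at `s = -1/2` is exactly the factor `|ω|⁻¹` lost in the lower bound of
  -- the symbol.
  rw [← mul_assoc, ← mul_assoc, show (2 * (-1 / 2) : ℝ) = -1 by norm_num, Real.rpow_neg_one]
  exact h

lemma exists_isSpaceTimePairing (hG : IsLipschitzDomain G) (hbdd : Bornology.IsBounded G)
    (hμ : 0 < μ) (hc : 0 < c) (hσ : 0 < σ)
    {φ : 𝓓'((⊤ : Opens ℝ), TildeH d (1 / 2) G)} {ψ : 𝓓'((⊤ : Opens ℝ), QuotH d (-1 / 2) G)}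
    {f : ℝ → TildeH d (1 / 2) G} (hf : HasFourierLaplace σ φ f)
    (hψ : HasFourierLaplace σ ψ (dtnTransform σ μ c f))
    (hφ : spaceTimeNorm σ 0 tildeNorm φ < ⊤) :
    ∃ z : ℂ, IsSpaceTimePairing σ ψ φ z ∧
      ((2 * Real.pi)⁻¹ * (((2 * Real.pi) ^ d)⁻¹ * (μ * (σ / √(2 + c ^ 2))))).toNNReal *
        spaceTimeNorm σ (-1 / 2) tildeNorm φ ^ 2 ≤ ENNReal.ofReal z.re ∧
      ‖z‖ₑ ≤ ((2 * Real.pi)⁻¹ * (((2 * Real.pi) ^ d)⁻¹ * (μ * (1 + c⁻¹)))).toNNReal *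
        spaceTimeNorm σ 0 tildeNorm φ ^ 2 := by
  have hup := lintegral_enorm_dtnPairing_le hμ hc hσ hf
  have hpi := integrable_dtnPairing hμ hc hσ hf hφ
  have hlow := le_lintegral_re_dtnPairing hμ hc hσ hf
  have hnn (ξ₀ : ℝ) := (le_re_sobolevPairing_dtnOp hμ hc (freq_im_pos hσ ξ₀) (f ξ₀).1).1
  have hdual := isDualPairing_dtn (σ := σ) (μ := μ) (c := c) hG hbdd f
  set p : ℝ → ℂ := fun ξ₀ => sobolevPairing (dtnOp d μ c (freq σ ξ₀) (f ξ₀).1) (f ξ₀).1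
  refine ⟨((2 * Real.pi : ℝ) : ℂ)⁻¹ * ∫ ξ₀, p ξ₀, ⟨_, f, p, hψ, hf,
    Filter.Eventually.of_forall hdual, hpi, rfl⟩, ?_, ?_⟩
  · have h1 : (((2 * Real.pi : ℝ) : ℂ)⁻¹ * ∫ ξ₀, p ξ₀).re =
        (2 * Real.pi)⁻¹ * ∫ ξ₀, (p ξ₀).re := by
      rw [← ofReal_inv, re_ofReal_mul]
      congr 1
      exact (reCLM.integral_comp_comm hpi).symm
    have h2 : ENNReal.ofReal (∫ ξ₀, (p ξ₀).re) = ∫⁻ ξ₀, ENNReal.ofReal (p ξ₀).re :=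
      ofReal_integral_eq_lintegral_ofReal hpi.re (Filter.Eventually.of_forall hnn)
    rw [h1, ENNReal.ofReal_mul (by positivity), h2, ← ENNReal.ofReal,
      ENNReal.ofReal_mul (by positivity), mul_assoc]
    exact mul_le_mul' le_rfl hlow
  · have h1 : ‖((2 * Real.pi : ℝ) : ℂ)⁻¹‖ₑ = ENNReal.ofReal (2 * Real.pi)⁻¹ := by
      rw [← ofReal_norm, norm_inv, norm_real, Real.norm_of_nonneg (by positivity)]
    rw [enorm_mul, h1, ← ENNReal.ofReal, ENNReal.ofReal_mul (by positivity), mul_assoc]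
    exact mul_le_mul' le_rfl ((enorm_integral_le_lintegral_enorm p).trans hup)

end MainResult

end DtN
end

/-! ### The theorem -/

open DtN
theorem theorem4p1 {d : ℕ} (G : Set (Space d)) (hG : IsLipschitzDomain G)
    (hbdd : Bornology.IsBounded G) (μ c : ℝ) (hμ : 0 < μ) (hc : 0 < c) :
    (∀ σ : ℝ, 0 < σ → ∀ s : ℝ, ∃ C : ℝ≥0,
      ∀ φ ∈ spaceTimeSobolev σ s (tildeNorm (r := 1 / 2) (G := G)),
        (∃! ψ, IsDirichletToNeumann σ μ c G φ ψ) ∧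
        ∀ ψ, IsDirichletToNeumann σ μ c G φ ψ →
          ψ ∈ spaceTimeSobolev σ s quotNorm ∧
          spaceTimeNorm σ s quotNorm ψ ≤ C * spaceTimeNorm σ s tildeNorm φ) ∧
    ∃ C : ℝ≥0, ∀ σ : ℝ, 0 < σ → ∃ κ : ℝ≥0, 0 < κ ∧
      ∀ φ ∈ spaceTimeSobolev σ 0 (tildeNorm (r := 1 / 2) (G := G)),
        ∀ ψ, IsDirichletToNeumann σ μ c G φ ψ →
          ∃ z : ℂ, IsSpaceTimePairing σ ψ φ z ∧
            κ * spaceTimeNorm σ (-1 / 2) tildeNorm φ ^ 2 ≤ ENNReal.ofReal z.re ∧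
            ‖z‖ₑ ≤ C * spaceTimeNorm σ 0 tildeNorm φ ^ 2 := by
  -- The upper constants carry only the bound of the symbol and, for the form, the Plancherel
  -- factors; `σ` enters only the coercivity constant, linearly.
  refine ⟨fun σ hσ s => ⟨(μ * (1 + c⁻¹)).toNNReal, fun φ hφ => ?_⟩,
    ((2 * Real.pi)⁻¹ * (((2 * Real.pi) ^ d)⁻¹ * (μ * (1 + c⁻¹)))).toNNReal, fun σ hσ =>
    ⟨((2 * Real.pi)⁻¹ * (((2 * Real.pi) ^ d)⁻¹ * (μ * (σ / √(2 + c ^ 2))))).toNNReal,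
      Real.toNNReal_pos.2 (by positivity), fun φ hφ ψ hψ => ?_⟩⟩
  · obtain ⟨f, hf⟩ := exists_hasFourierLaplace_of_spaceTimeNorm_lt_top hφ.2.2
    obtain ⟨ψ₀, hψ₀⟩ := exists_hasFourierLaplace_dtnTransform hμ hc hσ hf hφ.2.2
    refine ⟨⟨ψ₀, isDirichletToNeumann_of_hasFourierLaplace hμ hc hσ hf hψ₀, fun ψ hψ =>
      (hψ.hasFourierLaplace hμ hc hσ hf).unique hψ₀⟩, fun ψ hψ => ?_⟩
    have h := hψ.hasFourierLaplace hμ hc hσ hf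
    have hle := spaceTimeNorm_dtn_le hμ hc hσ hf h s
    exact ⟨⟨isVanishingOn_dtn hμ hc hσ hf h hφ.1, h.exists_isExpWeighted,
      hle.trans_lt (ENNReal.mul_lt_top ENNReal.coe_lt_top hφ.2.2)⟩, hle⟩
  · obtain ⟨f, hf⟩ := exists_hasFourierLaplace_of_spaceTimeNorm_lt_top hφ.2.2
    exact exists_isSpaceTimePairing hG hbdd hμ hc hσ hf (hψ.hasFourierLaplace hμ hc hσ hf) hφ.2.2
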